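/- Let $k\ge 0$. A randomized algorithm with access to $k$ coins is a computable procedure that at each step may flip one of the coins, read the next binary digit of a random variable $U$, read a dyadic approximation $a_n/2^n$ with $a_n\in\mathbb{N}$ and $|a_n/2^n-x|\le 2^{-n}$, with $n$ of its choice, of one of its real inputs $x\in\{C_1,\dots,C_k,M\}$, or halt with an output in $\{0,1\}$. Here $U$ is uniform on $[0,1]$, the flips of coin $i$ are Bernoulli with (unknown) mean $p_i\in[0,1]$, and $U$ and all flips are independent. Its running time is the total number $T=T_1+\dots+T_k$ of coin flips it makes, where $T_i\in\{0,1,2,\dots\}$ is the number of flips of coin $i$. **Theorem 1.** For every $k$ there is a randomized algorithm (a multivariate Bernoulli factory) with the following property. For all inputs $C_1,\dots,C_k\ge 0$ and $M<1/2$ (given by arbitrary such sequences of approximations), and all $p\in[0,1]^k$ such that $$r=C_1p_1+\dots+C_kp_k\le M,$$ the algorithm halts with probability one, its output is Bernoulli with mean $r$, and, with $C=C_1+\dots+C_k$, $$\mathbb{E}[T]\le \frac{C}{(1-2M)(1+r)}+r\cdot\left[C\cdot\frac{15.2}{1-2M+r}\right].$$ Moreover, for fixed $C$, the right-hand side tends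 to $C$ as $M\to 0^+$, whenever $0\le r=r(M)\le M$. -/

import Mathlib

open MeasureTheory ProbabilityTheory Filter Topology

/-- The instructions of a randomized algorithm that has access to `k` coins, to the binary digits
of one random real `U`, and to the input reals `C₁, …, C_k` and `M`. Each instruction except
`halt` is answered by a natural number. -/
inductive CoinInstr (k : ℕ) : Type
  /-- Stop and output `b`. -/
  | halt (b : Bool)
  /-- Flip coin `i`: the answer is `1` for heads and `0` for tails. -/
  | flip (i : Fin k)
  /-- Ask for the next unread binary digit of `U`. -/
  | digit
  /-- Ask for an approximation of `C i` with precision `2⁻ⁿ`. -/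
  | readC (i : Fin k) (n : ℕ)
  /-- Ask for an approximation of `M` with precision `2⁻ⁿ`. -/
  | readM (n : ℕ)

namespace CoinInstr

/-- Instructions as a disjoint sum of standard types, which fixes their coding by numbers. -/
def equivSum (k : ℕ) : CoinInstr k ≃ (Bool ⊕ Fin k ⊕ Unit ⊕ (Fin k × ℕ) ⊕ ℕ) where
  toFun
    | halt b => .inl b
    | flip i => .inr (.inl i)
    | digit => .inr (.inr (.inl ()))
    | readC i n => .inr (.inr (.inr (.inl (i, n))))
    | readM n => .inr (.inr (.inr (.inr n)))
  invFun
    | .inl b => halt b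
    | .inr (.inl i) => flip i
    | .inr (.inr (.inl _)) => digit
    | .inr (.inr (.inr (.inl q))) => readC q.1 q.2
    | .inr (.inr (.inr (.inr n))) => readM n
  left_inv := by rintro (_ | _ | _ | _ | _) <;> rfl
  right_inv := by rintro (_ | _ | _ | _ | _) <;> rfl

instance (k : ℕ) : Primcodable (CoinInstr k) := Primcodable.ofEquiv _ (equivSum k)

end CoinInstr

/-- A randomized algorithm using `k` coins: an interactive machine with countably many (coded)
states, whose next instruction is a computable function of the current state, and whose next
state is a computable function of the current state and of the answer received. -/
structure CoinAlgorithm (k : ℕ) where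
  /-- The states. -/
  State : Type
  /-- The coding of the states by natural numbers. -/
  [coding : Primcodable State]
  /-- The initial state. -/
  start : State
  /-- The instruction issued in a state. -/
  instr : State → CoinInstr k
  /-- The state reached from a state by an answer. -/
  next : State → ℕ → State
  /-- The instruction is computed from the state. -/
  instr_computable : Computable instr
  /-- The new state is computed from the old state and the answer. -/
  next_computable : Computable₂ next

attribute [instance] CoinAlgorithm.coding

/-- `a` is a name (a sequence of dyadic approximations `a n / 2ⁿ` with error at most `2⁻ⁿ`)
of the real number `x`. -/
def IsRealName (a : ℕ → ℕ) (x : ℝ) : Prop :=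
  ∀ n, |(a n : ℝ) / 2 ^ n - x| ≤ 1 / 2 ^ n

/-- The binary digit of `u` at the position of weight `2^{-(j+1)}`. -/
noncomputable def binaryDigit (u : ℝ) (j : ℕ) : ℕ := ⌊2 ^ (j + 1) * u⌋₊ % 2

namespace CoinAlgorithm

variable {k : ℕ}

/-- A configuration of a run: the state, the number of flips of each coin made so far, and the
number of digits of `U` read so far. -/
structure Config (A : CoinAlgorithm k) where
  /-- The current state. -/
  state : A.State
  /-- How often each coin has been flipped. -/
  flips : Fin k → ℕ
  /-- How many digits of `U` have been read. -/
  digits : ℕ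

/-- One step, with names `c i` of `C i` and `m` of `M`, on the value `u` of `U` and the flips
`x i 0, x i 1, …` of the coins: the next flip of coin `i` is the first one not yet seen. A halted
configuration does not change. -/
noncomputable def step (A : CoinAlgorithm k) (c : Fin k → ℕ → ℕ) (m : ℕ → ℕ)
    (u : ℝ) (x : Fin k → ℕ → Bool) (s : A.Config) : A.Config :=
  match A.instr s.state with
  | .halt _ => s
  | .flip i =>
      { state := A.next s.state (if x i (s.flips i) = true then 1 else 0)
        flips := Function.update s.flips i (s.flips i + 1)
        digits := s.digits }
  | .digit =>
      { state := A.next s.state (binaryDigit u s.digits)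
        flips := s.flips
        digits := s.digits + 1 }
  | .readC i n => { s with state := A.next s.state (c i n) }
  | .readM n => { s with state := A.next s.state (m n) }

/-- The configuration after `t` steps. -/
noncomputable def run (A : CoinAlgorithm k) (c : Fin k → ℕ → ℕ) (m : ℕ → ℕ)
    (u : ℝ) (x : Fin k → ℕ → Bool) (t : ℕ) : A.Config :=
  (A.step c m u x)^[t] { state := A.start, flips := fun _ => 0, digits := 0 }

/-- The algorithm halts with output `b`. -/
def Outputs (A : CoinAlgorithm k) (c : Fin k → ℕ → ℕ) (m : ℕ → ℕ)
    (u : ℝ) (x : Fin k → ℕ → Bool) (b : Bool) : Prop :=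
  ∃ t, A.instr (A.run c m u x t).state = .halt b

/-- The running time `T₁ + ⋯ + T_k`: the total number of coin flips made in the whole run
(infinite if there are infinitely many). -/
noncomputable def totalFlips (A : CoinAlgorithm k) (c : Fin k → ℕ → ℕ) (m : ℕ → ℕ)
    (u : ℝ) (x : Fin k → ℕ → Bool) : ENNReal :=
  ∑ i, ⨆ t, ((A.run c m u x t).flips i : ENNReal)

end CoinAlgorithm

/-- `U` is uniform on `[0,1]`, `X i j` (the `j`-th flip of coin `i`) is Bernoulli with mean `p i`,
and `U` and all the `X i j` are independent. -/
structure IsCoinModel {Ω : Type*} [MeasurableSpace Ω] (μ : Measure Ω) {k : ℕ} (p : Fin k → ℝ)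
    (U : Ω → ℝ) (X : Fin k → ℕ → Ω → Bool) : Prop where
  measurable_U : Measurable U
  measurable_X : ∀ i j, Measurable (X i j)
  law_U : μ.map U = volume.restrict (Set.Icc 0 1)
  law_X : ∀ i j, μ {ω | X i j ω = true} = ENNReal.ofReal (p i)
  indep_X : iIndepFun (fun ij : Fin k × ℕ => X ij.1 ij.2) μ
  indep_U_X : IndepFun U (fun ω (ij : Fin k × ℕ) => X ij.1 ij.2 ω) μ

/-- The bound on the expected number of flips, in terms of `C = C₁ + ⋯ + C_k`, `M` and `r`. -/
noncomputable def smallMeanFlipBound (C M r : ℝ) : ℝ :=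
  C / ((1 - 2 * M) * (1 + r)) + r * (C * (15.2 / (1 - 2 * M + r)))

/-!
The algorithm. Let `r = ∑ i, C i * p i` and `C = ∑ i, C i`. A *race* between the option to stop,
with weight `w`, and the coins, where coin `i` has weight `v * C i`, repeatedly selects an option
with probability proportional to its weight, and flips the coin if one is selected; it ends when
the option to stop is selected or a coin shows heads. The coins win with odds `v * r : w`, and the
expected number of flips is `v * C / (w + v * r)`.

The initial race has `w = 1 - 2 * M` and `v = 1`. If it stops, the output is `false`. If the coins
win, which has probability `r / (1 - 2 * M + r)`, the output should be `true` with probability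
`1 - 2 * M + r`. So the output is `true` with probability `1 - 2 * M`, and otherwise a random bit
of mean `r / (2 * M) ≤ 1 / 2` is produced. For this, at level `E ≥ 2` let
`ρ = (1 - 1 / E) * r / M`, which is at most `1 - 1 / E` and equals `r / (2 * M)` for `E = 2`.
A bit of mean `ρ ^ n` is produced by a random walk that starts at `n` and goes left if the coins
win a race with odds `ρ : 1`, and right otherwise, since `ρ ^ n` is harmonic for this walk; on
reaching `0` the output is `true`. If the walk reaches `4 * E`, the bit of mean `ρ ^ (4 * E)` is
obtained as the product of a bit whose mean `((2 * E - 2) / (2 * E - 1)) ^ (4 * E)` is known and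
of a bit of mean `ρ' ^ (4 * E)`, where `ρ'` is the ratio of level `2 * E`. As the known mean is at
most `1 / 7` while the cost of a level grows like `E ^ 2`, the expected number of flips of the walk
is at most `13 * C / (2 * M)` (`levelCost_double_le`, `levelCost_two_one_le`). It is entered with
probability `2 * M * r / (1 - 2 * M + r)`, and the total
`C / (1 - 2 * M + r) + 13 * C * r / (1 - 2 * M + r)` is below the claimed bound.

The proof. A run is a Markov chain on configurations, because the event of being in a given
configuration depends only on the bits seen in it, and these are independent of the next bit
(`CoinAlgorithm.measure_run_eq_inter`). So every nonnegative function of the state which, in the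
mean, decreases in each step by at least the cost of the step bounds the expected total cost of the
run (`CoinAlgorithm.IsSupersolution`). Three such functions suffice: the probabilities of the
outputs `true` and `false` bound the probability of each output from above
(`isRaceBound_trueProbability`), and a cost function, in which every step costs `eta > 0` and every
flip costs `1`, shows that the algorithm halts almost surely, hence that both bounds are
equalities, and bounds the number of flips as `eta` tends to `0` (`isRaceBound_totalCost`).

Bits of a mean `q` that is only known through approximations are drawn by comparing `q` with a
uniform random variable, digit by digit. This is done once and for all by compiling machines that
may request such bits (`BernoulliMachine.compile`), for which supersolutions are described by
`BernoulliMachine.IsSupersolution`. The races are run without divisions by real numbers: an option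
is chosen uniformly at random and is accepted with probability its weight divided by a common
integer bound `B`, which is computed from the inputs.
-/

/-! ### The binary digits of a uniform random variable -/

lemma measurable_binaryDigit (j : ℕ) : Measurable fun u => binaryDigit u j :=
  (measurable_from_top (f := fun n : ℕ => n % 2)).comp
    (Nat.measurable_floor.comp (measurable_const.mul measurable_id))

lemma binaryDigit_lt_two (u : ℝ) (j : ℕ) : binaryDigit u j < 2 := Nat.mod_lt _ two_pos

/-- The probability that a fair bit lies in `T`. -/
noncomputable def fairBitMass (T : Set ℕ) : ENNReal :=
  open Classical in (if 0 ∈ T then 2⁻¹ else 0) + (if 1 ∈ T then 2⁻¹ else 0)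

lemma fairBitMass_univ : fairBitMass Set.univ = 1 := by
  simp [fairBitMass, ENNReal.inv_two_add_inv_two]

lemma binaryDigit_zero_of_mem_Ico_zero_half {u : ℝ} (hu : 2 * u ∈ Set.Ico (0 : ℝ) 1) :
    binaryDigit u 0 = 0 := by
  have : ⌊2 * u⌋₊ = 0 := Nat.floor_eq_zero.2 hu.2
  simp [binaryDigit, this]

lemma binaryDigit_zero_of_mem_Ico_half_one {u : ℝ} (hu : 2 * u - 1 ∈ Set.Ico (0 : ℝ) 1) :
    binaryDigit u 0 = 1 := by
  have : ⌊2 * u⌋₊ = 1 := by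
    rw [Nat.floor_eq_iff (by linarith [hu.1])]
    constructor <;> push_cast <;> linarith [hu.1, hu.2]
  simp [binaryDigit, this]

lemma binaryDigit_succ (u : ℝ) (j : ℕ) : binaryDigit u (j + 1) = binaryDigit (2 * u) j := by
  simp only [binaryDigit]
  ring_nf

lemma binaryDigit_succ' {u : ℝ} (hu : 0 ≤ 2 * u - 1) (j : ℕ) :
    binaryDigit u (j + 1) = binaryDigit (2 * u - 1) j := by
  have h : (2 : ℝ) ^ (j + 1) * (2 * u - 1) = 2 ^ (j + 1 + 1) * u - ((2 ^ (j + 1) : ℕ) : ℝ) := by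
    push_cast; ring
  have h0 : 0 ≤ (2 : ℝ) ^ (j + 1) * (2 * u - 1) := by positivity
  simp only [binaryDigit]
  have h1 : 2 ^ (j + 1) ≤ ⌊(2 : ℝ) ^ (j + 1 + 1) * u⌋₊ := by
    apply Nat.le_floor
    rw [h] at h0
    linarith
  rw [h, Nat.floor_sub_natCast]
  have h2 : 2 ^ (j + 1) = 2 * 2 ^ j := by ring
  omega

/-- The digits of a number in `[0,1)` behave as fair independent bits. -/
lemma volume_binaryDigit_mem (N : ℕ) (T : ℕ → Set ℕ) :
    volume {u : ℝ | u ∈ Set.Ico (0 : ℝ) 1 ∧ ∀ j < N, binaryDigit u j ∈ T j}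
      = ∏ j ∈ Finset.range N, fairBitMass (T j) := by
  induction N generalizing T with
  | zero =>
    have : {u : ℝ | u ∈ Set.Ico (0 : ℝ) 1 ∧ ∀ j < 0, binaryDigit u j ∈ T j} = Set.Ico 0 1 := by
      ext u; simp
    rw [this]; simp
  | succ N ih =>
    set S := {u : ℝ | u ∈ Set.Ico (0 : ℝ) 1 ∧ ∀ j < N, binaryDigit u j ∈ T (j + 1)} with hS
    have hSm : MeasurableSet S := by
      have : S = Set.Ico (0 : ℝ) 1 ∩ ⋂ j ∈ Set.Iio N, {u | binaryDigit u j ∈ T (j + 1)} := by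
        ext u; simp [hS]
      rw [this]
      exact measurableSet_Ico.inter (MeasurableSet.biInter (Set.to_countable _) fun j _ =>
        measurable_binaryDigit j (MeasurableSet.of_discrete))
    have hpre : ∀ b : ℝ, volume {u : ℝ | 2 * u - b ∈ S} = 2⁻¹ * volume S := by
      intro b
      have h1 : {u : ℝ | 2 * u - b ∈ S} = (fun u => 2 * u) ⁻¹' ((fun u => u - b) ⁻¹' S) := rfl
      have h3 : ENNReal.ofReal |(2 : ℝ)⁻¹| = 2⁻¹ := by
        rw [abs_of_pos (by norm_num), ENNReal.ofReal_inv_of_pos (by norm_num)]; simp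
      rw [h1, Real.volume_preimage_mul_left (by norm_num), h3]
      congr 1
      simp only [sub_eq_add_neg]
      exact measure_preimage_add_right _ _ _
    have hsplit : {u : ℝ | u ∈ Set.Ico (0 : ℝ) 1 ∧ ∀ j < N + 1, binaryDigit u j ∈ T j}
        = {u | 0 ∈ T 0 ∧ 2 * u - 0 ∈ S} ∪ {u | 1 ∈ T 0 ∧ 2 * u - 1 ∈ S} := by
      ext u
      simp only [Set.mem_ofPred_eq, Set.mem_union, sub_zero, hS]
      constructor
      · rintro ⟨hu, h⟩
        rcases lt_or_ge (2 * u) 1 with hlt | hge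
        · have hm : 2 * u ∈ Set.Ico (0 : ℝ) 1 := ⟨by linarith [hu.1], hlt⟩
          refine Or.inl ⟨?_, hm, fun j hj => ?_⟩
          · have h0 := h 0 (by omega)
            rwa [binaryDigit_zero_of_mem_Ico_zero_half hm] at h0
          · rw [← binaryDigit_succ]; exact h _ (by omega)
        · have hm : 2 * u - 1 ∈ Set.Ico (0 : ℝ) 1 := ⟨by linarith, by linarith [hu.2]⟩
          refine Or.inr ⟨?_, hm, fun j hj => ?_⟩
          · have h0 := h 0 (by omega)
            rwa [binaryDigit_zero_of_mem_Ico_half_one hm] at h0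
          · rw [← binaryDigit_succ' hm.1]; exact h _ (by omega)
      · rintro (⟨h0, hm, h⟩ | ⟨h0, hm, h⟩)
        · refine ⟨⟨by linarith [hm.1], by linarith [hm.1, hm.2]⟩, fun j hj => ?_⟩
          rcases j with _ | j
          · rwa [binaryDigit_zero_of_mem_Ico_zero_half hm]
          · rw [binaryDigit_succ]; exact h _ (by omega)
        · refine ⟨⟨by linarith [hm.1], by linarith [hm.1, hm.2]⟩, fun j hj => ?_⟩
          rcases j with _ | j
          · rwa [binaryDigit_zero_of_mem_Ico_half_one hm]
          · rw [binaryDigit_succ' hm.1]; exact h _ (by omega)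
    have hmeas : ∀ b : ℝ, MeasurableSet {u : ℝ | 2 * u - b ∈ S} := fun b =>
      ((measurable_const.mul measurable_id).sub measurable_const) hSm
    have hpart : ∀ (b : ℕ), volume {u : ℝ | b ∈ T 0 ∧ 2 * u - (b : ℝ) ∈ S}
        = open Classical in (if b ∈ T 0 then 2⁻¹ else 0) * volume S := by
      intro b
      by_cases hb : b ∈ T 0
      · simp [hb, hpre]
      · simp [hb]
    have h0 := hpart 0
    have h1 := hpart 1
    rw [Nat.cast_zero] at h0
    rw [Nat.cast_one] at h1
    rw [hsplit, measure_union, h0, h1, ih, Finset.prod_range_succ', fairBitMass, ← add_mul,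
      mul_comm]
    · refine Set.disjoint_left.2 ?_
      rintro u ⟨-, hu⟩ ⟨-, hu'⟩
      have := hu.1.2
      have := hu'.1.1
      linarith
    · by_cases hb : 1 ∈ T 0
      · simpa [hb] using hmeas 1
      · simp [hb]

section UniformDigits

variable {Ω : Type*} [MeasurableSpace Ω] {μ : Measure Ω} {U : Ω → ℝ}

lemma measure_forall_binaryDigit_mem (hU : Measurable U)
    (hlaw : μ.map U = volume.restrict (Set.Icc 0 1)) (S : Finset ℕ) (T : ℕ → Set ℕ) :
    μ (⋂ j ∈ S, (fun ω => binaryDigit (U ω) j) ⁻¹' T j) = ∏ j ∈ S, fairBitMass (T j) := by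
  classical
  obtain ⟨N, hN⟩ := S.exists_nat_subset_range
  set T' : ℕ → Set ℕ := fun j => if j ∈ S then T j else Set.univ with hT'
  have hm : MeasurableSet {u : ℝ | ∀ j ∈ S, binaryDigit u j ∈ T j} := by
    have : {u : ℝ | ∀ j ∈ S, binaryDigit u j ∈ T j}
        = ⋂ j ∈ S, {u | binaryDigit u j ∈ T j} := by ext; simp
    rw [this]
    exact Finset.measurableSet_biInter _ fun j _ =>
      measurable_binaryDigit j (MeasurableSet.of_discrete)
  have h1 : (⋂ j ∈ S, (fun ω => binaryDigit (U ω) j) ⁻¹' T j)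
      = U ⁻¹' {u : ℝ | ∀ j ∈ S, binaryDigit u j ∈ T j} := by ext; simp
  have h2 : {u : ℝ | ∀ j ∈ S, binaryDigit u j ∈ T j} ∩ Set.Ico 0 1
      = {u : ℝ | u ∈ Set.Ico (0 : ℝ) 1 ∧ ∀ j < N, binaryDigit u j ∈ T' j} := by
    ext u
    simp only [Set.mem_inter_iff, Set.mem_ofPred_eq, hT']
    constructor
    · rintro ⟨h, hu⟩
      refine ⟨hu, fun j _ => ?_⟩
      by_cases hj : j ∈ S <;> simp [hj, h]
    · rintro ⟨hu, h⟩
      refine ⟨fun j hj => ?_, hu⟩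
      simpa [hj] using h j (Finset.mem_range.1 (hN hj))
  rw [h1, ← Measure.map_apply hU hm, hlaw, ← Measure.restrict_congr_set Ico_ae_eq_Icc,
    Measure.restrict_apply hm, h2, volume_binaryDigit_mem]
  symm
  refine Finset.prod_subset_one_on_sdiff hN (fun j hj => ?_) (fun j hj => ?_)
  · simp [hT', (Finset.mem_sdiff.1 hj).2, fairBitMass_univ]
  · simp [hT', hj]

lemma measure_binaryDigit_mem (hU : Measurable U)
    (hlaw : μ.map U = volume.restrict (Set.Icc 0 1)) (j : ℕ) (T : Set ℕ) :
    μ ((fun ω => binaryDigit (U ω) j) ⁻¹' T) = fairBitMass T := by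
  simpa using measure_forall_binaryDigit_mem hU hlaw {j} fun _ => T

lemma measure_binaryDigit_eq (hU : Measurable U)
    (hlaw : μ.map U = volume.restrict (Set.Icc 0 1)) (j : ℕ) {b : ℕ} (hb : b < 2) :
    μ {ω | binaryDigit (U ω) j = b} = 2⁻¹ := by
  have := measure_binaryDigit_mem hU hlaw j {b}
  interval_cases b <;> simpa [fairBitMass, Set.preimage] using this

end UniformDigits

/-! ### Independence of all random bits, and one step of a run -/

/-- The random bits: the `j`-th digit of `U` is `inl j`, the `j`-th flip of coin `i` is
`inr (i, j)`. The value of this function is the σ-algebra generated by the bit. -/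
@[reducible]
noncomputable def bitAlgebra {Ω : Type*} {k : ℕ} (U : Ω → ℝ) (X : Fin k → ℕ → Ω → Bool) :
    ℕ ⊕ (Fin k × ℕ) → MeasurableSpace Ω
  | .inl j => MeasurableSpace.comap (fun ω => binaryDigit (U ω) j) ⊤
  | .inr ij => MeasurableSpace.comap (X ij.1 ij.2) ⊤

namespace IsCoinModel

variable {Ω : Type*} [MeasurableSpace Ω] {μ : Measure Ω} {k : ℕ} {p : Fin k → ℝ}
  {U : Ω → ℝ} {X : Fin k → ℕ → Ω → Bool}

lemma bitAlgebra_le (h : IsCoinModel μ p U X) (i : ℕ ⊕ (Fin k × ℕ)) :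
    bitAlgebra U X i ≤ ‹MeasurableSpace Ω› := by
  rcases i with j | ij
  · exact ((measurable_binaryDigit j).comp h.measurable_U).comap_le
  · exact (h.measurable_X ij.1 ij.2).comap_le

lemma iIndep_bitAlgebra (h : IsCoinModel μ p U X) : iIndep (bitAlgebra U X) μ := by
  classical
  rw [iIndep_iff]
  intro s f hf
  have hl : ∀ j, ∃ T : Set ℕ, j ∈ s.toLeft →
      f (.inl j) = (fun ω => binaryDigit (U ω) j) ⁻¹' T := by
    intro j
    by_cases hj : j ∈ s.toLeft
    · obtain ⟨T, -, hT⟩ := hf _ (Finset.mem_toLeft.1 hj)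
      exact ⟨T, fun _ => hT.symm⟩
    · exact ⟨∅, fun h => absurd h hj⟩
  have hr : ∀ ij, ∃ T : Set Bool, ij ∈ s.toRight → f (.inr ij) = X ij.1 ij.2 ⁻¹' T := by
    intro ij
    by_cases hj : ij ∈ s.toRight
    · obtain ⟨T, -, hT⟩ := hf _ (Finset.mem_toRight.1 hj)
      exact ⟨T, fun _ => hT.symm⟩
    · exact ⟨∅, fun h => absurd h hj⟩
  choose T hT using hl
  choose T' hT' using hr
  have hinter : (⋂ i ∈ s, f i) = (U ⁻¹' ⋂ j ∈ s.toLeft, (fun u => binaryDigit u j) ⁻¹' T j)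
      ∩ ((fun ω (ij : Fin k × ℕ) => X ij.1 ij.2 ω) ⁻¹'
          ⋂ ij ∈ s.toRight, (fun x => x ij) ⁻¹' T' ij) := by
    ext ω
    simp only [Set.mem_iInter, Set.mem_inter_iff, Set.mem_preimage]
    constructor
    · intro hω
      refine ⟨fun j hj => ?_, fun ij hij => ?_⟩
      · have := hω _ (Finset.mem_toLeft.1 hj)
        rwa [hT j hj] at this
      · have := hω _ (Finset.mem_toRight.1 hij)
        rwa [hT' ij hij] at this
    · rintro ⟨h1, h2⟩ (j | ij) hi
      · rw [hT j (Finset.mem_toLeft.2 hi)]; exact h1 j (Finset.mem_toLeft.2 hi)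
      · rw [hT' ij (Finset.mem_toRight.2 hi)]; exact h2 ij (Finset.mem_toRight.2 hi)
  have hind := h.indep_U_X.measure_inter_preimage_eq_mul
    (⋂ j ∈ s.toLeft, (fun u => binaryDigit u j) ⁻¹' T j)
    (⋂ ij ∈ s.toRight, (fun x : Fin k × ℕ → Bool => x ij) ⁻¹' T' ij)
    (Finset.measurableSet_biInter _ fun j _ =>
      measurable_binaryDigit j (MeasurableSet.of_discrete))
    (Finset.measurableSet_biInter _ fun ij _ =>
      measurable_pi_apply ij (MeasurableSet.of_discrete))
  have hU : μ (U ⁻¹' ⋂ j ∈ s.toLeft, (fun u => binaryDigit u j) ⁻¹' T j)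
      = ∏ j ∈ s.toLeft, μ (f (.inl j)) := by
    have h1 := measure_forall_binaryDigit_mem h.measurable_U h.law_U s.toLeft T
    simp only [Set.preimage_iInter]
    refine h1.trans (Finset.prod_congr rfl fun j hj => ?_)
    rw [hT j hj, measure_binaryDigit_mem h.measurable_U h.law_U]
  have hX : μ ((fun ω (ij : Fin k × ℕ) => X ij.1 ij.2 ω) ⁻¹'
      ⋂ ij ∈ s.toRight, (fun x => x ij) ⁻¹' T' ij) = ∏ ij ∈ s.toRight, μ (f (.inr ij)) := by
    have h1 := iIndepFun_iff_measure_inter_preimage_eq_mul.1 h.indep_X s.toRight (sets := T')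
      (fun _ _ => MeasurableSet.of_discrete)
    simp only [Set.preimage_iInter]
    refine Eq.trans h1 (Finset.prod_congr rfl fun ij hij => ?_)
    rw [hT' ij hij]
  rw [hinter, hind, hU, hX, ← Finset.prod_disjSum s.toLeft s.toRight (fun i => μ (f i)),
    Finset.toLeft_disjSum_toRight]

end IsCoinModel

/-- The integral over an event `E` of a function that, on `E`, only depends on an independent
event `H`. -/
lemma setLIntegral_of_two_values {Ω : Type*} [MeasurableSpace Ω] {μ : Measure Ω}
    [IsProbabilityMeasure μ] {E H : Set Ω} (hE : MeasurableSet E) (hH : MeasurableSet H) {q : ℝ}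
    (hq : q ∈ Set.Icc (0 : ℝ) 1) (hμ : μ H = ENNReal.ofReal q)
    (hEH : μ (E ∩ H) = μ E * μ H) (hEH' : μ (E ∩ Hᶜ) = μ E * μ Hᶜ)
    {g : Ω → ENNReal} {a b : ENNReal} (ha : ∀ ω ∈ E ∩ H, g ω = a) (hb : ∀ ω ∈ E ∩ Hᶜ, g ω = b) :
    ∫⁻ ω in E, g ω ∂μ = μ E * (ENNReal.ofReal q * a + ENNReal.ofReal (1 - q) * b) := by
  have hμ' : μ Hᶜ = ENNReal.ofReal (1 - q) := by
    rw [prob_compl_eq_one_sub hH, hμ, ENNReal.ofReal_sub _ hq.1, ENNReal.ofReal_one]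
  have h1 := lintegral_inter_add_sdiff (μ := μ) g E hH
  rw [← h1, Set.sdiff_eq, setLIntegral_congr_fun (hE.inter hH) ha,
    setLIntegral_congr_fun (hE.inter hH.compl) hb, setLIntegral_const, setLIntegral_const, hEH,
    hEH', hμ, hμ']
  ring

namespace CoinInstr

variable {k : ℕ}

/-- The answers that an instruction can receive from names `c`, `m`, a digit or a coin. -/
def answers (c : Fin k → ℕ → ℕ) (m : ℕ → ℕ) : CoinInstr k → Set ℕ
  | halt _ => ∅
  | flip _ => {0, 1}
  | digit => {0, 1}
  | readC i n => {c i n}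
  | readM n => {m n}

/-- The mean of `g` at the answer to an instruction, for coins of means `p` (and `0` if there is
no answer because the instruction is to halt). -/
noncomputable def meanAnswer (c : Fin k → ℕ → ℕ) (m : ℕ → ℕ) (p : Fin k → ℝ) (g : ℕ → ℝ) :
    CoinInstr k → ℝ
  | halt _ => 0
  | flip i => p i * g 1 + (1 - p i) * g 0
  | digit => 1 / 2 * g 1 + (1 - 1 / 2) * g 0
  | readC i n => g (c i n)
  | readM n => g (m n)

/-- The number of coin flips that an instruction makes. -/
def flipCount : CoinInstr k → ℝ
  | flip _ => 1
  | _ => 0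

end CoinInstr

namespace CoinAlgorithm

variable {k : ℕ} {A : CoinAlgorithm k}

/-- `f` bounds the expected remaining cost of a run from each state satisfying the invariant
`I`, where a coin flip costs `lam` and each step costs `eta`; the value of `f` at a halting state
is a cost paid at the end. -/
structure IsSupersolution (A : CoinAlgorithm k) (c : Fin k → ℕ → ℕ) (m : ℕ → ℕ) (p : Fin k → ℝ)
    (I : A.State → Prop) (lam eta : ℝ) (f : A.State → ℝ) : Prop where
  start : I A.start
  invariant : ∀ s, I s → ∀ y ∈ (A.instr s).answers c m, I (A.next s y)
  nonneg : ∀ s, I s → 0 ≤ f s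
  mean_le : ∀ s, I s → (∀ b, A.instr s ≠ .halt b) →
    (A.instr s).meanAnswer c m p (fun y => f (A.next s y)) + lam * (A.instr s).flipCount + eta
      ≤ f s

namespace Config

lemma ext' {s s' : A.Config} (h1 : s.state = s'.state) (h2 : s.flips = s'.flips)
    (h3 : s.digits = s'.digits) : s = s' := by
  cases s; cases s'; simp_all

instance : Countable A.Config :=
  have : Countable A.State := Encodable.countable
  Function.Injective.countable (f := fun s : A.Config => (s.state, s.flips, s.digits))
    fun s s' h => by
      simp only [Prod.mk.injEq] at h
      exact ext' h.1 h.2.1 h.2.2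

/-- The indices of the random bits that have been seen in a configuration. -/
def seen (s : A.Config) : Set (ℕ ⊕ (Fin k × ℕ)) :=
  {b | b.elim (fun j => j < s.digits) fun ij => ij.2 < s.flips ij.1}

/-- The index of the random bit that is needed for the next step, if there is one. -/
def wanted (s : A.Config) : Set (ℕ ⊕ (Fin k × ℕ)) :=
  match A.instr s.state with
  | .flip i => {.inr (i, s.flips i)}
  | .digit => {.inl s.digits}
  | _ => ∅

lemma disjoint_seen_wanted (s : A.Config) : Disjoint s.seen s.wanted := by
  rw [Set.disjoint_left]
  intro b hb hb'
  unfold wanted at hb'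
  split at hb' <;> simp_all [seen]

/-- The total number of coin flips made so far. -/
noncomputable def total (s : A.Config) : ENNReal := ∑ i, (s.flips i : ENNReal)

end Config

variable {c : Fin k → ℕ → ℕ} {m : ℕ → ℕ}

lemma seen_step (u : ℝ) (x : Fin k → ℕ → Bool) (s : A.Config) :
    (A.step c m u x s).seen = s.seen ∪ s.wanted := by
  ext b
  rcases hi : A.instr s.state with _ | i | _ | _ | _ <;> simp only [step, Config.wanted, hi]
  · simp
  · rcases b with j | ⟨i', j⟩
    · simp [Config.seen]
    · by_cases h : i' = i
      · subst h; simp [Config.seen, Order.lt_add_one_iff, le_iff_lt_or_eq, or_comm]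
      · simp [Config.seen, h]
  · rcases b with j | ⟨i', j⟩
    · simp [Config.seen, Order.lt_add_one_iff, le_iff_lt_or_eq, or_comm]
    · simp [Config.seen]
  · simp [Config.seen]
  · simp [Config.seen]

lemma run_succ (u : ℝ) (x : Fin k → ℕ → Bool) (t : ℕ) :
    A.run c m u x (t + 1) = A.step c m u x (A.run c m u x t) := by
  simp only [run, Function.iterate_succ_apply']

section Model

variable {Ω : Type*} {U : Ω → ℝ} {X : Fin k → ℕ → Ω → Bool}

lemma measurableSet_step_eq (s s' : A.Config) :
    MeasurableSet[⨆ b ∈ s.wanted, bitAlgebra U X b]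
      {ω | A.step c m (U ω) (fun i j => X i j ω) s = s'} := by
  rcases hi : A.instr s.state with _ | i | _ | _ | _ <;> simp only [step, hi]
  · exact MeasurableSet.const _
  · have hb : Sum.inr (i, s.flips i) ∈ s.wanted := by simp [Config.wanted, hi]
    exact le_biSup (bitAlgebra U X) hb _
      ⟨{b | (⟨A.next s.state (if b = true then 1 else 0), Function.update s.flips i (s.flips i + 1),
      s.digits⟩ : A.Config) = s'}, trivial, rfl⟩
  · have hb : Sum.inl s.digits ∈ s.wanted := by simp [Config.wanted, hi]
    exact le_biSup (bitAlgebra U X) hb _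
      ⟨{b | (⟨A.next s.state b, s.flips, s.digits + 1⟩ : A.Config) = s'}, trivial, rfl⟩
  · exact MeasurableSet.const _
  · exact MeasurableSet.const _

/-- The event of being in a configuration is determined by the bits seen in it. -/
lemma measurableSet_run_eq (t : ℕ) (s : A.Config) :
    MeasurableSet[⨆ b ∈ s.seen, bitAlgebra U X b]
      {ω | A.run c m (U ω) (fun i j => X i j ω) t = s} := by
  induction t generalizing s with
  | zero => simp only [run, Function.iterate_zero, id]; exact MeasurableSet.const _
  | succ t ih =>
    have h : {ω | A.run c m (U ω) (fun i j => X i j ω) (t + 1) = s}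
        = ⋃ s' : A.Config, {ω | A.run c m (U ω) (fun i j => X i j ω) t = s'} ∩
            {ω | A.step c m (U ω) (fun i j => X i j ω) s' = s} := by
      ext ω; simp [run_succ]
    rw [h]
    refine MeasurableSet.iUnion fun s' => ?_
    rcases Set.eq_empty_or_nonempty
      {ω | A.step c m (U ω) (fun i j => X i j ω) s' = s} with h0 | ⟨ω, hω⟩
    · rw [h0, Set.inter_empty]; exact @MeasurableSet.empty _ (_)
    · have hs : s.seen = s'.seen ∪ s'.wanted := by
        rw [← show _ = s from hω]; exact seen_step _ _ _
      have h1 : ⨆ b ∈ s'.seen, bitAlgebra U X b ≤ ⨆ b ∈ s.seen, bitAlgebra U X b :=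
        biSup_mono fun b hb => by rw [hs]; exact Or.inl hb
      have h2 : ⨆ b ∈ s'.wanted, bitAlgebra U X b ≤ ⨆ b ∈ s.seen, bitAlgebra U X b :=
        biSup_mono fun b hb => by rw [hs]; exact Or.inr hb
      exact (h1 _ (ih s')).inter (h2 _ (measurableSet_step_eq s' s))

variable [MeasurableSpace Ω] {μ : Measure Ω} {p : Fin k → ℝ}

lemma iSup_bitAlgebra_le (h : IsCoinModel μ p U X) (S : Set (ℕ ⊕ (Fin k × ℕ))) :
    ⨆ b ∈ S, bitAlgebra U X b ≤ ‹MeasurableSpace Ω› :=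
  iSup₂_le fun b _ => h.bitAlgebra_le b

/-- The next bit is independent of the event of being in a given configuration. -/
lemma measure_run_eq_inter (h : IsCoinModel μ p U X) (t : ℕ) (s : A.Config)
    {b : ℕ ⊕ (Fin k × ℕ)} (hb : b ∈ s.wanted) {H : Set Ω} (hH : MeasurableSet[bitAlgebra U X b] H) :
    μ ({ω | A.run c m (U ω) (fun i j => X i j ω) t = s} ∩ H)
      = μ {ω | A.run c m (U ω) (fun i j => X i j ω) t = s} * μ H :=
  (Indep_iff _ _ μ).1
    (indep_iSup_of_disjoint h.bitAlgebra_le h.iIndep_bitAlgebra s.disjoint_seen_wanted) _ _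
    (measurableSet_run_eq t s) (le_biSup (bitAlgebra U X) hb _ hH)

end Model

section Supersolution

variable {Ω : Type*} [MeasurableSpace Ω] {μ : Measure Ω} {p : Fin k → ℝ} {U : Ω → ℝ}
  {X : Fin k → ℕ → Ω → Bool}
  {I : A.State → Prop} {lam eta : ℝ} {f : A.State → ℝ}

/-- The remaining cost bound given by `f`, plus the cost of the flips made so far. -/
noncomputable def costBound (f : A.State → ℝ) (lam : ℝ) (s : A.Config) : ENNReal :=
  ENNReal.ofReal (f s.state) + ENNReal.ofReal lam * s.total

lemma ofReal_mix_le {q f₁ f₀ extra F : ℝ} (N : ENNReal) (hq : q ∈ Set.Icc (0 : ℝ) 1)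
    (h₁ : 0 ≤ f₁) (h₀ : 0 ≤ f₀) (he : 0 ≤ extra) (h : q * f₁ + (1 - q) * f₀ + extra ≤ F) :
    ENNReal.ofReal q * (ENNReal.ofReal f₁ + N) + ENNReal.ofReal (1 - q) * (ENNReal.ofReal f₀ + N)
      + ENNReal.ofReal extra ≤ ENNReal.ofReal F + N := by
  have hq' : 0 ≤ 1 - q := by linarith [hq.2]
  have h1 : ENNReal.ofReal q + ENNReal.ofReal (1 - q) = 1 := by
    rw [← ENNReal.ofReal_add hq.1 hq']; simp
  calc _ = ENNReal.ofReal (q * f₁ + (1 - q) * f₀ + extra)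
        + (ENNReal.ofReal q + ENNReal.ofReal (1 - q)) * N := by
        have := mul_nonneg hq.1 h₁
        have := mul_nonneg hq' h₀
        rw [ENNReal.ofReal_add (by positivity) he, ENNReal.ofReal_add (by positivity)
          (by positivity), ENNReal.ofReal_mul hq.1, ENNReal.ofReal_mul hq']
        ring
    _ ≤ _ := by
        rw [h1, one_mul]
        gcongr

lemma IsSupersolution.setLIntegral_step_le [IsProbabilityMeasure μ]
    (hf : A.IsSupersolution c m p I lam eta f)
    (h : IsCoinModel μ p U X) (hp : ∀ i, p i ∈ Set.Icc (0 : ℝ) 1) (hlam : 0 ≤ lam) (heta : 0 ≤ eta)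
    (t : ℕ) (s : A.Config) (hs : I s.state) :
    ∫⁻ ω in {ω | A.run c m (U ω) (fun i j => X i j ω) t = s},
        costBound f lam (A.step c m (U ω) (fun i j => X i j ω) s) ∂μ
      + (open Classical in if ∃ b, A.instr s.state = .halt b then 0 else ENNReal.ofReal eta)
        * μ {ω | A.run c m (U ω) (fun i j => X i j ω) t = s}
      ≤ costBound f lam s * μ {ω | A.run c m (U ω) (fun i j => X i j ω) t = s} := by
  classical
  have hE : MeasurableSet {ω | A.run c m (U ω) (fun i j => X i j ω) t = s} :=
    iSup_bitAlgebra_le h _ _ (measurableSet_run_eq t s)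
  have hind := fun b hb H => measure_run_eq_inter (c := c) (m := m) h t s (b := b) hb (H := H)
  set E := {ω | A.run c m (U ω) (fun i j => X i j ω) t = s} with hEdef
  have hinv := hf.invariant _ hs
  have hle := hf.mean_le _ hs
  rcases hi : A.instr s.state with b | i | _ | ⟨i, n⟩ | n
  · have : ∃ b', (CoinInstr.halt b : CoinInstr k) = .halt b' := ⟨b, rfl⟩
    simp [step, hi]
  all_goals
    rw [hi] at hinv hle
    have hle := hle (by simp)
    simp only [CoinInstr.meanAnswer, CoinInstr.flipCount, mul_one, mul_zero, add_zero] at hle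
    rw [if_neg (by simp)]
  · have hb : Sum.inr (i, s.flips i) ∈ s.wanted := by simp [Config.wanted, hi]
    have hH : MeasurableSet[bitAlgebra U X (.inr (i, s.flips i))]
        {ω | X i (s.flips i) ω = true} := ⟨{true}, trivial, rfl⟩
    have htot : ∀ y, Config.total (A := A) ⟨A.next s.state y,
        Function.update s.flips i (s.flips i + 1), s.digits⟩ = s.total + 1 := by
      intro y
      simp only [Config.total]
      rw [← Finset.add_sum_erase _ _ (Finset.mem_univ i),
        ← Finset.add_sum_erase Finset.univ (fun j => (s.flips j : ENNReal)) (Finset.mem_univ i)]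
      rw [Finset.sum_congr rfl
        fun j hj => by rw [Function.update_of_ne (Finset.ne_of_mem_erase hj)]]
      simp
      ring
    rw [setLIntegral_of_two_values (q := p i)
      (a := ENNReal.ofReal (f (A.next s.state 1)) + ENNReal.ofReal lam * (s.total + 1))
      (b := ENNReal.ofReal (f (A.next s.state 0)) + ENNReal.ofReal lam * (s.total + 1))
      hE (h.bitAlgebra_le _ _ hH) (hp i) (h.law_X _ _)
      (hind _ hb _ hH) (hind _ hb _ hH.compl)]
    · have h1 := ofReal_mix_le (F := f s.state) (ENNReal.ofReal lam * s.total) (hp i)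
        (hf.nonneg _ (hinv 1 (by simp [CoinInstr.answers])))
        (hf.nonneg _ (hinv 0 (by simp [CoinInstr.answers]))) (add_nonneg hlam heta)
        (by rw [← add_assoc]; exact hle)
      have hq : ENNReal.ofReal (p i) + ENNReal.ofReal (1 - p i) = 1 := by
        rw [← ENNReal.ofReal_add (hp i).1 (by linarith [(hp i).2])]; simp
      rw [ENNReal.ofReal_add hlam heta] at h1
      calc _ = μ E * (ENNReal.ofReal (p i) * (ENNReal.ofReal (f (A.next s.state 1))
              + ENNReal.ofReal lam * s.total) + ENNReal.ofReal (1 - p i) *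
              (ENNReal.ofReal (f (A.next s.state 0)) + ENNReal.ofReal lam * s.total)
              + ((ENNReal.ofReal (p i) + ENNReal.ofReal (1 - p i)) * ENNReal.ofReal lam
                + ENNReal.ofReal eta)) := by ring
        _ ≤ μ E * (ENNReal.ofReal (f s.state) + ENNReal.ofReal lam * s.total) := by
            rw [hq, one_mul]; exact mul_le_mul_right h1 _
        _ = _ := by rw [costBound, mul_comm]
    · rintro ω ⟨-, hω⟩
      have hω : X i (s.flips i) ω = true := hω
      simp [step, hi, costBound, htot, hω]
    · rintro ω ⟨-, hω⟩
      have hω : ¬ X i (s.flips i) ω = true := hω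
      simp [step, hi, costBound, htot, hω]
  · have hb : Sum.inl s.digits ∈ s.wanted := by simp [Config.wanted, hi]
    have hH : MeasurableSet[bitAlgebra U X (.inl s.digits)]
        {ω | binaryDigit (U ω) s.digits = 1} := ⟨{1}, trivial, rfl⟩
    have hhalf : (1 / 2 : ℝ) ∈ Set.Icc (0 : ℝ) 1 := by constructor <;> norm_num
    rw [setLIntegral_of_two_values (q := 1 / 2)
      (a := ENNReal.ofReal (f (A.next s.state 1)) + ENNReal.ofReal lam * s.total)
      (b := ENNReal.ofReal (f (A.next s.state 0)) + ENNReal.ofReal lam * s.total)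
      hE (h.bitAlgebra_le _ _ hH) hhalf ?_
      (hind _ hb _ hH) (hind _ hb _ hH.compl)]
    · have h1 := ofReal_mix_le (F := f s.state) (ENNReal.ofReal lam * s.total) hhalf
        (hf.nonneg _ (hinv 1 (by simp [CoinInstr.answers])))
        (hf.nonneg _ (hinv 0 (by simp [CoinInstr.answers]))) heta hle
      rw [mul_comm _ (μ E), ← mul_add, mul_comm _ (μ E)]
      exact mul_le_mul_right h1 _
    · rintro ω ⟨-, hω⟩
      have hω : binaryDigit (U ω) s.digits = 1 := hω
      simp only [step, hi, costBound, hω]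
      rfl
    · rintro ω ⟨-, hω⟩
      have hω : ¬ binaryDigit (U ω) s.digits = 1 := hω
      have hω : binaryDigit (U ω) s.digits = 0 := by
        have := binaryDigit_lt_two (U ω) s.digits
        omega
      simp only [step, hi, costBound, hω]
      rfl
    · rw [measure_binaryDigit_eq h.measurable_U h.law_U _ one_lt_two, one_div,
        ENNReal.ofReal_inv_of_pos two_pos]
      simp
  all_goals
    simp only [step, hi, lintegral_const, Measure.restrict_apply MeasurableSet.univ,
      Set.univ_inter, ← add_mul]
    gcongr
    simp only [costBound, Config.total]
    rw [add_right_comm, ← ENNReal.ofReal_add (hf.nonneg _ (hinv _ (by simp [CoinInstr.answers])))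
      heta]
    gcongr

lemma measurableSet_run (h : IsCoinModel μ p U X) (t : ℕ) (s : A.Config) :
    MeasurableSet {ω | A.run c m (U ω) (fun i j => X i j ω) t = s} :=
  iSup_bitAlgebra_le h _ _ (measurableSet_run_eq t s)

lemma measurableSet_setOf_run (h : IsCoinModel μ p U X) (t : ℕ) (P : A.Config → Prop) :
    MeasurableSet {ω | P (A.run c m (U ω) (fun i j => X i j ω) t)} := by
  have : {ω | P (A.run c m (U ω) (fun i j => X i j ω) t)}
      = ⋃ s ∈ {s : A.Config | P s}, {ω | A.run c m (U ω) (fun i j => X i j ω) t = s} := by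
    ext ω; simp
  rw [this]
  exact MeasurableSet.biUnion (Set.to_countable _) fun s _ => measurableSet_run h t s

lemma measurable_comp_run (h : IsCoinModel μ p U X) (t : ℕ) (g : A.Config → ENNReal) :
    Measurable fun ω => g (A.run c m (U ω) (fun i j => X i j ω) t) := fun S _ =>
  measurableSet_setOf_run h t fun s => g s ∈ S

lemma lintegral_eq_tsum_run (h : IsCoinModel μ p U X) (t : ℕ) (g : Ω → ENNReal) :
    ∫⁻ ω, g ω ∂μ
      = ∑' s : A.Config, ∫⁻ ω in {ω | A.run c m (U ω) (fun i j => X i j ω) t = s}, g ω ∂μ := by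
  rw [← lintegral_iUnion (measurableSet_run h t)]
  · rw [show (⋃ s : A.Config, {ω | A.run c m (U ω) (fun i j => X i j ω) t = s}) = Set.univ by
      ext ω; simp, Measure.restrict_univ]
  · intro s s' hs
    refine Set.disjoint_left.2 fun ω h1 h2 => hs ?_
    exact Eq.trans (Eq.symm h1) h2

lemma IsSupersolution.invariant_run (hf : A.IsSupersolution c m p I lam eta f)
    (u : ℝ) (x : Fin k → ℕ → Bool) (t : ℕ) : I (A.run c m u x t).state := by
  induction t with
  | zero => exact hf.start
  | succ t ih =>
    rw [run_succ]
    have hinv := hf.invariant _ ih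
    rcases hi : A.instr (A.run c m u x t).state with _ | i | _ | _ | _ <;>
      simp only [step, hi]
    · exact ih
    all_goals
      apply hinv
      simp only [hi, CoinInstr.answers]
    · split_ifs <;> simp
    · have := binaryDigit_lt_two u (A.run c m u x t).digits
      simp only [Set.mem_insert_iff, Set.mem_singleton_iff]
      omega
    · rfl
    · rfl

lemma IsSupersolution.lintegral_run_succ_le [IsProbabilityMeasure μ]
    (hf : A.IsSupersolution c m p I lam eta f)
    (h : IsCoinModel μ p U X) (hp : ∀ i, p i ∈ Set.Icc (0 : ℝ) 1) (hlam : 0 ≤ lam) (heta : 0 ≤ eta)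
    (t : ℕ) :
    ∫⁻ ω, costBound f lam (A.run c m (U ω) (fun i j => X i j ω) (t + 1)) ∂μ
      + ENNReal.ofReal eta
        * μ {ω | ¬ ∃ b, A.instr (A.run c m (U ω) (fun i j => X i j ω) t).state = .halt b}
      ≤ ∫⁻ ω, costBound f lam (A.run c m (U ω) (fun i j => X i j ω) t) ∂μ := by
  classical
  have hmeas := measurableSet_setOf_run (c := c) (m := m) (A := A) h t
    fun s => ¬ ∃ b, A.instr s.state = .halt b
  rw [← lintegral_indicator_const hmeas, ← lintegral_add_left (measurable_comp_run h _ _),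
    lintegral_eq_tsum_run (A := A) (c := c) (m := m) h t,
    lintegral_eq_tsum_run (A := A) (c := c) (m := m) h t (fun ω => costBound f lam _)]
  refine ENNReal.tsum_le_tsum fun s => ?_
  have hE := measurableSet_run (c := c) (m := m) h t s
  rcases Set.eq_empty_or_nonempty {ω | A.run c m (U ω) (fun i j => X i j ω) t = s} with h0 | ⟨ω, hω⟩
  · simp [h0]
  have hs : I s.state := by
    have := hf.invariant_run (U ω) (fun i j => X i j ω) t
    rwa [show _ = s from hω] at this
  have hmain := hf.setLIntegral_step_le h hp hlam heta t s hs
  refine le_trans (le_of_eq ?_) (hmain.trans (le_of_eq ?_))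
  · rw [← setLIntegral_const, ← lintegral_add_right _ measurable_const]
    refine setLIntegral_congr_fun hE fun ω hω => ?_
    have hω : A.run c m (U ω) (fun i j => X i j ω) t = s := hω
    simp only [run_succ, hω, Set.indicator, Set.mem_ofPred_eq]
    by_cases hb : ∃ b, A.instr s.state = .halt b
    · simp [hb]
    · simp [hb]
  · rw [← setLIntegral_const]
    refine setLIntegral_congr_fun hE fun ω hω => ?_
    have hω : A.run c m (U ω) (fun i j => X i j ω) t = s := hω
    simp only [hω]

/-- The expected cost of the first `t` steps, plus the expected remaining cost, is at most the
value of the supersolution at the start. -/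
lemma IsSupersolution.lintegral_run_le [IsProbabilityMeasure μ]
    (hf : A.IsSupersolution c m p I lam eta f)
    (h : IsCoinModel μ p U X) (hp : ∀ i, p i ∈ Set.Icc (0 : ℝ) 1) (hlam : 0 ≤ lam) (heta : 0 ≤ eta)
    (t : ℕ) :
    ∫⁻ ω, costBound f lam (A.run c m (U ω) (fun i j => X i j ω) t) ∂μ
      + ENNReal.ofReal eta * ∑ t' ∈ Finset.range t,
        μ {ω | ¬ ∃ b, A.instr (A.run c m (U ω) (fun i j => X i j ω) t').state = .halt b}
      ≤ ENNReal.ofReal (f A.start) := by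
  induction t with
  | zero => simp [run, costBound, Config.total]
  | succ t ih =>
    refine le_trans ?_ ih
    rw [Finset.sum_range_succ, mul_add, add_comm (_ * _) (_ * _), ← add_assoc]
    gcongr
    exact hf.lintegral_run_succ_le h hp hlam heta t

lemma step_of_halt {u : ℝ} {x : Fin k → ℕ → Bool} {s : A.Config} {b : Bool}
    (h : A.instr s.state = .halt b) : A.step c m u x s = s := by
  simp [step, h]

lemma run_add_of_halt {u : ℝ} {x : Fin k → ℕ → Bool} {t : ℕ} {b : Bool}
    (h : A.instr (A.run c m u x t).state = .halt b) (n : ℕ) :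
    A.run c m u x (t + n) = A.run c m u x t := by
  induction n with
  | zero => rfl
  | succ n ih => rw [← add_assoc, run_succ, ih, step_of_halt h]

lemma Outputs.eq {u : ℝ} {x : Fin k → ℕ → Bool} {b b' : Bool}
    (h : A.Outputs c m u x b) (h' : A.Outputs c m u x b') : b = b' := by
  obtain ⟨t, ht⟩ := h
  obtain ⟨t', ht'⟩ := h'
  rcases le_total t t' with hle | hle
  · obtain ⟨n, rfl⟩ := Nat.exists_eq_add_of_le hle
    rw [run_add_of_halt ht, ht] at ht'
    exact CoinInstr.halt.inj ht'
  · obtain ⟨n, rfl⟩ := Nat.exists_eq_add_of_le hle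
    rw [run_add_of_halt ht', ht'] at ht
    exact (CoinInstr.halt.inj ht).symm

lemma flips_le_step (u : ℝ) (x : Fin k → ℕ → Bool) (s : A.Config) (i : Fin k) :
    s.flips i ≤ (A.step c m u x s).flips i := by
  rcases hi : A.instr s.state with _ | i' | _ | _ | _ <;> simp only [step, hi, le_refl]
  by_cases h : i = i'
  · subst h; simp
  · simp [h]

/-- The probability of an output is at most the start value of a supersolution that is at least
`1` at the states where that output is given. -/
lemma IsSupersolution.measure_outputs_le [IsProbabilityMeasure μ]
    (hf : A.IsSupersolution c m p I 0 0 f)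
    (h : IsCoinModel μ p U X) (hp : ∀ i, p i ∈ Set.Icc (0 : ℝ) 1) {b : Bool}
    (hb : ∀ s, I s → A.instr s = .halt b → 1 ≤ f s) :
    μ {ω | A.Outputs c m (U ω) (fun i j => X i j ω) b} ≤ ENNReal.ofReal (f A.start) := by
  set E : ℕ → Set Ω :=
    fun t => {ω | A.instr (A.run c m (U ω) (fun i j => X i j ω) t).state = .halt b} with hE
  have hU : {ω | A.Outputs c m (U ω) (fun i j => X i j ω) b} = ⋃ t, E t := by
    ext ω; simp [Outputs, hE]
  have hmono : Monotone E := monotone_nat_of_le_succ fun t ω hω => by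
    have hω : A.instr (A.run c m (U ω) (fun i j => X i j ω) t).state = .halt b := hω
    have h1 := run_add_of_halt hω 1
    simp only [hE, Set.mem_ofPred_eq, h1, hω]
  rw [hU, hmono.measure_iUnion]
  refine iSup_le fun t => ?_
  have hEm : MeasurableSet (E t) :=
    measurableSet_setOf_run h t fun s => A.instr s.state = .halt b
  have h1 := hf.lintegral_run_le h hp le_rfl le_rfl t
  rw [ENNReal.ofReal_zero, zero_mul, add_zero] at h1
  refine le_trans ?_ h1
  rw [← lintegral_indicator_one hEm]
  refine lintegral_mono fun ω => ?_
  by_cases hω : ω ∈ E t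
  · simp only [hω, Set.indicator_of_mem, Pi.one_apply, costBound]
    refine le_add_right ?_
    rw [← ENNReal.ofReal_one]
    exact ENNReal.ofReal_le_ofReal (hb _ (hf.invariant_run _ _ _) hω)
  · simp [hω]

/-- If each step costs something, then a supersolution shows that the algorithm halts almost
surely. -/
lemma IsSupersolution.one_le_measure_outputs [IsProbabilityMeasure μ]
    (hf : A.IsSupersolution c m p I lam eta f)
    (h : IsCoinModel μ p U X) (hp : ∀ i, p i ∈ Set.Icc (0 : ℝ) 1) (hlam : 0 ≤ lam)
    (heta : 0 < eta) :
    1 ≤ μ {ω | A.Outputs c m (U ω) (fun i j => X i j ω) true}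
      + μ {ω | A.Outputs c m (U ω) (fun i j => X i j ω) false} := by
  set N : ℕ → Set Ω := fun t =>
    {ω | ¬ ∃ b, A.instr (A.run c m (U ω) (fun i j => X i j ω) t).state = .halt b} with hN
  have hsum : ∑' t, μ (N t) ≠ ⊤ := by
    have h1 : ENNReal.ofReal eta * ∑' t, μ (N t) ≤ ENNReal.ofReal (f A.start) := by
      rw [ENNReal.tsum_eq_iSup_nat, ENNReal.mul_iSup]
      exact iSup_le fun t =>
        le_trans le_add_self (hf.lintegral_run_le h hp hlam heta.le t)
    intro htop
    rw [htop, ENNReal.mul_top (by simpa using heta)] at h1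
    exact absurd h1 (by simp)
  have hlim := ENNReal.tendsto_atTop_zero_of_tsum_ne_top hsum
  have hzero : μ (⋂ t, N t) = 0 :=
    have hle : ∀ t, μ (⋂ t, N t) ≤ μ (N t) := fun t => measure_mono (Set.iInter_subset _ t)
    le_antisymm (ge_of_tendsto' hlim hle) zero_le
  have hcover : Set.univ ⊆ ((⋂ t, N t) ∪ {ω | A.Outputs c m (U ω) (fun i j => X i j ω) true})
      ∪ {ω | A.Outputs c m (U ω) (fun i j => X i j ω) false} := by
    intro ω _
    by_cases hω : ω ∈ ⋂ t, N t
    · exact Or.inl (Or.inl hω)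
    · simp only [hN, Set.mem_iInter, Set.mem_ofPred_eq, not_forall, not_not] at hω
      obtain ⟨t, b, hb⟩ := hω
      rcases b with _ | _
      · exact Or.inr ⟨t, hb⟩
      · exact Or.inl (Or.inr ⟨t, hb⟩)
  calc (1 : ENNReal) = μ Set.univ := measure_univ.symm
    _ ≤ μ (((⋂ t, N t) ∪ {ω | A.Outputs c m (U ω) (fun i j => X i j ω) true})
        ∪ {ω | A.Outputs c m (U ω) (fun i j => X i j ω) false}) := measure_mono hcover
    _ ≤ _ := measure_union_le _ _
    _ ≤ _ := by
      refine add_le_add ((measure_union_le _ _).trans ?_) le_rfl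
      rw [hzero, zero_add]

lemma totalFlips_eq_iSup (u : ℝ) (x : Fin k → ℕ → Bool) :
    A.totalFlips c m u x = ⨆ t, (A.run c m u x t).total := by
  refine ENNReal.finsetSum_iSup_of_monotone fun i => monotone_nat_of_le_succ fun t => ?_
  rw [run_succ]
  exact_mod_cast flips_le_step u x _ i

lemma IsSupersolution.lintegral_totalFlips_le [IsProbabilityMeasure μ]
    (hf : A.IsSupersolution c m p I 1 eta f)
    (h : IsCoinModel μ p U X) (hp : ∀ i, p i ∈ Set.Icc (0 : ℝ) 1) (heta : 0 ≤ eta) :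
    ∫⁻ ω, A.totalFlips c m (U ω) (fun i j => X i j ω) ∂μ ≤ ENNReal.ofReal (f A.start) := by
  simp only [totalFlips_eq_iSup]
  rw [lintegral_iSup (fun t => measurable_comp_run h t Config.total)]
  · refine iSup_le fun t => ?_
    refine le_trans ?_ (hf.lintegral_run_le h hp zero_le_one heta t)
    refine le_add_right (lintegral_mono fun ω => ?_)
    simp [costBound]
  · refine monotone_nat_of_le_succ fun t ω => ?_
    simp only [run_succ]
    exact Finset.sum_le_sum fun i _ => by exact_mod_cast flips_le_step _ _ _ i

end Supersolution

end CoinAlgorithm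

/-! ### Machines that flip coins of prescribed probabilities -/

/-- A request for a random bit that is `1` with probability `(α + β z - γ z) / Q`, where the
real number `z` is one of the inputs: `M` for `none` and `C i` for `some i`. It is coded as
`(z, α, β, γ, Q)`. -/
abbrev BernoulliQuery (k : ℕ) : Type := Option (Fin k) × ℕ × ℕ × ℕ × ℕ

namespace BernoulliQuery

variable {k : ℕ}

/-- The input that a query refers to. -/
def input (C : Fin k → ℝ) (M : ℝ) (q : BernoulliQuery k) : ℝ := q.1.elim M C

/-- The probability that a query asks for, multiplied by its denominator. -/
def numerator (C : Fin k → ℝ) (M : ℝ) (q : BernoulliQuery k) : ℝ :=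
  q.2.1 + q.2.2.1 * q.input C M - q.2.2.2.1 * q.input C M

/-- The denominator of a query. -/
def denominator (q : BernoulliQuery k) : ℕ := q.2.2.2.2

/-- The probability that a query asks for. -/
noncomputable def value (C : Fin k → ℝ) (M : ℝ) (q : BernoulliQuery k) : ℝ :=
  q.numerator C M / q.denominator

/-- The precision with which the input is read in order to compare the value of the query with
a number given by `j` binary digits. -/
def precision (q : BernoulliQuery k) (j : ℕ) : ℕ := j + q.2.2.1 + q.2.2.2.1 + 2

/-- The instruction that reads the input of the query with precision `2⁻ⁿ`. -/
def readInstr (q : BernoulliQuery k) (n : ℕ) : CoinInstr k :=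
  q.1.elim (.readM n) fun i => .readC i n

/-- The approximation of `2 ^ j * value`, multiplied by the denominator and by
`2 ^ precision`, that is computed from the approximation `y` of the input. -/
def scaledApprox (q : BernoulliQuery k) (j y : ℕ) : ℕ :=
  2 ^ j * (q.2.1 * 2 ^ q.precision j + q.2.2.1 * y - q.2.2.2.1 * y)

/-- The unit in which `scaledApprox` is expressed. -/
def unit (q : BernoulliQuery k) (j : ℕ) : ℕ := q.denominator * 2 ^ q.precision j

/-- The approximation `y` of the input shows that all numbers whose binary expansion starts with
the `j` digits forming the integer `a` are below the value of the query. -/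
def Accepts (q : BernoulliQuery k) (j a y : ℕ) : Prop :=
  (4 * a + 5) * q.unit j ≤ 4 * q.scaledApprox j y

/-- The approximation `y` of the input shows that all numbers whose binary expansion starts with
the `j` digits forming the integer `a` are above the value of the query. -/
def Rejects (q : BernoulliQuery k) (j a y : ℕ) : Prop :=
  4 * q.scaledApprox j y + q.unit j ≤ 4 * a * q.unit j

instance (q : BernoulliQuery k) (j a y : ℕ) : Decidable (q.Accepts j a y) :=
  inferInstanceAs (Decidable (_ ≤ _))

instance (q : BernoulliQuery k) (j a y : ℕ) : Decidable (q.Rejects j a y) :=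
  inferInstanceAs (Decidable (_ ≤ _))

variable {C : Fin k → ℝ} {M : ℝ}

lemma abs_scaledApprox_sub_le {q : BernoulliQuery k} (hQ : 0 < q.denominator)
    (hnum : 0 ≤ q.numerator C M) {j y : ℕ}
    (hy : |(y : ℝ) / 2 ^ q.precision j - q.input C M| ≤ 1 / 2 ^ q.precision j) :
    |4 * (q.scaledApprox j y : ℝ) - 4 * (2 ^ j * q.value C M * q.unit j)| ≤ q.unit j := by
  obtain ⟨z, α, β, γ, Q⟩ := q
  simp only [denominator, numerator, precision, scaledApprox, value, unit] at *
  set w : ℝ := input C M (z, α, β, γ, Q) with hw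
  set n := j + β + γ + 2 with hn
  have hP : (0 : ℝ) < 2 ^ n := by positivity
  have hQ' : (0 : ℝ) < Q := by exact_mod_cast hQ
  have hy' : |(y : ℝ) - 2 ^ n * w| ≤ 1 := by
    have h1 : (y : ℝ) - 2 ^ n * w = 2 ^ n * ((y : ℝ) / 2 ^ n - w) := by field_simp
    rw [h1, abs_mul, abs_of_pos hP]
    calc (2 : ℝ) ^ n * _ ≤ 2 ^ n * (1 / 2 ^ n) := by gcongr
      _ = 1 := by field_simp
  obtain ⟨hy1, hy2⟩ := abs_le.1 hy'
  have hβ : (0 : ℝ) ≤ β := Nat.cast_nonneg _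
  have hγ : (0 : ℝ) ≤ γ := Nat.cast_nonneg _
  -- truncated subtraction only brings the approximation closer to the nonnegative true value
  have hN : |(((α * 2 ^ n + β * y - γ * y : ℕ)) : ℝ) - 2 ^ n * (α + β * w - γ * w)| ≤ β + γ := by
    have hb1 := mul_le_mul_of_nonneg_left hy1 hβ
    have hb2 := mul_le_mul_of_nonneg_left hy2 hβ
    have hg1 := mul_le_mul_of_nonneg_left hy1 hγ
    have hg2 := mul_le_mul_of_nonneg_left hy2 hγ
    rcases le_total (γ * y) (α * 2 ^ n + β * y) with hle | hle
    · rw [Nat.cast_sub hle]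
      push_cast
      rw [abs_le]
      constructor <;> nlinarith
    · rw [Nat.sub_eq_zero_of_le hle]
      have hle' : (α : ℝ) * 2 ^ n + β * y ≤ γ * y := by exact_mod_cast hle
      have h0 : 0 ≤ 2 ^ n * (α + β * w - γ * w) := mul_nonneg hP.le hnum
      rw [abs_le]
      constructor <;> push_cast <;> nlinarith
  have hsize : (4 : ℝ) * (2 ^ j * (β + γ)) ≤ Q * 2 ^ n := by
    have h1 : ((β + γ : ℕ) : ℝ) ≤ 2 ^ (β + γ) := by exact_mod_cast Nat.lt_two_pow_self.le
    have h2 : (2 : ℝ) ^ n = 4 * (2 ^ j * 2 ^ (β + γ)) := by rw [hn]; ring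
    have h3 : (1 : ℝ) ≤ Q := by exact_mod_cast hQ
    push_cast at h1
    calc (4 : ℝ) * (2 ^ j * (β + γ)) ≤ 4 * (2 ^ j * 2 ^ (β + γ)) := by gcongr
      _ = 1 * 2 ^ n := by rw [h2]; ring
      _ ≤ Q * 2 ^ n := by gcongr
  have hrw : 4 * ((2 ^ j * (α * 2 ^ n + β * y - γ * y) : ℕ) : ℝ)
      - 4 * (2 ^ j * ((α + β * w - γ * w) / Q) * ((Q * 2 ^ n : ℕ) : ℝ))
      = 4 * 2 ^ j * ((((α * 2 ^ n + β * y - γ * y : ℕ)) : ℝ) - 2 ^ n * (α + β * w - γ * w)) := by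
    push_cast
    field_simp
  rw [hrw, abs_mul, abs_of_pos (by positivity)]
  push_cast
  calc (4 : ℝ) * 2 ^ j * _ ≤ 4 * 2 ^ j * (β + γ) := by gcongr
    _ ≤ _ := by linarith

lemma unit_pos {q : BernoulliQuery k} (hQ : 0 < q.denominator) (j : ℕ) : (0 : ℝ) < q.unit j := by
  have : 0 < q.unit j := Nat.mul_pos hQ (by positivity)
  exact_mod_cast this

section Decision

variable {q : BernoulliQuery k} (hQ : 0 < q.denominator) (hnum : 0 ≤ q.numerator C M) {j a y : ℕ}
  (hy : |(y : ℝ) / 2 ^ q.precision j - q.input C M| ≤ 1 / 2 ^ q.precision j)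

include hQ hnum hy

lemma Accepts.one_le (h : q.Accepts j a y) : 1 ≤ 2 ^ j * q.value C M - a := by
  have h1 := (abs_le.1 (abs_scaledApprox_sub_le hQ hnum hy)).2
  have h2 : (4 * a + 5 : ℝ) * q.unit j ≤ 4 * q.scaledApprox j y := by exact_mod_cast h
  have h3 := unit_pos hQ j
  have h4 : (a + 1) * (q.unit j : ℝ) ≤ 2 ^ j * q.value C M * q.unit j := by linarith
  have := le_of_mul_le_mul_right h4 h3
  linarith

lemma Rejects.le_zero (h : q.Rejects j a y) : 2 ^ j * q.value C M - a ≤ 0 := by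
  have h1 := (abs_le.1 (abs_scaledApprox_sub_le hQ hnum hy)).1
  have h2 : 4 * (q.scaledApprox j y : ℝ) + q.unit j ≤ 4 * a * q.unit j := by exact_mod_cast h
  have h3 := unit_pos hQ j
  have h4 : 2 ^ j * q.value C M * q.unit j ≤ a * (q.unit j : ℝ) := by linarith
  have := le_of_mul_le_mul_right h4 h3
  linarith

lemma lt_of_not_accepts (h : ¬ q.Accepts j a y) : 2 ^ j * q.value C M - a < 3 / 2 := by
  have h1 := (abs_le.1 (abs_scaledApprox_sub_le hQ hnum hy)).1
  have h2 : 4 * (q.scaledApprox j y : ℝ) < (4 * a + 5 : ℝ) * q.unit j := by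
    exact_mod_cast not_le.1 h
  have h3 := unit_pos hQ j
  have h4 : 2 ^ j * q.value C M * q.unit j < (a + 3 / 2) * (q.unit j : ℝ) := by linarith
  have := lt_of_mul_lt_mul_right h4 h3.le
  linarith

lemma lt_of_not_rejects (h : ¬ q.Rejects j a y) : -(1 / 2) < 2 ^ j * q.value C M - a := by
  have h1 := (abs_le.1 (abs_scaledApprox_sub_le hQ hnum hy)).2
  have h2 : 4 * a * (q.unit j : ℝ) < 4 * (q.scaledApprox j y : ℝ) + q.unit j := by
    exact_mod_cast not_le.1 h
  have h3 := unit_pos hQ j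
  have h4 : (a - 1 / 2) * (q.unit j : ℝ) < 2 ^ j * q.value C M * q.unit j := by linarith
  have := lt_of_mul_lt_mul_right h4 h3.le
  linarith

end Decision

end BernoulliQuery

/-- A randomized algorithm that can also ask for random bits of prescribed probabilities. -/
structure BernoulliMachine (k : ℕ) where
  /-- The states. -/
  State : Type
  /-- The coding of the states by natural numbers. -/
  [coding : Primcodable State]
  /-- The initial state. -/
  start : State
  /-- The instruction or query issued in a state. -/
  instr : State → CoinInstr k ⊕ BernoulliQuery k
  /-- The state reached from a state by an answer. -/
  next : State → ℕ → State
  /-- The instruction is computed from the state. -/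
  instr_computable : Computable instr
  /-- The new state is computed from the old state and the answer. -/
  next_computable : Computable₂ next

attribute [instance] BernoulliMachine.coding

namespace BernoulliMachine

variable {k : ℕ}

/-- The instruction issued by the compiled machine in the state `(s, j, a, d)`: the machine is in
state `s` and, if it is answering a query there, then it has drawn `j` digits of a fresh uniform
random variable, which form the integer `a`; it draws another one if `d` holds, and otherwise
reads the input in order to compare. -/
def compiledInstr (B : BernoulliMachine k) (s : B.State × ℕ × ℕ × Bool) : CoinInstr k :=
  match B.instr s.1 with
  | .inl i => i
  | .inr q => if s.2.2.2 = true then .digit else q.readInstr (q.precision s.2.1)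

/-- The transitions of the compiled machine. -/
def compiledNext (B : BernoulliMachine k) (s : B.State × ℕ × ℕ × Bool) (y : ℕ) :
    B.State × ℕ × ℕ × Bool :=
  match B.instr s.1 with
  | .inl _ => (B.next s.1 y, 0, 0, false)
  | .inr q =>
    if s.2.2.2 = true then (s.1, s.2.1 + 1, 2 * s.2.2.1 + y, false)
    else if q.Accepts s.2.1 s.2.2.1 y then (B.next s.1 1, 0, 0, false)
    else if q.Rejects s.2.1 s.2.2.1 y then (B.next s.1 0, 0, 0, false)
    else (s.1, s.2.1, s.2.2.1, true)

end BernoulliMachine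

/-! ### Computability of the compiled machine -/

lemma Primrec.nat_pow : Primrec₂ ((· ^ ·) : ℕ → ℕ → ℕ) := by
  have h : Primrec₂ fun (a n : ℕ) => n.rec (motive := fun _ => ℕ) 1 fun _ y => y * a :=
    Primrec.nat_rec (Primrec.const 1)
      (Primrec.nat_mul.comp (Primrec.snd.comp Primrec.snd) Primrec.fst).to₂
  refine h.of_eq fun a n => ?_
  induction n with
  | zero => simp
  | succ n ih => rw [pow_succ, ← ih]

namespace CoinInstr

variable {k : ℕ}

lemma primrec_equivSum_symm : Primrec (equivSum k).symm := Primrec.of_equiv_symm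

lemma primrec_halt : Primrec (halt : Bool → CoinInstr k) :=
  (primrec_equivSum_symm.comp Primrec.sumInl).of_eq fun _ => rfl

lemma primrec_flip : Primrec (flip : Fin k → CoinInstr k) :=
  (primrec_equivSum_symm.comp (Primrec.sumInr.comp Primrec.sumInl)).of_eq fun _ => rfl

lemma primrec_readC : Primrec₂ (readC : Fin k → ℕ → CoinInstr k) :=
  (primrec_equivSum_symm.comp (Primrec.sumInr.comp (Primrec.sumInr.comp
    (Primrec.sumInr.comp Primrec.sumInl)))).of_eq fun _ => rfl

lemma primrec_readM : Primrec (readM : ℕ → CoinInstr k) :=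
  (primrec_equivSum_symm.comp (Primrec.sumInr.comp (Primrec.sumInr.comp
    (Primrec.sumInr.comp Primrec.sumInr)))).of_eq fun _ => rfl

end CoinInstr

namespace BernoulliQuery

open Primrec

variable {k : ℕ}

lemma primrec_precision : Primrec₂ (precision : BernoulliQuery k → ℕ → ℕ) :=
  nat_add.comp (nat_add.comp (nat_add.comp snd
    (fst.comp (snd.comp (snd.comp fst)))) (fst.comp (snd.comp (snd.comp (snd.comp fst)))))
    (const 2)

lemma primrec_readInstr : Primrec₂ (readInstr : BernoulliQuery k → ℕ → CoinInstr k) := by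
  have h : Primrec₂ fun (q : BernoulliQuery k) (n : ℕ) =>
      (Option.casesOn q.1 (.readM n) fun i => .readC i n : CoinInstr k) :=
    option_casesOn (fst.comp fst) (CoinInstr.primrec_readM.comp snd)
      (CoinInstr.primrec_readC.comp snd (snd.comp fst)).to₂
  refine h.of_eq fun q n => ?_
  rcases hq : q.1 with _ | i <;> simp [readInstr, hq]

lemma primrec_unit : Primrec₂ (unit : BernoulliQuery k → ℕ → ℕ) :=
  nat_mul.comp (snd.comp (snd.comp (snd.comp (snd.comp fst))))
    (nat_pow.comp (const 2) primrec_precision)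

lemma primrec_scaledApprox :
    Primrec fun x : BernoulliQuery k × ℕ × ℕ => x.1.scaledApprox x.2.1 x.2.2 := by
  have hj : Primrec fun x : BernoulliQuery k × ℕ × ℕ => x.2.1 := fst.comp snd
  have hy : Primrec fun x : BernoulliQuery k × ℕ × ℕ => x.2.2 := snd.comp snd
  have hα : Primrec fun x : BernoulliQuery k × ℕ × ℕ => x.1.2.1 := fst.comp (snd.comp fst)
  have hβ : Primrec fun x : BernoulliQuery k × ℕ × ℕ => x.1.2.2.1 :=
    fst.comp (snd.comp (snd.comp fst))
  have hγ : Primrec fun x : BernoulliQuery k × ℕ × ℕ => x.1.2.2.2.1 :=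
    fst.comp (snd.comp (snd.comp (snd.comp fst)))
  exact nat_mul.comp (nat_pow.comp (const 2) hj)
    (nat_sub.comp (nat_add.comp (nat_mul.comp hα (nat_pow.comp (const 2)
      (primrec_precision.comp fst hj))) (nat_mul.comp hβ hy)) (nat_mul.comp hγ hy))

lemma primrecPred_accepts : PrimrecPred fun x : BernoulliQuery k × ℕ × ℕ × ℕ =>
    x.1.Accepts x.2.1 x.2.2.1 x.2.2.2 :=
  nat_le.comp (nat_mul.comp (nat_add.comp (nat_mul.comp (const 4) (fst.comp (snd.comp snd)))
      (const 5)) (primrec_unit.comp fst (fst.comp snd)))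
    (nat_mul.comp (const 4) (primrec_scaledApprox.comp
      (pair fst (pair (fst.comp snd) (snd.comp (snd.comp snd))))))

lemma primrecPred_rejects : PrimrecPred fun x : BernoulliQuery k × ℕ × ℕ × ℕ =>
    x.1.Rejects x.2.1 x.2.2.1 x.2.2.2 :=
  nat_le.comp (nat_add.comp (nat_mul.comp (const 4) (primrec_scaledApprox.comp
      (pair fst (pair (fst.comp snd) (snd.comp (snd.comp snd))))))
      (primrec_unit.comp fst (fst.comp snd)))
    (nat_mul.comp (nat_mul.comp (const 4) (fst.comp (snd.comp snd)))
      (primrec_unit.comp fst (fst.comp snd)))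

end BernoulliQuery

/-- A function defined by a computable case distinction is computable. -/
lemma Computable.ite_of_primrecPred {α σ : Type*} [Primcodable α] [Primcodable σ] {P : α → Prop}
    [DecidablePred P] {f g : α → σ} (hP : PrimrecPred P) (hf : Computable f) (hg : Computable g) :
    Computable fun a => if P a then f a else g a := by
  have hd : Computable fun a => decide (P a) := hP.decide.to_comp
  exact (Computable.cond hd hf hg).of_eq fun a => by by_cases h : P a <;> simp [h]

namespace BernoulliMachine

variable {k : ℕ} (B : BernoulliMachine k)

lemma computable_compiledInstr : Computable B.compiledInstr := by
  have h : Computable fun s : B.State × ℕ × ℕ × Bool =>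
      (Sum.casesOn (B.instr s.1) id fun q =>
        if s.2.2.2 = true then .digit else q.readInstr (q.precision s.2.1) : CoinInstr k) := by
    refine Computable.sumCasesOn (B.instr_computable.comp Computable.fst) Computable.snd.to₂ ?_
    refine Primrec.to_comp (Primrec.ite ?_ (Primrec.const _) ?_)
    · exact Primrec.eq.comp (Primrec.snd.comp (Primrec.snd.comp (Primrec.snd.comp Primrec.fst)))
        (Primrec.const true)
    · exact BernoulliQuery.primrec_readInstr.comp Primrec.snd
        (BernoulliQuery.primrec_precision.comp Primrec.snd
          (Primrec.fst.comp (Primrec.snd.comp Primrec.fst)))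
  refine h.of_eq fun s => ?_
  rcases hs : B.instr s.1 with i | q <;> simp [compiledInstr, hs]

lemma computable_compiledNext : Computable₂ B.compiledNext := by
  have hfresh : ∀ {α : Type} [Primcodable α] {g : α → B.State}, Computable g →
      Computable fun x => ((g x, 0, 0, false) : B.State × ℕ × ℕ × Bool) :=
    fun hg => hg.pair (Computable.const _)
  have h : Computable fun x : (B.State × ℕ × ℕ × Bool) × ℕ =>
      (Sum.casesOn (B.instr x.1.1) (fun _ => (B.next x.1.1 x.2, 0, 0, false)) fun q =>
        if x.1.2.2.2 = true then (x.1.1, x.1.2.1 + 1, 2 * x.1.2.2.1 + x.2, false)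
        else if q.Accepts x.1.2.1 x.1.2.2.1 x.2 then (B.next x.1.1 1, 0, 0, false)
        else if q.Rejects x.1.2.1 x.1.2.2.1 x.2 then (B.next x.1.1 0, 0, 0, false)
        else (x.1.1, x.1.2.1, x.1.2.2.1, true) : B.State × ℕ × ℕ × Bool) := by
    refine Computable.sumCasesOn
      (B.instr_computable.comp (Computable.fst.comp Computable.fst))
      (hfresh (B.next_computable.comp (Computable.fst.comp (Computable.fst.comp Computable.fst))
        (Computable.snd.comp Computable.fst))).to₂ ?_
    have hs : Primrec fun x : ((B.State × ℕ × ℕ × Bool) × ℕ) × BernoulliQuery k => x.1.1.1 :=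
      Primrec.fst.comp (Primrec.fst.comp Primrec.fst)
    have hj : Primrec fun x : ((B.State × ℕ × ℕ × Bool) × ℕ) × BernoulliQuery k => x.1.1.2.1 :=
      Primrec.fst.comp (Primrec.snd.comp (Primrec.fst.comp Primrec.fst))
    have ha : Primrec fun x : ((B.State × ℕ × ℕ × Bool) × ℕ) × BernoulliQuery k => x.1.1.2.2.1 :=
      Primrec.fst.comp (Primrec.snd.comp (Primrec.snd.comp (Primrec.fst.comp Primrec.fst)))
    have hd : Primrec fun x : ((B.State × ℕ × ℕ × Bool) × ℕ) × BernoulliQuery k => x.1.1.2.2.2 :=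
      Primrec.snd.comp (Primrec.snd.comp (Primrec.snd.comp (Primrec.fst.comp Primrec.fst)))
    have hy : Primrec fun x : ((B.State × ℕ × ℕ × Bool) × ℕ) × BernoulliQuery k => x.1.2 :=
      Primrec.snd.comp Primrec.fst
    have hx := Primrec.snd.pair (hj.pair (ha.pair hy))
    refine Computable.ite_of_primrecPred (Primrec.eq.comp hd (Primrec.const true)) ?_
      (Computable.ite_of_primrecPred (BernoulliQuery.primrecPred_accepts.comp hx) ?_
        (Computable.ite_of_primrecPred (BernoulliQuery.primrecPred_rejects.comp hx) ?_ ?_))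
    · exact (hs.pair ((Primrec.succ.comp hj).pair ((Primrec.nat_add.comp
        (Primrec.nat_mul.comp (Primrec.const 2) ha) hy).pair (Primrec.const false)))).to_comp
    · exact hfresh (B.next_computable.comp hs.to_comp (Computable.const 1))
    · exact hfresh (B.next_computable.comp hs.to_comp (Computable.const 0))
    · exact (hs.pair (hj.pair (ha.pair (Primrec.const true)))).to_comp
  refine h.of_eq fun x => ?_
  rcases hs : B.instr x.1.1 with i | q <;> simp only [compiledNext, hs]

/-- The randomized algorithm that answers each query by comparing its value with a uniform random
variable, whose digits it draws one by one until the comparison is decided. -/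
def compile : CoinAlgorithm k where
  State := B.State × ℕ × ℕ × Bool
  start := (B.start, 0, 0, false)
  instr := B.compiledInstr
  next := B.compiledNext
  instr_computable := B.computable_compiledInstr
  next_computable := B.computable_compiledNext

end BernoulliMachine

/-! ### Supersolutions for the compiled machine -/

/-- The projection of the real line to `[0,1]`: with `x = 2 ^ j * q - a`, this is the conditional
probability that a uniform random variable is below `q`, when its first `j` digits form the
integer `a`. -/
noncomputable def clampUnit (x : ℝ) : ℝ := max 0 (min x 1)

lemma clampUnit_mem (x : ℝ) : clampUnit x ∈ Set.Icc (0 : ℝ) 1 :=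
  ⟨le_max_left _ _, max_le zero_le_one (min_le_right _ _)⟩

lemma clampUnit_of_mem {x : ℝ} (hx : x ∈ Set.Icc (0 : ℝ) 1) : clampUnit x = x := by
  rw [clampUnit, min_eq_left hx.2, max_eq_right hx.1]

lemma clampUnit_of_le_zero {x : ℝ} (hx : x ≤ 0) : clampUnit x = 0 :=
  max_eq_left ((min_le_left _ _).trans hx)

lemma clampUnit_of_one_le {x : ℝ} (hx : 1 ≤ x) : clampUnit x = 1 := by
  rw [clampUnit, min_eq_right hx, max_eq_right zero_le_one]

lemma clampUnit_mean (x : ℝ) : clampUnit (2 * x - 1) + clampUnit (2 * x) = 2 * clampUnit x := by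
  rcases le_total x 0 with h | h
  · rw [clampUnit_of_le_zero h, clampUnit_of_le_zero (by linarith),
      clampUnit_of_le_zero (by linarith)]
    ring
  rcases le_total 1 x with h' | h'
  · rw [clampUnit_of_one_le h', clampUnit_of_one_le (by linarith),
      clampUnit_of_one_le (by linarith)]
    ring
  rw [clampUnit_of_mem ⟨h, h'⟩]
  rcases le_total (2 * x) 1 with h2 | h2
  · rw [clampUnit_of_le_zero (by linarith), clampUnit_of_mem ⟨by linarith, h2⟩]; ring
  · rw [clampUnit_of_one_le h2, clampUnit_of_mem ⟨by linarith, by linarith⟩]; ring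

/-- A bound for the expected number of steps until the comparison of the value of a query with a
uniform random variable is decided, where `x` is as in `clampUnit`. -/
noncomputable def comparisonTime (x : ℝ) : ℝ :=
  if 0 < x ∧ x < 1 then 9 else if -1 < x ∧ x < 2 then 5 else 1

lemma comparisonTime_le (x : ℝ) : comparisonTime x ≤ 9 := by
  unfold comparisonTime; split_ifs <;> norm_num

lemma one_le_comparisonTime (x : ℝ) : 1 ≤ comparisonTime x := by
  unfold comparisonTime; split_ifs <;> norm_num

lemma comparisonTime_mean {x : ℝ} (h1 : -(1 / 2) < x) (h2 : x < 3 / 2) :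
    1 / 2 * comparisonTime (2 * x - 1) + (1 - 1 / 2) * comparisonTime (2 * x) + 2
      ≤ comparisonTime x := by
  unfold comparisonTime
  split_ifs with a1 a2 a3 a4 a5 a6 a7 a8 <;> first
    | norm_num; done
    | (exfalso; grind)

namespace CoinInstr

variable {k : ℕ} {c : Fin k → ℕ → ℕ} {m : ℕ → ℕ} {p : Fin k → ℝ}

lemma meanAnswer_mono (hp : ∀ i, p i ∈ Set.Icc (0 : ℝ) 1) {i : CoinInstr k} {f g : ℕ → ℝ}
    (h : ∀ y ∈ i.answers c m, f y ≤ g y) : i.meanAnswer c m p f ≤ i.meanAnswer c m p g := by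
  rcases i with b | i | _ | ⟨i, n⟩ | n <;> simp only [answers, meanAnswer] at *
  · exact le_rfl
  · have h1 := (hp i).1
    have h2 : 0 ≤ 1 - p i := by linarith [(hp i).2]
    have := h 0 (by simp)
    have := h 1 (by simp)
    gcongr
  · have := h 0 (by simp)
    have := h 1 (by simp)
    linarith
  · exact h _ rfl
  · exact h _ rfl

end CoinInstr

lemma BernoulliQuery.readInstr_answers {k : ℕ} {C : Fin k → ℝ} {M : ℝ} {c : Fin k → ℕ → ℕ}
    {m : ℕ → ℕ} {q : BernoulliQuery k} (hc : ∀ i, IsRealName (c i) (C i))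
    (hm : IsRealName m M) {n y : ℕ} (hy : y ∈ (q.readInstr n).answers c m) :
    |(y : ℝ) / 2 ^ n - q.input C M| ≤ 1 / 2 ^ n := by
  rcases hq : q.1 with _ | i
  · simp only [BernoulliQuery.readInstr, BernoulliQuery.input, hq, Option.elim,
      CoinInstr.answers, Set.mem_singleton_iff] at hy ⊢
    rw [hy]; exact hm n
  · simp only [BernoulliQuery.readInstr, BernoulliQuery.input, hq, Option.elim,
      CoinInstr.answers, Set.mem_singleton_iff] at hy ⊢
    rw [hy]; exact hc i n

namespace BernoulliMachine

variable {k : ℕ}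

/-- The analogue of `CoinAlgorithm.IsSupersolution` for machines with queries. The invariant only
has to be preserved by the answers to queries that have a positive probability. -/
structure IsSupersolution (B : BernoulliMachine k) (C : Fin k → ℝ) (M : ℝ) (c : Fin k → ℕ → ℕ)
    (m : ℕ → ℕ) (p : Fin k → ℝ) (I : B.State → Prop) (lam eta : ℝ) (f : B.State → ℝ) : Prop where
  start : I B.start
  invariant : ∀ s i, I s → B.instr s = .inl i → ∀ y ∈ i.answers c m, I (B.next s y)
  query_valid : ∀ s q, I s → B.instr s = .inr q →
    0 < q.denominator ∧ 0 ≤ q.numerator C M ∧ q.numerator C M ≤ q.denominator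
  invariant_one : ∀ s q, I s → B.instr s = .inr q → 0 < q.value C M → I (B.next s 1)
  invariant_zero : ∀ s q, I s → B.instr s = .inr q → q.value C M < 1 → I (B.next s 0)
  nonneg : ∀ s, I s → 0 ≤ f s
  mean_le : ∀ s i, I s → B.instr s = .inl i → (∀ b, i ≠ .halt b) →
    i.meanAnswer c m p (fun y => f (B.next s y)) + lam * i.flipCount + eta ≤ f s
  query_le : ∀ s q, I s → B.instr s = .inr q →
    q.value C M * f (B.next s 1) + (1 - q.value C M) * f (B.next s 0) + eta ≤ f s

variable {B : BernoulliMachine k} {C : Fin k → ℝ} {M : ℝ} {c : Fin k → ℕ → ℕ} {m : ℕ → ℕ}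
  {p : Fin k → ℝ} {I : B.State → Prop} {lam eta : ℝ} {f : B.State → ℝ}

/-- The quantity `2 ^ j * q - a` of `clampUnit`, for the query `q` of a state of the compiled
machine. -/
noncomputable def offset (C : Fin k → ℝ) (M : ℝ) (q : BernoulliQuery k) (j a : ℕ) : ℝ :=
  2 ^ j * q.value C M - a

lemma offset_succ (q : BernoulliQuery k) (j a b : ℕ) :
    offset C M q (j + 1) (2 * a + b) = 2 * offset C M q j a - b := by
  simp only [offset]; push_cast; ring

/-- The invariant of the compiled machine. -/
def compiledInvariant (B : BernoulliMachine k) (C : Fin k → ℝ) (M : ℝ) (I : B.State → Prop)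
    (s : B.State × ℕ × ℕ × Bool) : Prop :=
  I s.1 ∧ ∀ q, B.instr s.1 = .inr q → s.2.2.1 < 2 ^ s.2.1 ∧
    (s.2.2.2 = true → -(1 / 2) < offset C M q s.2.1 s.2.2.1 ∧
      offset C M q s.2.1 s.2.2.1 < 3 / 2)

/-- The supersolution of the compiled machine. -/
noncomputable def compiledBound (B : BernoulliMachine k) (C : Fin k → ℝ) (M eta : ℝ)
    (f : B.State → ℝ) (s : B.State × ℕ × ℕ × Bool) : ℝ :=
  match B.instr s.1 with
  | .inl _ => f s.1
  | .inr q =>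
    clampUnit (offset C M q s.2.1 s.2.2.1) * f (B.next s.1 1)
      + (1 - clampUnit (offset C M q s.2.1 s.2.2.1)) * f (B.next s.1 0)
      + eta / 9 * (comparisonTime (offset C M q s.2.1 s.2.2.1) - if s.2.2.2 = true then 1 else 0)

lemma compiledInvariant_fresh {s : B.State} (hs : I s) :
    B.compiledInvariant C M I (s, 0, 0, false) :=
  ⟨hs, fun _ _ => ⟨by simp, by simp⟩⟩

namespace IsSupersolution

lemma value_mem (hf : B.IsSupersolution C M c m p I lam eta f) {s : B.State}
    {q : BernoulliQuery k} (hs : I s) (hq : B.instr s = .inr q) :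
    q.value C M ∈ Set.Icc (0 : ℝ) 1 := by
  obtain ⟨h1, h2, h3⟩ := hf.query_valid s q hs hq
  have h1' : (0 : ℝ) < q.denominator := by exact_mod_cast h1
  exact ⟨div_nonneg h2 h1'.le, (div_le_one h1').2 h3⟩

lemma compiledBound_fresh_le (hf : B.IsSupersolution C M c m p I lam eta f) (heta : 0 ≤ eta)
    {s : B.State} (hs : I s) : B.compiledBound C M eta f (s, 0, 0, false) ≤ f s := by
  rcases hq : B.instr s with i | q
  · simp [compiledBound, hq]
  · have h1 := hf.query_le s q hs hq
    have h2 : offset C M q 0 0 = q.value C M := by simp [offset]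
    have h3 := mul_le_mul_of_nonneg_left (comparisonTime_le (q.value C M))
      (show 0 ≤ eta / 9 by positivity)
    simp only [compiledBound, hq, h2, clampUnit_of_mem (hf.value_mem hs hq)]
    simp only [Bool.false_eq_true, if_false, sub_zero]
    linarith

lemma compiledBound_nonneg (hf : B.IsSupersolution C M c m p I lam eta f) (heta : 0 ≤ eta)
    {s : B.State × ℕ × ℕ × Bool} (hs : B.compiledInvariant C M I s) :
    0 ≤ B.compiledBound C M eta f s := by
  obtain ⟨s, j, a, d⟩ := s
  obtain ⟨hI, hs⟩ := hs
  rcases hq : B.instr s with i | q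
  · simpa [compiledBound, hq] using hf.nonneg s hI
  · obtain ⟨ha, -⟩ := hs q hq
    simp only at ha hI
    have hval := hf.value_mem hI hq
    have hcl := clampUnit_mem (offset C M q j a)
    simp only [compiledBound, hq]
    have h1 : 0 ≤ clampUnit (offset C M q j a) * f (B.next s 1) := by
      rcases hval.1.eq_or_lt with h0 | h0
      · rw [clampUnit_of_le_zero (by simp [offset, ← h0]), zero_mul]
      · exact mul_nonneg hcl.1 (hf.nonneg _ (hf.invariant_one s q hI hq h0))
    have h0 : 0 ≤ (1 - clampUnit (offset C M q j a)) * f (B.next s 0) := by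
      rcases hval.2.eq_or_lt with h0 | h0
      · have ha' : (a : ℝ) + 1 ≤ 2 ^ j := by exact_mod_cast ha
        rw [clampUnit_of_one_le (by rw [offset, h0]; linarith), sub_self, zero_mul]
      · exact mul_nonneg (by linarith [hcl.2]) (hf.nonneg _ (hf.invariant_zero s q hI hq h0))
    have h2 : (0 : ℝ) ≤ comparisonTime (offset C M q j a) - if d = true then 1 else 0 := by
      have := one_le_comparisonTime (offset C M q j a)
      split_ifs <;> linarith
    have h3 := mul_nonneg (show 0 ≤ eta / 9 by positivity) h2
    linarith

lemma compiledInvariant_next (hf : B.IsSupersolution C M c m p I lam eta f)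
    (hc : ∀ i, IsRealName (c i) (C i)) (hm : IsRealName m M)
    {s : B.State × ℕ × ℕ × Bool} (hs : B.compiledInvariant C M I s) {y : ℕ}
    (hy : y ∈ (B.compiledInstr s).answers c m) :
    B.compiledInvariant C M I (B.compiledNext s y) := by
  obtain ⟨s, j, a, d⟩ := s
  obtain ⟨hI, hs⟩ := hs
  simp only at hI hs
  rcases hq : B.instr s with i | q
  · simp only [compiledInstr, hq] at hy
    simp only [compiledNext, hq]
    exact compiledInvariant_fresh (hf.invariant s i hI hq y hy)
  · obtain ⟨ha, hd⟩ := hs q hq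
    obtain ⟨hQ, hnum, -⟩ := hf.query_valid s q hI hq
    have ha' : (a : ℝ) + 1 ≤ 2 ^ j := by exact_mod_cast ha
    rcases d with _ | _
    · simp only [compiledInstr, hq, Bool.false_eq_true, if_false] at hy
      have hy' := q.readInstr_answers hc hm hy
      simp only [compiledNext, hq, Bool.false_eq_true, if_false]
      split_ifs with hacc hrej
      · have h1 := hacc.one_le hQ hnum hy'
        refine compiledInvariant_fresh (hf.invariant_one s q hI hq ?_)
        have h2 : 0 < 2 ^ j * q.value C M := by
          have : (0 : ℝ) ≤ a := Nat.cast_nonneg _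
          linarith
        exact pos_of_mul_pos_right h2 (by positivity)
      · have h1 := hrej.le_zero hQ hnum hy'
        refine compiledInvariant_fresh (hf.invariant_zero s q hI hq ?_)
        have h2 : 2 ^ j * q.value C M < 2 ^ j * 1 := by linarith
        exact lt_of_mul_lt_mul_left h2 (by positivity)
      · refine ⟨hI, fun q' hq' => ?_⟩
        obtain rfl : q = q' := by simpa [hq] using hq'
        exact ⟨ha, fun _ => ⟨BernoulliQuery.lt_of_not_rejects hQ hnum hy' hrej,
          BernoulliQuery.lt_of_not_accepts hQ hnum hy' hacc⟩⟩
    · simp only [compiledInstr, hq, if_true, CoinInstr.answers] at hy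
      simp only [compiledNext, hq, if_true]
      refine ⟨hI, fun q' _ => ⟨?_, by simp⟩⟩
      simp only [pow_succ]
      rcases hy with rfl | rfl <;> omega

lemma compiledBound_mean_le (hf : B.IsSupersolution C M c m p I lam eta f)
    (hc : ∀ i, IsRealName (c i) (C i)) (hm : IsRealName m M)
    (hp : ∀ i, p i ∈ Set.Icc (0 : ℝ) 1) (heta : 0 ≤ eta)
    {s : B.State × ℕ × ℕ × Bool} (hs : B.compiledInvariant C M I s)
    (hhalt : ∀ b, B.compiledInstr s ≠ .halt b) :
    (B.compiledInstr s).meanAnswer c m p (fun y => B.compiledBound C M eta f (B.compiledNext s y))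
      + lam * (B.compiledInstr s).flipCount + eta / 9 ≤ B.compiledBound C M eta f s := by
  obtain ⟨s, j, a, d⟩ := s
  obtain ⟨hI, hs⟩ := hs
  simp only at hI hs
  rcases hq : B.instr s with i | q
  · simp only [compiledInstr, compiledNext, compiledBound, hq] at hhalt ⊢
    have h1 := hf.mean_le s i hI hq hhalt
    have h2 := CoinInstr.meanAnswer_mono hp (i := i) (c := c) (m := m)
      (f := fun y => B.compiledBound C M eta f (B.next s y, 0, 0, false))
      (g := fun y => f (B.next s y))
      fun y hy => hf.compiledBound_fresh_le heta (hf.invariant s i hI hq y hy)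
    have h3 : eta / 9 ≤ eta := by linarith
    simp only [compiledBound] at h2
    linarith
  · obtain ⟨ha, hd⟩ := hs q hq
    obtain ⟨hQ, hnum, -⟩ := hf.query_valid s q hI hq
    have hnext := fun y hy =>
      hf.compiledInvariant_next hc hm (s := (s, j, a, d)) ⟨hI, hs⟩ (y := y) hy
    have h9 : 0 ≤ eta / 9 := by positivity
    rcases d with _ | _
    · have hmean : ∀ g : ℕ → ℝ, ∃ y, y ∈ (q.readInstr (q.precision j)).answers c m ∧
          (q.readInstr (q.precision j)).meanAnswer c m p g
            + lam * (q.readInstr (q.precision j)).flipCount = g y := by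
        intro g
        rcases hz : q.1 with _ | i <;>
          simp [BernoulliQuery.readInstr, hz, CoinInstr.answers, CoinInstr.meanAnswer,
            CoinInstr.flipCount]
      obtain ⟨y, hy, hval⟩ := hmean
        fun y => B.compiledBound C M eta f (B.compiledNext (s, j, a, false) y)
      have hinstr : B.compiledInstr (s, j, a, false) = q.readInstr (q.precision j) := by
        simp [compiledInstr, hq]
      have hIy := hnext y (by rw [hinstr]; exact hy)
      rw [hinstr, hval]
      have hy' := q.readInstr_answers hc hm hy
      have hT := mul_le_mul_of_nonneg_left (one_le_comparisonTime (offset C M q j a)) h9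
      simp only [compiledNext, hq, Bool.false_eq_true, if_false] at hIy ⊢
      rw [show B.compiledBound C M eta f (s, j, a, false)
        = clampUnit (offset C M q j a) * f (B.next s 1)
          + (1 - clampUnit (offset C M q j a)) * f (B.next s 0)
          + eta / 9 * comparisonTime (offset C M q j a) by simp [compiledBound, hq]]
      split_ifs at hIy ⊢ with hacc hrej
      · have h1 : 1 ≤ offset C M q j a := hacc.one_le hQ hnum hy'
        have h2 := hf.compiledBound_fresh_le heta hIy.1
        rw [clampUnit_of_one_le h1]
        simp only at h2
        linarith
      · have h1 : offset C M q j a ≤ 0 := hrej.le_zero hQ hnum hy'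
        have h2 := hf.compiledBound_fresh_le heta hIy.1
        rw [clampUnit_of_le_zero h1]
        simp only at h2
        linarith
      · simp only [compiledBound, hq, if_true]
        linarith
    · obtain ⟨hd1, hd2⟩ := hd rfl
      have hT := mul_le_mul_of_nonneg_left (comparisonTime_mean hd1 hd2) h9
      have hcl := clampUnit_mean (offset C M q j a)
      have ho1 := offset_succ (C := C) (M := M) q j a 1
      have ho0 := offset_succ (C := C) (M := M) q j a 0
      rw [Nat.cast_one] at ho1
      rw [Nat.cast_zero, sub_zero, add_zero] at ho0
      simp only [compiledInstr, compiledNext, compiledBound, hq, if_true, CoinInstr.meanAnswer,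
        CoinInstr.flipCount, Bool.false_eq_true, if_false, add_zero, ho1, ho0]
      have hcl' : clampUnit (2 * offset C M q j a - 1)
          = 2 * clampUnit (offset C M q j a) - clampUnit (2 * offset C M q j a) := by linarith
      rw [hcl']
      linarith

/-- A supersolution for a machine with queries gives one for the compiled machine. -/
lemma compile (hf : B.IsSupersolution C M c m p I lam eta f)
    (hc : ∀ i, IsRealName (c i) (C i)) (hm : IsRealName m M)
    (hp : ∀ i, p i ∈ Set.Icc (0 : ℝ) 1) (heta : 0 ≤ eta) :
    B.compile.IsSupersolution c m p (B.compiledInvariant C M I) lam (eta / 9)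
      (B.compiledBound C M eta f) where
  start := compiledInvariant_fresh hf.start
  invariant _ hs _ hy := hf.compiledInvariant_next hc hm hs hy
  nonneg _ hs := hf.compiledBound_nonneg heta hs
  mean_le _ hs hb := hf.compiledBound_mean_le hc hm hp heta hs hb

end IsSupersolution

end BernoulliMachine

/-! ### The machine for linear functions of small mean -/

/-- The states of the machine. Throughout, `B` is a bound for the inputs. In the states `race`,
`sel` and `flip`, the level `E` and the position `pos` say what is being done, and `i` is the
index of an option: `0` stands for the option to stop and `i + 1` for coin `i`. Level `0` is the
initial race; at a level `E ≥ 2` the position performs a random walk between `0` and `4 * E`. -/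
inductive FactoryState : Type
  /-- Computing the bound `B`: the inputs with index below `i` have been read. -/
  | init (i B : ℕ)
  /-- Choosing an option uniformly at random from `0, …, i`. -/
  | race (E pos i B : ℕ)
  /-- Deciding whether option `i` is accepted. -/
  | sel (E pos i B : ℕ)
  /-- Flipping the coin of option `i`. -/
  | flip (E pos i B : ℕ)
  /-- The initial race was won by a coin. -/
  | post (B : ℕ)
  /-- The random walk at level `E` has reached `4 * E`. -/
  | kill (E B : ℕ)
  /-- Halting with output `b`. -/
  | halt (b : Bool)

namespace FactoryState

/-- States as a disjoint sum of standard types, which fixes their coding by numbers. -/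
def equivSum : FactoryState ≃ (ℕ × ℕ) ⊕ (ℕ × ℕ × ℕ × ℕ) ⊕ (ℕ × ℕ × ℕ × ℕ) ⊕ (ℕ × ℕ × ℕ × ℕ) ⊕
    ℕ ⊕ (ℕ × ℕ) ⊕ Bool where
  toFun
    | init i B => .inl (i, B)
    | race E pos i B => .inr (.inl (E, pos, i, B))
    | sel E pos i B => .inr (.inr (.inl (E, pos, i, B)))
    | flip E pos i B => .inr (.inr (.inr (.inl (E, pos, i, B))))
    | post B => .inr (.inr (.inr (.inr (.inl B))))
    | kill E B => .inr (.inr (.inr (.inr (.inr (.inl (E, B))))))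
    | halt b => .inr (.inr (.inr (.inr (.inr (.inr b)))))
  invFun
    | .inl x => init x.1 x.2
    | .inr (.inl x) => race x.1 x.2.1 x.2.2.1 x.2.2.2
    | .inr (.inr (.inl x)) => sel x.1 x.2.1 x.2.2.1 x.2.2.2
    | .inr (.inr (.inr (.inl x))) => flip x.1 x.2.1 x.2.2.1 x.2.2.2
    | .inr (.inr (.inr (.inr (.inl B)))) => post B
    | .inr (.inr (.inr (.inr (.inr (.inl x))))) => kill x.1 x.2
    | .inr (.inr (.inr (.inr (.inr (.inr b))))) => halt b
  left_inv := by rintro (_ | _ | _ | _ | _ | _ | _) <;> rfl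
  right_inv := by rintro (_ | _ | _ | _ | _ | _ | _) <;> rfl

instance : Primcodable FactoryState := Primcodable.ofEquiv _ equivSum

end FactoryState

/-- The `i`-th element of `Fin k`, if there is one. -/
def finOption (k i : ℕ) : Option (Fin k) := (List.finRange k)[i]?

lemma finOption_val {k : ℕ} (i : Fin k) : finOption k i = some i := by
  simp [finOption]

lemma finOption_of_le {k i : ℕ} (h : k ≤ i) : finOption k i = none := by
  simp [finOption, h]

/-- The query that accepts option `i` at level `E`. The options have acceptance probabilities
proportional to `1 - 2 M, C 0, C 1, …` at level `0` and to `E * M, (E - 1) * C 0, (E - 1) * C 1, …`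
at level `E ≥ 2`; they are divided by `B` and by `E * B`. For options up to `k` the junk value
`none` of `finOption` does not occur. -/
def selQuery (k E i B : ℕ) : BernoulliQuery k :=
  if i = 0 then
    if E = 0 then (none, 1, 0, 2, B) else (none, 0, 1, 0, B)
  else
    if E = 0 then (finOption k (i - 1), 0, 1, 0, B)
    else (finOption k (i - 1), 0, E - 1, 0, E * B)

/-- The instructions of the machine. -/
def factoryInstr (k : ℕ) : FactoryState → CoinInstr k ⊕ BernoulliQuery k
  | .init i _ => .inl ((finOption k i).elim (.readM 0) fun j => .readC j 0)
  | .race _ _ i _ => .inr (none, 1, 0, 0, i + 1)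
  | .sel E _ i B => .inr (selQuery k E i B)
  | .flip _ _ i _ => .inl ((finOption k (i - 1)).elim (.halt false) .flip)
  | .post _ => .inr (none, 1, 0, 2, 1)
  | .kill E _ => .inr (none, (2 * E - 2) ^ (4 * E), 0, 0, (2 * E - 1) ^ (4 * E))
  | .halt b => .inl (.halt b)

/-- The state after a race that was won by the option to stop. -/
def afterStop (k E pos B : ℕ) : FactoryState :=
  if E = 0 then .halt false
  else if pos + 1 = 4 * E then .kill E B else .race E (pos + 1) k B

/-- The state after a race that was won by a coin. -/
def afterHeads (k E pos B : ℕ) : FactoryState :=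
  if E = 0 then .post B
  else if pos = 1 then .halt true else .race E (pos - 1) k B

/-- The transitions of the machine. Choosing option `i` with probability `1 / (i + 1)`, for `i`
going down from `k`, makes a uniform choice; option `0` is chosen surely when it is reached, so the
truncation in `0 - 1` does not matter. -/
def factoryNext (k : ℕ) : FactoryState → ℕ → FactoryState
  | .init i B, y => if i < k then .init (i + 1) (B + (y + 1)) else .race 0 0 k B
  | .race E pos i B, y => if y = 1 then .sel E pos i B else .race E pos (i - 1) B
  | .sel E pos i B, y =>
      if y = 1 then if i = 0 then afterStop k E pos B else .flip E pos i B
      else .race E pos k B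
  | .flip E pos _ B, y => if y = 1 then afterHeads k E pos B else .race E pos k B
  | .post B, y => if y = 1 then .halt true else .race 2 1 k B
  | .kill E B, y => if y = 1 then .race (2 * E) (4 * E) k B else .halt false
  | .halt b, _ => .halt b

section Computability

lemma Primrec.sumElim {α β σ : Type*} [Primcodable α] [Primcodable β] [Primcodable σ]
    {f : α ⊕ β → σ} (hl : Primrec fun a => f (.inl a)) (hr : Primrec fun b => f (.inr b)) :
    Primrec f :=
  (Primrec.sumCasesOn Primrec.id (hl.comp Primrec.snd).to₂ (hr.comp Primrec.snd).to₂).of_eq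
    fun x => by cases x <;> rfl

lemma Primrec₂.sumElim {α β γ σ : Type*} [Primcodable α] [Primcodable β] [Primcodable γ]
    [Primcodable σ] {f : α ⊕ β → γ → σ} (hl : Primrec₂ fun a c => f (.inl a) c)
    (hr : Primrec₂ fun b c => f (.inr b) c) : Primrec₂ f :=
  (Primrec.sumCasesOn Primrec.fst
    (f := fun x : (α ⊕ β) × γ => x.1) (g := fun x a => f (.inl a) x.2)
    (h := fun x b => f (.inr b) x.2)
    (hl.comp Primrec.snd (Primrec.snd.comp Primrec.fst)).to₂
    (hr.comp Primrec.snd (Primrec.snd.comp Primrec.fst)).to₂).of_eq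
    fun x => by rcases x with ⟨_ | _, _⟩ <;> rfl

open Primrec

namespace FactoryState

lemma primrec_equivSum_symm : Primrec equivSum.symm := Primrec.of_equiv_symm

lemma primrec_init : Primrec fun x : ℕ × ℕ => init x.1 x.2 :=
  primrec_equivSum_symm.comp sumInl

lemma primrec_race : Primrec fun x : ℕ × ℕ × ℕ × ℕ => race x.1 x.2.1 x.2.2.1 x.2.2.2 :=
  primrec_equivSum_symm.comp (sumInr.comp sumInl)

lemma primrec_sel : Primrec fun x : ℕ × ℕ × ℕ × ℕ => sel x.1 x.2.1 x.2.2.1 x.2.2.2 :=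
  primrec_equivSum_symm.comp (sumInr.comp (sumInr.comp sumInl))

lemma primrec_flip : Primrec fun x : ℕ × ℕ × ℕ × ℕ => flip x.1 x.2.1 x.2.2.1 x.2.2.2 :=
  primrec_equivSum_symm.comp (sumInr.comp (sumInr.comp (sumInr.comp sumInl)))

lemma primrec_post : Primrec post :=
  primrec_equivSum_symm.comp (sumInr.comp (sumInr.comp (sumInr.comp (sumInr.comp sumInl))))

lemma primrec_kill : Primrec fun x : ℕ × ℕ => kill x.1 x.2 :=
  primrec_equivSum_symm.comp
    (sumInr.comp (sumInr.comp (sumInr.comp (sumInr.comp (sumInr.comp sumInl)))))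

end FactoryState

variable (k : ℕ)

lemma primrec_finOption : Primrec (finOption k) :=
  list_getElem?.comp (const _) .id

lemma primrec_selQuery : Primrec fun x : ℕ × ℕ × ℕ => selQuery k x.1 x.2.1 x.2.2 := by
  have hE : Primrec fun x : ℕ × ℕ × ℕ => x.1 := fst
  have hi : Primrec fun x : ℕ × ℕ × ℕ => x.2.1 := fst.comp snd
  have hB : Primrec fun x : ℕ × ℕ × ℕ => x.2.2 := snd.comp snd
  have hz : Primrec fun x : ℕ × ℕ × ℕ => finOption k (x.2.1 - 1) :=
    (primrec_finOption k).comp (nat_sub.comp hi (const 1))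
  refine Primrec.ite (Primrec.eq.comp hi (const 0))
    (Primrec.ite (Primrec.eq.comp hE (const 0)) ?_ ?_)
    (Primrec.ite (Primrec.eq.comp hE (const 0)) ?_ ?_)
  · exact (const _).pair ((const _).pair ((const _).pair ((const _).pair hB)))
  · exact (const _).pair ((const _).pair ((const _).pair ((const _).pair hB)))
  · exact hz.pair ((const _).pair ((const _).pair ((const _).pair hB)))
  · exact hz.pair ((const _).pair ((nat_sub.comp hE (const 1)).pair
      ((const _).pair (nat_mul.comp hE hB))))

lemma primrec_factoryInstr : Primrec (factoryInstr k) := by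
  suffices h : Primrec fun x => factoryInstr k (FactoryState.equivSum.symm x) from
    (h.comp (Primrec.of_equiv (e := FactoryState.equivSum))).of_eq fun s => by simp
  refine sumElim ?_ (sumElim ?_ (sumElim ?_ (sumElim ?_ (sumElim ?_ (sumElim ?_ ?_)))))
  · have h : Primrec fun x : ℕ × ℕ =>
        (Option.casesOn (finOption k x.1) (.readM 0) fun j => .readC j 0 : CoinInstr k) :=
      option_casesOn ((primrec_finOption k).comp fst) (const _)
        (CoinInstr.primrec_readC.comp snd (const 0)).to₂
    exact (sumInl.comp h).of_eq fun x => by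
      rcases hx : finOption k x.1 with _ | j <;> simp [FactoryState.equivSum, factoryInstr, hx]
  · exact sumInr.comp ((const _).pair ((const _).pair ((const _).pair ((const _).pair
      (succ.comp (fst.comp (snd.comp snd)))))))
  · exact sumInr.comp ((primrec_selQuery k).comp (fst.pair
      ((fst.comp (snd.comp snd)).pair (snd.comp (snd.comp snd)))))
  · have h : Primrec fun x : ℕ × ℕ × ℕ × ℕ =>
        (Option.casesOn (finOption k (x.2.2.1 - 1)) (.halt false) fun j => .flip j :
          CoinInstr k) :=
      option_casesOn ((primrec_finOption k).comp
        (nat_sub.comp (fst.comp (snd.comp snd)) (const 1))) (const _)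
        (CoinInstr.primrec_flip.comp snd).to₂
    exact (sumInl.comp h).of_eq fun x => by
      rcases hx : finOption k (x.2.2.1 - 1) with _ | j <;>
        simp [FactoryState.equivSum, factoryInstr, hx]
  · exact const _
  · have h2E : Primrec fun x : ℕ × ℕ => 2 * x.1 := nat_mul.comp (const 2) fst
    have h4E : Primrec fun x : ℕ × ℕ => 4 * x.1 := nat_mul.comp (const 4) fst
    exact sumInr.comp ((const _).pair ((nat_pow.comp (nat_sub.comp h2E (const 2)) h4E).pair
      ((const _).pair ((const _).pair (nat_pow.comp (nat_sub.comp h2E (const 1)) h4E)))))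
  · exact sumInl.comp CoinInstr.primrec_halt

lemma primrec_afterStop : Primrec fun x : ℕ × ℕ × ℕ => afterStop k x.1 x.2.1 x.2.2 := by
  have hE : Primrec fun x : ℕ × ℕ × ℕ => x.1 := fst
  have hpos : Primrec fun x : ℕ × ℕ × ℕ => x.2.1 + 1 := succ.comp (fst.comp snd)
  have hB : Primrec fun x : ℕ × ℕ × ℕ => x.2.2 := snd.comp snd
  exact Primrec.ite (Primrec.eq.comp hE (const 0)) (const _)
    (Primrec.ite (Primrec.eq.comp hpos (nat_mul.comp (const 4) hE))
      (FactoryState.primrec_kill.comp (hE.pair hB))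
      (FactoryState.primrec_race.comp (hE.pair (hpos.pair ((const k).pair hB)))))

lemma primrec_afterHeads : Primrec fun x : ℕ × ℕ × ℕ => afterHeads k x.1 x.2.1 x.2.2 := by
  have hE : Primrec fun x : ℕ × ℕ × ℕ => x.1 := fst
  have hpos : Primrec fun x : ℕ × ℕ × ℕ => x.2.1 := fst.comp snd
  have hB : Primrec fun x : ℕ × ℕ × ℕ => x.2.2 := snd.comp snd
  exact Primrec.ite (Primrec.eq.comp hE (const 0)) (FactoryState.primrec_post.comp hB)
    (Primrec.ite (Primrec.eq.comp hpos (const 1)) (const _)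
      (FactoryState.primrec_race.comp (hE.pair ((nat_sub.comp hpos (const 1)).pair
        ((const k).pair hB)))))

lemma primrec_factoryNext : Primrec₂ (factoryNext k) := by
  suffices h : Primrec₂ fun x y => factoryNext k (FactoryState.equivSum.symm x) y from
    (h.comp ((Primrec.of_equiv (e := FactoryState.equivSum)).comp fst) snd).of_eq
      fun s => by simp
  have hy : ∀ {α : Type} [Primcodable α], PrimrecPred fun x : α × ℕ => x.2 = 1 :=
    Primrec.eq.comp snd (const 1)
  have hE : Primrec fun x : (ℕ × ℕ × ℕ × ℕ) × ℕ => x.1.1 := fst.comp fst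
  have hpos : Primrec fun x : (ℕ × ℕ × ℕ × ℕ) × ℕ => x.1.2.1 := fst.comp (snd.comp fst)
  have hi : Primrec fun x : (ℕ × ℕ × ℕ × ℕ) × ℕ => x.1.2.2.1 :=
    fst.comp (snd.comp (snd.comp fst))
  have hB : Primrec fun x : (ℕ × ℕ × ℕ × ℕ) × ℕ => x.1.2.2.2 :=
    snd.comp (snd.comp (snd.comp fst))
  have hrace := FactoryState.primrec_race.comp (hE.pair (hpos.pair ((const k).pair hB)))
  refine .sumElim ?_ (.sumElim ?_ (.sumElim ?_ (.sumElim ?_ (.sumElim ?_ (.sumElim ?_ ?_)))))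
  · exact Primrec.ite (nat_lt.comp (fst.comp fst) (const k))
      (FactoryState.primrec_init.comp ((succ.comp (fst.comp fst)).pair
        (nat_add.comp (snd.comp fst) (succ.comp snd))))
      (FactoryState.primrec_race.comp ((const 0).pair ((const 0).pair
        ((const k).pair (snd.comp fst)))))
  · exact Primrec.ite hy (FactoryState.primrec_sel.comp fst)
      (FactoryState.primrec_race.comp
        (hE.pair (hpos.pair ((nat_sub.comp hi (const 1)).pair hB))))
  · exact Primrec.ite hy (Primrec.ite (Primrec.eq.comp hi (const 0))
      ((primrec_afterStop k).comp (hE.pair (hpos.pair hB)))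
      (FactoryState.primrec_flip.comp fst)) hrace
  · exact Primrec.ite hy ((primrec_afterHeads k).comp (hE.pair (hpos.pair hB))) hrace
  · exact Primrec.ite hy (const _) (FactoryState.primrec_race.comp ((const 2).pair ((const 1).pair
      ((const k).pair fst))))
  · exact Primrec.ite hy (FactoryState.primrec_race.comp
      ((nat_mul.comp (const 2) (fst.comp fst)).pair
      ((nat_mul.comp (const 4) (fst.comp fst)).pair ((const k).pair (snd.comp fst))))) (const _)
  · exact (FactoryState.primrec_equivSum_symm.comp (sumInr.comp (sumInr.comp (sumInr.comp
      (sumInr.comp (sumInr.comp (sumInr.comp fst))))))).to₂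

end Computability

/-- The machine that outputs `true` with probability `∑ i, C i * p i`. -/
def factory (k : ℕ) : BernoulliMachine k where
  State := FactoryState
  start := .init 0 1
  instr := factoryInstr k
  next := factoryNext k
  instr_computable := (primrec_factoryInstr k).to_comp
  next_computable := (primrec_factoryNext k).to_comp

/-! ### Supersolutions for the machine -/

section FactoryBound

variable {k : ℕ}

/-- The bound for the inputs that is computed from the names of those with index below `i`. -/
def partialBound (c : Fin k → ℕ → ℕ) (i : ℕ) : ℕ :=
  1 + ∑ j : Fin k with j.val < i, (c j 0 + 1)

lemma partialBound_zero (c : Fin k → ℕ → ℕ) : partialBound c 0 = 1 := by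
  simp [partialBound]

lemma partialBound_succ (c : Fin k → ℕ → ℕ) (j : Fin k) :
    partialBound c (j + 1) = partialBound c j + (c j 0 + 1) := by
  have h : ({j' : Fin k | j'.val < j + 1} : Finset (Fin k))
      = insert j ({j' : Fin k | j'.val < j} : Finset (Fin k)) := by
    ext j'
    simp only [Finset.mem_filter, Finset.mem_univ, true_and, Finset.mem_insert, Fin.ext_iff]
    omega
  rw [partialBound, partialBound, h, Finset.sum_insert (by simp)]
  ring

lemma partialBound_pos (c : Fin k → ℕ → ℕ) (i : ℕ) : 0 < partialBound c i := by
  unfold partialBound; omega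

lemma le_partialBound {c : Fin k → ℕ → ℕ} {C : Fin k → ℝ} (hc : ∀ i, IsRealName (c i) (C i))
    (j : Fin k) : C j ≤ partialBound c k := by
  have h1 : c j 0 + 1 ≤ partialBound c k := by
    have : c j 0 + 1 ≤ ∑ j : Fin k with j.val < k, (c j 0 + 1) :=
      Finset.single_le_sum (f := fun j => c j 0 + 1) (fun _ _ => Nat.zero_le _)
        (by simp)
    unfold partialBound; omega
  have h2 : ((c j 0 : ℝ) + 1) ≤ partialBound c k := by exact_mod_cast h1
  have h3 := (abs_le.1 (hc j 0)).1
  norm_num at h3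
  linarith

/-- The levels and positions that occur in races. Since the random walk is entered with
probability `2 M`, it only occurs if `M` is positive. -/
def ValidLevel (M : ℝ) (E pos : ℕ) : Prop :=
  (E = 0 ∧ pos = 0) ∨ (2 ≤ E ∧ 1 ≤ pos ∧ pos < 4 * E ∧ 0 < M)

/-- The invariant of the machine. -/
def factoryInvariant (c : Fin k → ℕ → ℕ) (M : ℝ) : FactoryState → Prop
  | .init i B => i ≤ k ∧ B = partialBound c i
  | .race E pos i B => ValidLevel M E pos ∧ i ≤ k ∧ B = partialBound c k
  | .sel E pos i B => ValidLevel M E pos ∧ i ≤ k ∧ B = partialBound c k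
  | .flip E pos i B => ValidLevel M E pos ∧ i ≤ k ∧ i ≠ 0 ∧ B = partialBound c k
  | .post B => B = partialBound c k
  | .kill E B => 2 ≤ E ∧ 0 < M ∧ B = partialBound c k
  | .halt _ => True

/-- The probability that the random walk continues at level `2 * E` when it reaches `4 * E` at
level `E`. -/
noncomputable def survival (E : ℕ) : ℝ :=
  (((2 * E - 2) ^ (4 * E) : ℕ) : ℝ) / (((2 * E - 1) ^ (4 * E) : ℕ) : ℝ)

lemma survival_mem (E : ℕ) : survival E ∈ Set.Icc (0 : ℝ) 1 := by
  refine ⟨by unfold survival; positivity, div_le_one_of_le₀ ?_ (by positivity)⟩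
  exact_mod_cast Nat.pow_le_pow_left (by omega) _

variable (M lam eta : ℝ) (out : Bool → ℝ) (U : ℕ → ℕ → ℝ)

/-- The value after an initial race that was won by a coin, where `out b` is the value of the
output `b` and `U E pos` is the value of a race at level `E` and position `pos`. -/
noncomputable def postValue : ℝ := eta + ((1 - 2 * M) * out true + 2 * M * U 2 1)

/-- The value when the random walk at level `E` has reached `4 * E`. -/
noncomputable def killValue (E : ℕ) : ℝ :=
  eta + (survival E * U (2 * E) (4 * E) + (1 - survival E) * out false)

/-- The value after a race that was won by the option to stop. -/
noncomputable def stopValue (E pos : ℕ) : ℝ :=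
  if E = 0 then out false else if pos + 1 = 4 * E then killValue eta out U E else U E (pos + 1)

/-- The value after a race that was won by a coin. -/
noncomputable def headsValue (E pos : ℕ) : ℝ :=
  if E = 0 then postValue M eta out U else if pos = 1 then out true else U E (pos - 1)

/-- The mean of the coin of option `i`. -/
def optionMean (p : Fin k → ℝ) (i : ℕ) : ℝ := (finOption k (i - 1)).elim 0 p

/-- The value when option `i` has been accepted. -/
noncomputable def optionValue (p : Fin k → ℝ) (E pos i : ℕ) : ℝ :=
  if i = 0 then stopValue eta out U E pos
  else optionMean p i * headsValue M eta out U E pos + (1 - optionMean p i) * U E pos + lam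

/-- The probability that option `i` is accepted. -/
noncomputable def acceptance (C : Fin k → ℝ) (B E i : ℕ) : ℝ := (selQuery k E i B).value C M

/-- The value of each state of the machine. -/
noncomputable def factoryValue (C : Fin k → ℝ) (p : Fin k → ℝ) : FactoryState → ℝ
  | .init i _ => U 0 0 + eta * (k + 1 - i)
  | .race E pos i B => 1 / (i + 1) * ∑ i' ∈ Finset.range (i + 1),
      ((1 - acceptance M C B E i') * U E pos
        + acceptance M C B E i' * optionValue M lam eta out U p E pos i') + eta * (i + 3)
  | .sel E pos i B => (1 - acceptance M C B E i) * U E pos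
        + acceptance M C B E i * optionValue M lam eta out U p E pos i + 2 * eta
  | .flip E pos i _ =>
      optionMean p i * headsValue M eta out U E pos + (1 - optionMean p i) * U E pos + lam + eta
  | .post _ => postValue M eta out U
  | .kill E _ => killValue eta out U E
  | .halt b => out b

/-- The function `U` satisfies the inequalities that make `factoryValue` a supersolution. They
bound the value of a race by the mean value after it, plus the expected cost of the race. -/
structure IsRaceBound (C : Fin k → ℝ) (B : ℕ) (p : Fin k → ℝ) : Prop where
  out_nonneg : ∀ b, 0 ≤ out b
  nonneg : ∀ E pos, ValidLevel M E pos → 0 ≤ U E pos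
  initial : (1 - 2 * M) * (out false - U 0 0)
    + (∑ i, C i * p i) * (postValue M eta out U - U 0 0) + lam * ∑ i, C i
    + eta * B * ((k + 1) * (k + 3)) ≤ 0
  level : ∀ E pos : ℕ, 2 ≤ E → 1 ≤ pos → pos < 4 * E → 0 < M →
    M * (stopValue eta out U E pos - U E pos)
      + (E - 1) / E * ((∑ i, C i * p i) * (headsValue M eta out U E pos - U E pos)
        + lam * ∑ i, C i) + eta * B * ((k + 1) * (k + 3)) ≤ 0

end FactoryBound

section

variable {k : ℕ} {C : Fin k → ℝ} {M : ℝ} {c : Fin k → ℕ → ℕ} {m : ℕ → ℕ} {p : Fin k → ℝ}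
  {lam eta : ℝ} {out : Bool → ℝ} {U : ℕ → ℕ → ℝ} {B : ℕ}

lemma optionMean_succ (p : Fin k → ℝ) (j : Fin k) : optionMean p (j + 1) = p j := by
  simp [optionMean, finOption_val]

lemma optionMean_mem (hp : ∀ i, p i ∈ Set.Icc (0 : ℝ) 1) (i : ℕ) :
    optionMean p i ∈ Set.Icc (0 : ℝ) 1 := by
  unfold optionMean
  rcases finOption k (i - 1) with _ | j
  · simp
  · exact hp j

lemma acceptance_zero_zero (C : Fin k → ℝ) (M : ℝ) (B : ℕ) :
    acceptance M C B 0 0 = (1 - 2 * M) / B := by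
  simp [acceptance, selQuery, BernoulliQuery.value, BernoulliQuery.numerator,
    BernoulliQuery.denominator, BernoulliQuery.input]

lemma acceptance_level_zero (C : Fin k → ℝ) (M : ℝ) (B : ℕ) {E : ℕ} (hE : E ≠ 0) :
    acceptance M C B E 0 = M / B := by
  simp [acceptance, selQuery, hE, BernoulliQuery.value, BernoulliQuery.numerator,
    BernoulliQuery.denominator, BernoulliQuery.input]

lemma acceptance_zero_succ (C : Fin k → ℝ) (M : ℝ) (B : ℕ) (j : Fin k) :
    acceptance M C B 0 (j + 1) = C j / B := by
  simp [acceptance, selQuery, BernoulliQuery.value, BernoulliQuery.numerator,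
    BernoulliQuery.denominator, BernoulliQuery.input, finOption_val]

lemma acceptance_level_succ (C : Fin k → ℝ) (M : ℝ) (B : ℕ) {E : ℕ} (hE : E ≠ 0) (j : Fin k) :
    acceptance M C B E (j + 1) = (E - 1) / E * C j / B := by
  have h1 : ((E - 1 : ℕ) : ℝ) = E - 1 := by
    rw [Nat.cast_sub (by omega)]; simp
  simp [acceptance, selQuery, hE, BernoulliQuery.value, BernoulliQuery.numerator,
    BernoulliQuery.denominator, BernoulliQuery.input, finOption_val, h1]
  ring

lemma optionValue_zero (E pos : ℕ) :
    optionValue M lam eta out U p E pos 0 = stopValue eta out U E pos := by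
  simp [optionValue]

lemma optionValue_succ (E pos : ℕ) (j : Fin k) :
    optionValue M lam eta out U p E pos (j + 1)
      = p j * headsValue M eta out U E pos + (1 - p j) * U E pos + lam := by
  simp [optionValue, optionMean_succ]

/-- A race bound makes the value of a race at its beginning at most `U`. -/
lemma IsRaceBound.race_le (hU : IsRaceBound M lam eta out U C B p) (hB : 0 < B) {E pos : ℕ}
    (hl : ValidLevel M E pos) : factoryValue M lam eta out U C p (.race E pos k B) ≤ U E pos := by
  have hB' : (0 : ℝ) < B := by exact_mod_cast hB
  have hk : (0 : ℝ) < (k : ℝ) + 1 := by positivity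
  have key : ∑ i' ∈ Finset.range (k + 1), acceptance M C B E i'
      * (optionValue M lam eta out U p E pos i' - U E pos) + eta * ((k + 1) * (k + 3)) ≤ 0 := by
    rw [Finset.sum_range_succ', Finset.sum_range
      fun i => acceptance M C B E (i + 1)
        * (optionValue M lam eta out U p E pos (i + 1) - U E pos)]
    simp only [optionValue_zero, optionValue_succ]
    rcases hl with ⟨rfl, rfl⟩ | ⟨hE, h1, h2, hM⟩
    · have hc := hU.initial
      have hsum : ∑ j : Fin k, acceptance M C B 0 (j + 1)
          * (p j * headsValue M eta out U 0 0 + (1 - p j) * U 0 0 + lam - U 0 0)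
          = ((∑ i, C i * p i) * (postValue M eta out U - U 0 0) + lam * ∑ i, C i) / B := by
        rw [Finset.sum_mul, Finset.mul_sum, ← Finset.sum_add_distrib, Finset.sum_div]
        refine Finset.sum_congr rfl fun j _ => ?_
        simp only [acceptance_zero_succ, headsValue, if_true]
        ring
      rw [hsum, acceptance_zero_zero]
      simp only [stopValue, if_true]
      have h3 := div_nonpos_of_nonpos_of_nonneg hc hB'.le
      have h4 : eta * B * ((k + 1) * (k + 3)) / B = eta * ((k + 1) * (k + 3)) := by
        field_simp
      rw [add_div, h4] at h3
      refine le_trans (le_of_eq ?_) h3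
      ring
    · have hc := hU.level E pos hE h1 h2 hM
      have hE0 : E ≠ 0 := by omega
      have hsum : ∑ j : Fin k, acceptance M C B E (j + 1)
          * (p j * headsValue M eta out U E pos + (1 - p j) * U E pos + lam - U E pos)
          = ((E - 1) / E * ((∑ i, C i * p i) * (headsValue M eta out U E pos - U E pos)
            + lam * ∑ i, C i)) / B := by
        rw [Finset.sum_mul, Finset.mul_sum, ← Finset.sum_add_distrib, Finset.mul_sum,
          Finset.sum_div]
        refine Finset.sum_congr rfl fun j _ => ?_
        simp only [acceptance_level_succ C M B hE0]
        ring
      rw [hsum, acceptance_level_zero C M B hE0]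
      have h3 := div_nonpos_of_nonpos_of_nonneg hc hB'.le
      have h4 : eta * B * ((k + 1) * (k + 3)) / B = eta * ((k + 1) * (k + 3)) := by
        field_simp
      rw [add_div, h4] at h3
      refine le_trans (le_of_eq ?_) h3
      ring
  have hrw : ∑ i' ∈ Finset.range (k + 1), ((1 - acceptance M C B E i') * U E pos
        + acceptance M C B E i' * optionValue M lam eta out U p E pos i')
      = (k + 1) * U E pos + ∑ i' ∈ Finset.range (k + 1), acceptance M C B E i'
      * (optionValue M lam eta out U p E pos i' - U E pos) := by
    have : (k + 1) * U E pos = ∑ i' ∈ Finset.range (k + 1), U E pos := by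
      simp
    rw [this, ← Finset.sum_add_distrib]
    exact Finset.sum_congr rfl fun _ _ => by ring
  simp only [factoryValue]
  rw [hrw]
  set S := ∑ i' ∈ Finset.range (k + 1), acceptance M C B E i'
      * (optionValue M lam eta out U p E pos i' - U E pos)
  have h5 : 1 / ((k : ℝ) + 1) * ((k + 1) * U E pos + S) + eta * (k + 3)
      = U E pos + 1 / ((k : ℝ) + 1) * (S + eta * ((k + 1) * (k + 3))) := by
    field_simp
    ring
  rw [h5]
  have : 1 / ((k : ℝ) + 1) * (S + eta * ((k + 1) * (k + 3))) ≤ 0 :=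
    mul_nonpos_of_nonneg_of_nonpos (by positivity) key
  linarith

lemma IsRaceBound.postValue_nonneg (hU : IsRaceBound M lam eta out U C B p) (heta : 0 ≤ eta)
    (hM0 : 0 ≤ M) (hM : M < 1 / 2) : 0 ≤ postValue M eta out U := by
  have h1 : 0 ≤ (1 - 2 * M) * out true := mul_nonneg (by linarith) (hU.out_nonneg _)
  have h2 : 0 ≤ 2 * M * U 2 1 := by
    rcases hM0.eq_or_lt with h | h
    · simp [← h]
    · exact mul_nonneg (by linarith)
        (hU.nonneg 2 1 (Or.inr ⟨le_rfl, le_rfl, by norm_num, h⟩))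
  unfold postValue
  linarith

lemma IsRaceBound.killValue_nonneg (hU : IsRaceBound M lam eta out U C B p) (heta : 0 ≤ eta)
    (hM : 0 < M) {E : ℕ} (hE : 2 ≤ E) : 0 ≤ killValue eta out U E := by
  obtain ⟨h1, h2⟩ := survival_mem E
  have h3 : 0 ≤ survival E * U (2 * E) (4 * E) :=
    mul_nonneg h1 (hU.nonneg _ _ (Or.inr ⟨by omega, by omega, by omega, hM⟩))
  have h4 : 0 ≤ (1 - survival E) * out false :=
    mul_nonneg (by linarith) (hU.out_nonneg _)
  unfold killValue
  linarith

lemma IsRaceBound.stopValue_nonneg (hU : IsRaceBound M lam eta out U C B p) (heta : 0 ≤ eta)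
    {E pos : ℕ} (hl : ValidLevel M E pos) : 0 ≤ stopValue eta out U E pos := by
  unfold stopValue
  split_ifs with h1 h2
  · exact hU.out_nonneg _
  · rcases hl with h | ⟨hE, _, _, hM⟩
    · exact absurd h.1 h1
    · exact hU.killValue_nonneg heta hM hE
  · rcases hl with h | ⟨hE, h3, h4, hM⟩
    · exact absurd h.1 h1
    · exact hU.nonneg _ _ (Or.inr ⟨hE, by omega, by omega, hM⟩)

lemma IsRaceBound.headsValue_nonneg (hU : IsRaceBound M lam eta out U C B p) (heta : 0 ≤ eta)
    (hM0 : 0 ≤ M) (hM : M < 1 / 2)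
    {E pos : ℕ} (hl : ValidLevel M E pos) : 0 ≤ headsValue M eta out U E pos := by
  unfold headsValue
  split_ifs with h1 h2
  · exact hU.postValue_nonneg heta hM0 hM
  · exact hU.out_nonneg _
  · rcases hl with h | ⟨hE, h3, h4, hM⟩
    · exact absurd h.1 h1
    · exact hU.nonneg _ _ (Or.inr ⟨hE, by omega, by omega, hM⟩)

lemma selQuery_valid (hC : ∀ i, 0 ≤ C i) (hM0 : 0 ≤ M) (hM : M < 1 / 2)
    (hc : ∀ i, IsRealName (c i) (C i)) {E pos i : ℕ} (hl : ValidLevel M E pos) :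
    0 < (selQuery k E i (partialBound c k)).denominator
      ∧ 0 ≤ (selQuery k E i (partialBound c k)).numerator C M
      ∧ (selQuery k E i (partialBound c k)).numerator C M
        ≤ (selQuery k E i (partialBound c k)).denominator := by
  have hB := partialBound_pos c k
  have hB1 : (1 : ℝ) ≤ partialBound c k := by exact_mod_cast hB
  have hz : ∀ z : Option (Fin k), 0 ≤ z.elim M C ∧ z.elim M C ≤ partialBound c k := by
    rintro (_ | j)
    · exact ⟨hM0, by simp only [Option.elim]; linarith⟩
    · exact ⟨hC j, le_partialBound hc j⟩
  obtain ⟨hz0, hz1⟩ := hz (finOption k (i - 1))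
  unfold selQuery
  split_ifs with h1 h2 h2
  · simp only [BernoulliQuery.denominator, BernoulliQuery.numerator, BernoulliQuery.input,
      Option.elim]
    refine ⟨hB, ?_, ?_⟩ <;> push_cast <;> linarith
  · simp only [BernoulliQuery.denominator, BernoulliQuery.numerator, BernoulliQuery.input,
      Option.elim]
    refine ⟨hB, ?_, ?_⟩ <;> push_cast <;> linarith
  · simp only [BernoulliQuery.denominator, BernoulliQuery.numerator, BernoulliQuery.input]
    refine ⟨hB, ?_, ?_⟩ <;> push_cast <;> linarith
  · have hE : 2 ≤ E := by
      rcases hl with h | h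
      · exact absurd h.1 h2
      · exact h.1
    simp only [BernoulliQuery.denominator, BernoulliQuery.numerator, BernoulliQuery.input]
    have hE1 : ((E - 1 : ℕ) : ℝ) ≤ E := by exact_mod_cast Nat.sub_le _ _
    have h3 : ((E - 1 : ℕ) : ℝ) * (finOption k (i - 1)).elim M C
        ≤ E * (partialBound c k : ℝ) := by gcongr
    refine ⟨Nat.mul_pos (by omega) hB, ?_, ?_⟩
    · push_cast
      have : 0 ≤ ((E - 1 : ℕ) : ℝ) * (finOption k (i - 1)).elim M C := by positivity
      linarith
    · rw [Nat.cast_mul]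
      push_cast
      linarith

lemma acceptance_mem (hC : ∀ i, 0 ≤ C i) (hM0 : 0 ≤ M) (hM : M < 1 / 2)
    (hc : ∀ i, IsRealName (c i) (C i)) {E pos i : ℕ} (hl : ValidLevel M E pos) :
    acceptance M C (partialBound c k) E i ∈ Set.Icc (0 : ℝ) 1 := by
  obtain ⟨h1, h2, h3⟩ := selQuery_valid (i := i) hC hM0 hM hc hl
  have h1' : (0 : ℝ) < (selQuery k E i (partialBound c k)).denominator := by exact_mod_cast h1
  exact ⟨div_nonneg h2 h1'.le, (div_le_one h1').2 h3⟩

lemma raceQuery_value (C : Fin k → ℝ) (M : ℝ) (i : ℕ) :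
    BernoulliQuery.value C M ((none, 1, 0, 0, i + 1) : BernoulliQuery k) = 1 / (i + 1) := by
  simp [BernoulliQuery.value, BernoulliQuery.numerator, BernoulliQuery.denominator]

lemma postQuery_value (C : Fin k → ℝ) (M : ℝ) :
    BernoulliQuery.value C M ((none, 1, 0, 2, 1) : BernoulliQuery k) = 1 - 2 * M := by
  simp [BernoulliQuery.value, BernoulliQuery.numerator, BernoulliQuery.denominator,
    BernoulliQuery.input]

lemma killQuery_value (C : Fin k → ℝ) (M : ℝ) (E : ℕ) :
    BernoulliQuery.value C M ((none, (2 * E - 2) ^ (4 * E), 0, 0, (2 * E - 1) ^ (4 * E)) :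
      BernoulliQuery k) = survival E := by
  simp [BernoulliQuery.value, BernoulliQuery.numerator, BernoulliQuery.denominator, survival]

lemma factoryInvariant_afterStop {E pos : ℕ} (hl : ValidLevel M E pos) :
    factoryInvariant c M (afterStop k E pos (partialBound c k)) := by
  unfold afterStop
  split_ifs with h1 h2
  · trivial
  · rcases hl with h | ⟨hE, h3, h4, hM⟩
    · exact absurd h.1 h1
    · exact ⟨hE, hM, rfl⟩
  · rcases hl with h | ⟨hE, h3, h4, hM⟩
    · exact absurd h.1 h1
    · exact ⟨Or.inr ⟨hE, by omega, by omega, hM⟩, le_rfl, rfl⟩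

lemma factoryInvariant_afterHeads {E pos : ℕ} (hl : ValidLevel M E pos) :
    factoryInvariant c M (afterHeads k E pos (partialBound c k)) := by
  unfold afterHeads
  split_ifs with h1 h2
  · rfl
  · trivial
  · rcases hl with h | ⟨hE, h3, h4, hM⟩
    · exact absurd h.1 h1
    · exact ⟨Or.inr ⟨hE, by omega, by omega, hM⟩, le_rfl, rfl⟩

lemma IsRaceBound.factoryValue_afterStop_le
    (hU : IsRaceBound M lam eta out U C (partialBound c k) p) {E pos : ℕ}
    (hl : ValidLevel M E pos) :
    factoryValue M lam eta out U C p (afterStop k E pos (partialBound c k))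
      ≤ stopValue eta out U E pos := by
  unfold afterStop stopValue
  split_ifs with h1 h2
  · exact le_rfl
  · exact le_rfl
  · rcases hl with h | ⟨hE, h3, h4, hM⟩
    · exact absurd h.1 h1
    · exact hU.race_le (partialBound_pos c k) (Or.inr ⟨hE, by omega, by omega, hM⟩)

lemma IsRaceBound.factoryValue_afterHeads_le
    (hU : IsRaceBound M lam eta out U C (partialBound c k) p) {E pos : ℕ}
    (hl : ValidLevel M E pos) :
    factoryValue M lam eta out U C p (afterHeads k E pos (partialBound c k))
      ≤ headsValue M eta out U E pos := by
  unfold afterHeads headsValue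
  split_ifs with h1 h2
  · exact le_rfl
  · exact le_rfl
  · rcases hl with h | ⟨hE, h3, h4, hM⟩
    · exact absurd h.1 h1
    · exact hU.race_le (partialBound_pos c k) (Or.inr ⟨hE, by omega, by omega, hM⟩)

lemma factoryInvariant_race_self {E pos : ℕ} (hl : ValidLevel M E pos) :
    factoryInvariant c M (.race E pos k (partialBound c k)) := ⟨hl, le_rfl, rfl⟩

lemma validLevel_two_one (h : 0 < M) : ValidLevel M 2 1 :=
  Or.inr ⟨le_rfl, le_rfl, by norm_num, h⟩

lemma validLevel_double (h : 0 < M) {E : ℕ} (hE : 2 ≤ E) : ValidLevel M (2 * E) (4 * E) :=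
  Or.inr ⟨by omega, by omega, by omega, h⟩

lemma IsRaceBound.optionValue_nonneg (hU : IsRaceBound M lam eta out U C B p)
    (hp : ∀ i, p i ∈ Set.Icc (0 : ℝ) 1) (hlam : 0 ≤ lam) (heta : 0 ≤ eta)
    (hM0 : 0 ≤ M) (hM : M < 1 / 2) {E pos : ℕ} (hl : ValidLevel M E pos) (i : ℕ) :
    0 ≤ optionValue M lam eta out U p E pos i := by
  unfold optionValue
  split_ifs
  · exact hU.stopValue_nonneg heta hl
  · obtain ⟨h1, h2⟩ := optionMean_mem hp i
    have h3 := mul_nonneg h1 (hU.headsValue_nonneg heta hM0 hM hl)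
    have h4 := mul_nonneg (sub_nonneg.2 h2) (hU.nonneg _ _ hl)
    linarith

/-- A race bound gives a supersolution for the machine. -/
lemma IsRaceBound.isSupersolution (hU : IsRaceBound M lam eta out U C (partialBound c k) p)
    (hC : ∀ i, 0 ≤ C i) (hM0 : 0 ≤ M) (hM : M < 1 / 2) (hc : ∀ i, IsRealName (c i) (C i))
    (hp : ∀ i, p i ∈ Set.Icc (0 : ℝ) 1) (hlam : 0 ≤ lam) (heta : 0 ≤ eta) :
    (factory k).IsSupersolution C M c m p (factoryInvariant c M) lam eta
      (factoryValue M lam eta out U C p) where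
  start := ⟨Nat.zero_le _, (partialBound_zero c).symm⟩
  invariant := by
    rintro s i hs hi y hy
    change factoryInvariant c M (factoryNext k s y)
    change factoryInstr k s = .inl i at hi
    rcases s with ⟨i, B⟩ | ⟨E, pos, i, B⟩ | ⟨E, pos, i, B⟩ | ⟨E, pos, i, B⟩ | B | ⟨E, B⟩ | b <;>
      simp only [factoryInstr, reduceCtorEq, Sum.inl.injEq] at hi
    · obtain ⟨hik, rfl⟩ := hs
      simp only [factoryNext]
      split_ifs with h
      · refine ⟨h, ?_⟩
        have hopt : finOption k i = some ⟨i, h⟩ := finOption_val (⟨i, h⟩ : Fin k)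
        rw [← hi, hopt] at hy
        simp only [Option.elim, CoinInstr.answers, Set.mem_singleton_iff] at hy
        rw [hy, partialBound_succ c ⟨i, h⟩]
      · obtain rfl : i = k := by omega
        exact ⟨Or.inl ⟨rfl, rfl⟩, le_rfl, rfl⟩
    · obtain ⟨hl, hik, -, rfl⟩ := hs
      simp only [factoryNext]
      split_ifs
      · exact factoryInvariant_afterHeads hl
      · exact factoryInvariant_race_self hl
    · rw [← hi] at hy
      exact absurd hy (Set.notMem_empty _)
  query_valid := by
    rintro s q hs hq
    change factoryInstr k s = .inr q at hq
    rcases s with ⟨i, B⟩ | ⟨E, pos, i, B⟩ | ⟨E, pos, i, B⟩ | ⟨E, pos, i, B⟩ | B | ⟨E, B⟩ | b <;>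
      simp only [factoryInstr, reduceCtorEq, Sum.inr.injEq] at hq <;> subst hq
    · simp only [BernoulliQuery.denominator, BernoulliQuery.numerator]
      refine ⟨by omega, ?_, ?_⟩ <;> push_cast <;>
        linarith [(Nat.cast_nonneg i : (0 : ℝ) ≤ i)]
    · obtain ⟨hl, hik, rfl⟩ := hs
      exact selQuery_valid hC hM0 hM hc hl
    · simp only [BernoulliQuery.denominator, BernoulliQuery.numerator, BernoulliQuery.input,
        Option.elim]
      refine ⟨by omega, ?_, ?_⟩ <;> push_cast <;> linarith
    · obtain ⟨hE, -⟩ := hs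
      simp only [BernoulliQuery.denominator, BernoulliQuery.numerator, Nat.cast_zero, zero_mul,
        sub_zero, add_zero]
      exact ⟨Nat.pow_pos (by omega), Nat.cast_nonneg _,
        by exact_mod_cast Nat.pow_le_pow_left (by omega) _⟩
  invariant_one := by
    rintro s q hs hq -
    change factoryInvariant c M (factoryNext k s 1)
    change factoryInstr k s = .inr q at hq
    rcases s with ⟨i, B⟩ | ⟨E, pos, i, B⟩ | ⟨E, pos, i, B⟩ | ⟨E, pos, i, B⟩ | B | ⟨E, B⟩ | b <;>
      simp only [factoryInstr, reduceCtorEq] at hq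
    · exact hs
    · obtain ⟨hl, hik, rfl⟩ := hs
      simp only [factoryNext, if_true]
      split_ifs with h
      · exact factoryInvariant_afterStop hl
      · exact ⟨hl, hik, h, rfl⟩
    · trivial
    · obtain ⟨hE, hM, rfl⟩ := hs
      exact ⟨validLevel_double hM hE, le_rfl, rfl⟩
  invariant_zero := by
    rintro s q hs hq hlt
    change factoryInvariant c M (factoryNext k s 0)
    change factoryInstr k s = .inr q at hq
    rcases s with ⟨i, B⟩ | ⟨E, pos, i, B⟩ | ⟨E, pos, i, B⟩ | ⟨E, pos, i, B⟩ | B | ⟨E, B⟩ | b <;>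
      simp only [factoryInstr, reduceCtorEq, Sum.inr.injEq] at hq
    · obtain ⟨hl, hik, rfl⟩ := hs
      exact ⟨hl, by omega, rfl⟩
    · obtain ⟨hl, hik, rfl⟩ := hs
      exact factoryInvariant_race_self hl
    · rw [← hq, postQuery_value] at hlt
      exact ⟨validLevel_two_one (by linarith), le_rfl, hs⟩
    · trivial
  nonneg := by
    rintro s hs
    rcases s with ⟨i, B⟩ | ⟨E, pos, i, B⟩ | ⟨E, pos, i, B⟩ | ⟨E, pos, i, B⟩ | B | ⟨E, B⟩ | b <;>
      simp only [factoryValue]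
    · have h1 : (i : ℝ) ≤ k := by exact_mod_cast hs.1
      have h2 := hU.nonneg 0 0 (Or.inl ⟨rfl, rfl⟩)
      have h3 : 0 ≤ eta * (k + 1 - i) := mul_nonneg heta (by linarith)
      linarith
    · obtain ⟨hl, hik, rfl⟩ := hs
      refine add_nonneg (mul_nonneg (by positivity) (Finset.sum_nonneg fun i' _ => ?_))
        (by positivity)
      obtain ⟨h1, h2⟩ := acceptance_mem (i := i') hC hM0 hM hc hl
      exact add_nonneg (mul_nonneg (sub_nonneg.2 h2) (hU.nonneg _ _ hl))
        (mul_nonneg h1 (hU.optionValue_nonneg hp hlam heta hM0 hM hl _))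
    · obtain ⟨hl, hik, rfl⟩ := hs
      obtain ⟨h1, h2⟩ := acceptance_mem (i := i) hC hM0 hM hc hl
      exact add_nonneg (add_nonneg (mul_nonneg (sub_nonneg.2 h2) (hU.nonneg _ _ hl))
        (mul_nonneg h1 (hU.optionValue_nonneg hp hlam heta hM0 hM hl _))) (by positivity)
    · obtain ⟨hl, -⟩ := hs
      obtain ⟨h1, h2⟩ := optionMean_mem hp i
      have h3 := mul_nonneg h1 (hU.headsValue_nonneg heta hM0 hM hl)
      have h4 := mul_nonneg (sub_nonneg.2 h2) (hU.nonneg _ _ hl)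
      linarith
    · exact hU.postValue_nonneg heta hM0 hM
    · exact hU.killValue_nonneg heta hs.2.1 hs.1
    · exact hU.out_nonneg b
  mean_le := by
    rintro s i hs hi hhalt
    change i.meanAnswer c m p (fun y => factoryValue M lam eta out U C p (factoryNext k s y))
      + lam * i.flipCount + eta ≤ factoryValue M lam eta out U C p s
    change factoryInstr k s = .inl i at hi
    rcases s with ⟨i', B⟩ | ⟨E, pos, i', B⟩ | ⟨E, pos, i', B⟩ | ⟨E, pos, i', B⟩ | B | ⟨E, B⟩ | b <;>
      simp only [factoryInstr, reduceCtorEq, Sum.inl.injEq] at hi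
    · obtain ⟨hik, rfl⟩ := hs
      rcases hik.eq_or_lt with rfl | hlt
      · rw [finOption_of_le le_rfl, Option.elim] at hi
        rw [← hi]
        have h1 := hU.race_le (partialBound_pos c i') (Or.inl ⟨rfl, rfl⟩)
        simp only [CoinInstr.meanAnswer, CoinInstr.flipCount, factoryNext, lt_irrefl, if_false]
        rw [show factoryValue M lam eta out U C p (.init i' (partialBound c i'))
          = U 0 0 + eta * (i' + 1 - i') from rfl]
        linarith
      · have hopt : finOption k i' = some ⟨i', hlt⟩ := finOption_val (⟨i', hlt⟩ : Fin k)
        rw [hopt, Option.elim] at hi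
        rw [← hi]
        simp only [CoinInstr.meanAnswer, CoinInstr.flipCount, factoryNext, hlt, if_true,
          factoryValue]
        push_cast
        linarith
    · obtain ⟨hl, hik, hi0, rfl⟩ := hs
      have hlt : i' - 1 < k := by omega
      have hopt : finOption k (i' - 1) = some ⟨i' - 1, hlt⟩ :=
        finOption_val (⟨i' - 1, hlt⟩ : Fin k)
      rw [hopt, Option.elim] at hi
      rw [← hi]
      have hmean : optionMean p i' = p ⟨i' - 1, hlt⟩ := by simp [optionMean, hopt]
      have h1 := mul_le_mul_of_nonneg_left (hU.factoryValue_afterHeads_le hl) (hp ⟨i' - 1, hlt⟩).1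
      have h2 := mul_le_mul_of_nonneg_left (hU.race_le (partialBound_pos c k) hl)
        (sub_nonneg.2 (hp ⟨i' - 1, hlt⟩).2)
      simp only [CoinInstr.meanAnswer, CoinInstr.flipCount, factoryNext, if_true, zero_ne_one,
        if_false]
      rw [show factoryValue M lam eta out U C p (.flip E pos i' (partialBound c k))
        = optionMean p i' * headsValue M eta out U E pos + (1 - optionMean p i') * U E pos
          + lam + eta from rfl, hmean]
      linarith
    · exact absurd hi.symm (hhalt b)
  query_le := by
    rintro s q hs hq
    change q.value C M * factoryValue M lam eta out U C p (factoryNext k s 1)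
      + (1 - q.value C M) * factoryValue M lam eta out U C p (factoryNext k s 0) + eta
      ≤ factoryValue M lam eta out U C p s
    change factoryInstr k s = .inr q at hq
    rcases s with ⟨i, B⟩ | ⟨E, pos, i, B⟩ | ⟨E, pos, i, B⟩ | ⟨E, pos, i, B⟩ | B | ⟨E, B⟩ | b <;>
      simp only [factoryInstr, reduceCtorEq, Sum.inr.injEq] at hq
    · rw [← hq, raceQuery_value]
      simp only [factoryNext, if_true, zero_ne_one, if_false]
      rcases i with _ | i
      · simp [factoryValue]
        linarith
      · simp only [factoryValue, Nat.add_sub_cancel]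
        rw [Finset.sum_range_succ _ (i + 1)]
        set S := ∑ i' ∈ Finset.range (i + 1), ((1 - acceptance M C B E i') * U E pos
          + acceptance M C B E i' * optionValue M lam eta out U p E pos i')
        push_cast
        set D := (1 - acceptance M C B E (i + 1)) * U E pos
          + acceptance M C B E (i + 1) * optionValue M lam eta out U p E pos (i + 1)
        have h1 : (0 : ℝ) < (i : ℝ) + 1 + 1 := by positivity
        have h2 : 1 / ((i : ℝ) + 1 + 1) * (D + 2 * eta) + (1 - 1 / ((i : ℝ) + 1 + 1))
              * (1 / ((i : ℝ) + 1) * S + eta * (i + 3)) + eta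
            = 1 / ((i : ℝ) + 1 + 1) * (S + D)
              + eta * ((2 + (i + 1) * (i + 3)) / ((i : ℝ) + 1 + 1) + 1) := by
          field_simp
          ring
        have h3 : (2 + ((i : ℝ) + 1) * (i + 3)) / ((i : ℝ) + 1 + 1) + 1 ≤ i + 1 + 3 := by
          rw [← le_sub_iff_add_le, div_le_iff₀ h1]
          nlinarith [(Nat.cast_nonneg i : (0 : ℝ) ≤ i)]
        have h4 := mul_le_mul_of_nonneg_left h3 heta
        rw [h2]
        linarith
    · obtain ⟨hl, hik, rfl⟩ := hs
      have hacc : q.value C M = acceptance M C (partialBound c k) E i := by rw [← hq]; rfl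
      rw [hacc]
      obtain ⟨h1, h2⟩ := acceptance_mem (i := i) hC hM0 hM hc hl
      have h3 := mul_le_mul_of_nonneg_left (hU.race_le (partialBound_pos c k) hl)
        (sub_nonneg.2 h2)
      have h4 : factoryValue M lam eta out U C p
          (factoryNext k (.sel E pos i (partialBound c k)) 1)
          ≤ optionValue M lam eta out U p E pos i + eta := by
        simp only [factoryNext, if_true, optionValue]
        split_ifs with h
        · have := hU.factoryValue_afterStop_le hl
          linarith
        · exact le_rfl
      have h5 := mul_le_mul_of_nonneg_left h4 h1
      have h6 := mul_le_mul_of_nonneg_right h2 heta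
      rw [show factoryNext k (.sel E pos i (partialBound c k)) 0
        = .race E pos k (partialBound c k) from rfl]
      rw [show factoryValue M lam eta out U C p (.sel E pos i (partialBound c k))
        = (1 - acceptance M C (partialBound c k) E i) * U E pos
          + acceptance M C (partialBound c k) E i * optionValue M lam eta out U p E pos i
          + 2 * eta from rfl]
      linarith
    · rw [← hq, postQuery_value]
      change B = partialBound c k at hs
      subst hs
      rw [show factoryNext k (.post (partialBound c k)) 1 = .halt true from rfl,
        show factoryNext k (.post (partialBound c k)) 0
          = .race 2 1 k (partialBound c k) from rfl,
        show factoryValue M lam eta out U C p (.post (partialBound c k))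
          = eta + ((1 - 2 * M) * out true + 2 * M * U 2 1) from rfl,
        show factoryValue M lam eta out U C p (.halt true) = out true from rfl]
      rcases hM0.eq_or_lt with h0 | h0
      · rw [← h0]; linarith
      · have h1 := mul_le_mul_of_nonneg_left
          (hU.race_le (partialBound_pos c k) (validLevel_two_one h0))
          (show 0 ≤ 2 * M by linarith)
        linarith
    · obtain ⟨hE, hM, rfl⟩ := hs
      rw [← hq, killQuery_value]
      have h1 := mul_le_mul_of_nonneg_left
        (hU.race_le (partialBound_pos c k) (validLevel_double hM hE)) (survival_mem E).1
      rw [show factoryNext k (.kill E (partialBound c k)) 1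
          = .race (2 * E) (4 * E) k (partialBound c k) from rfl,
        show factoryNext k (.kill E (partialBound c k)) 0 = .halt false from rfl,
        show factoryValue M lam eta out U C p (.kill E (partialBound c k))
          = eta + (survival E * U (2 * E) (4 * E) + (1 - survival E) * out false) from rfl,
        show factoryValue M lam eta out U C p (.halt false) = out false from rfl]
      linarith

end

/-! ### The output distribution -/

section

variable {k : ℕ} {C : Fin k → ℝ} {M : ℝ} {c : Fin k → ℕ → ℕ} {m : ℕ → ℕ} {p : Fin k → ℝ}

/-- The ratio between the weight of all coins showing heads and the weight of the option to stop,
for races at level `E ≥ 2` and `r = ∑ i, C i * p i`. -/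
noncomputable def levelRatio (M r : ℝ) (E : ℕ) : ℝ := (E - 1) / E * (r / M)

lemma levelRatio_nonneg {M r : ℝ} (hM : 0 < M) (hr : 0 ≤ r) {E : ℕ} (hE : 2 ≤ E) :
    0 ≤ levelRatio M r E := by
  have hE' : (2 : ℝ) ≤ E := by exact_mod_cast hE
  have : (0 : ℝ) ≤ E - 1 := by linarith
  unfold levelRatio
  positivity

lemma levelRatio_le {M r : ℝ} (hM : 0 < M) (hrM : r ≤ M) {E : ℕ} (hE : 2 ≤ E) :
    levelRatio M r E ≤ 1 - 1 / E := by
  have hE' : (2 : ℝ) ≤ E := by exact_mod_cast hE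
  have h1 : (0 : ℝ) ≤ (E - 1) / E := div_nonneg (by linarith) (by linarith)
  have h2 : r / M ≤ 1 := (div_le_one hM).2 hrM
  calc levelRatio M r E ≤ (E - 1) / E * 1 := mul_le_mul_of_nonneg_left h2 h1
    _ = 1 - 1 / E := by field_simp

lemma survival_eq {E : ℕ} (hE : 2 ≤ E) :
    survival E = (((2 : ℝ) * E - 2) / (2 * E - 1)) ^ (4 * E) := by
  have h1 : ((2 * E - 2 : ℕ) : ℝ) = 2 * E - 2 := by
    rw [Nat.cast_sub (by omega)]; push_cast; ring
  have h2 : ((2 * E - 1 : ℕ) : ℝ) = 2 * E - 1 := by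
    rw [Nat.cast_sub (by omega)]; push_cast; ring
  rw [survival, Nat.cast_pow, Nat.cast_pow, h1, h2, div_pow]

/-- The survival probability makes up for the change of the ratio from level `E` to `2 * E`. -/
lemma survival_mul_levelRatio_pow (M r : ℝ) {E : ℕ} (hE : 2 ≤ E) :
    survival E * levelRatio M r (2 * E) ^ (4 * E) = levelRatio M r E ^ (4 * E) := by
  have hE' : (2 : ℝ) ≤ E := by exact_mod_cast hE
  have h1 : (2 : ℝ) * E - 1 ≠ 0 := by linarith
  rw [survival_eq hE, ← mul_pow]
  congr 1
  unfold levelRatio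
  push_cast
  field_simp

/-- The probability that the output of a run is `true` when a race at level `E` and position
`pos` begins. -/
noncomputable def trueProbability (M r : ℝ) (E pos : ℕ) : ℝ :=
  if E = 0 then r else levelRatio M r E ^ pos

lemma trueProbability_mem {M r : ℝ} (hM : M < 1 / 2) (hr : 0 ≤ r) (hrM : r ≤ M) {E pos : ℕ}
    (hl : ValidLevel M E pos) : trueProbability M r E pos ∈ Set.Icc (0 : ℝ) 1 := by
  rcases hl with ⟨rfl, -⟩ | ⟨hE, -, -, hM0⟩
  · simp only [trueProbability, if_true]
    exact ⟨hr, by linarith⟩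
  · have h1 := levelRatio_nonneg hM0 hr hE
    have h2 := levelRatio_le hM0 hrM hE
    have h3 : (0 : ℝ) ≤ 1 / E := by positivity
    rw [trueProbability, if_neg (by omega)]
    exact ⟨pow_nonneg h1 _, pow_le_one₀ h1 (by linarith)⟩

/-- If the output `true` has value `x` and `false` has value `y`, then the mean value of the
output is a race bound without costs. -/
lemma isRaceBound_trueProbability (hM : M < 1 / 2) (hr : 0 ≤ ∑ i, C i * p i)
    (hrM : ∑ i, C i * p i ≤ M) (B : ℕ) {out : Bool → ℝ} (hout : ∀ b, 0 ≤ out b) :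
    IsRaceBound M 0 0 out (fun E pos => out false
      + (out true - out false) * trueProbability M (∑ i, C i * p i) E pos) C B p where
  out_nonneg := hout
  nonneg E pos hl := by
    obtain ⟨h1, h2⟩ := trueProbability_mem hM hr hrM hl
    have h3 := mul_nonneg h1 (hout true)
    have h4 := mul_nonneg (sub_nonneg.2 h2) (hout false)
    linarith
  initial := by
    set r := ∑ i, C i * p i
    have h1 : 2 * M * trueProbability M r 2 1 = r := by
      rcases (hr.trans hrM).eq_or_lt with h | h
      · have : r = 0 := le_antisymm (h ▸ hrM) hr
        rw [← h, this]; simp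
      · simp only [trueProbability, levelRatio, OfNat.ofNat_ne_zero, if_false, pow_one]
        push_cast
        field_simp
        ring
    have h0 : trueProbability M r 0 0 = r := by simp [trueProbability]
    have h2 : 2 * M * (out false + (out true - out false) * trueProbability M r 2 1)
        = 2 * M * out false + (out true - out false) * r := by
      linear_combination (out true - out false) * h1
    simp only [postValue, h0, h2]
    apply le_of_eq
    ring
  level E pos hE h1 h2 hM0 := by
    set r := ∑ i, C i * p i
    have hE0 : E ≠ 0 := by omega
    have hρ : (E - 1) / E * r = M * levelRatio M r E := by unfold levelRatio; field_simp
    have hstopValue : stopValue 0 out (fun E pos => out false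
        + (out true - out false) * trueProbability M r E pos) E pos
        = out false + (out true - out false) * levelRatio M r E ^ (pos + 1) := by
      simp only [stopValue, hE0, if_false]
      split_ifs with h
      · have h3 := survival_mul_levelRatio_pow M r hE
        have h4 : 2 * E ≠ 0 := by omega
        simp only [killValue, trueProbability, h4, if_false]
        rw [h, ← h3]
        ring
      · simp only [trueProbability, hE0, if_false]
    have hheadsValue : headsValue M 0 out (fun E pos => out false
        + (out true - out false) * trueProbability M r E pos) E pos
        = out false + (out true - out false) * levelRatio M r E ^ (pos - 1) := by
      simp only [headsValue, hE0, if_false]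
      split_ifs with h
      · simp [h]
      · simp only [trueProbability, hE0, if_false]
    rw [hstopValue, hheadsValue]
    simp only [trueProbability, hE0, if_false]
    obtain ⟨n, rfl⟩ : ∃ n, pos = n + 1 := ⟨pos - 1, by omega⟩
    rw [Nat.add_sub_cancel]
    apply le_of_eq
    set ρ := levelRatio M r E
    have : (E - 1 : ℝ) / E * (r * (out false + (out true - out false) * ρ ^ n
        - (out false + (out true - out false) * ρ ^ (n + 1))) + 0 * ∑ i, C i)
        = M * ρ * ((out true - out false) * (ρ ^ n - ρ ^ (n + 1))) := by
      rw [← hρ]; ring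
    rw [this]
    ring

end

/-! ### The cost of the random walk -/

section Walk

/-- The expected cost of a random walk from `pos` until it hits `0` or `m`, where the step to the
left has odds `ρ : 1`, the cost of a step is `s / (1 + ρ)` and `T` is the cost of hitting `m`. -/
noncomputable def walkCost (ρ s T : ℝ) (m pos : ℕ) : ℝ :=
  (s * m / (1 - ρ) + T) * ((1 - ρ ^ pos) / (1 - ρ ^ m)) - s * pos / (1 - ρ)

variable {ρ s T : ℝ} {m pos : ℕ}

lemma walkCost_zero : walkCost ρ s T m 0 = 0 := by simp [walkCost]

lemma walkCost_self (hρ : 0 ≤ ρ) (hρ1 : ρ < 1) (hm : m ≠ 0) : walkCost ρ s T m m = T := by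
  have h : 1 - ρ ^ m ≠ 0 := by
    have := pow_lt_one₀ hρ hρ1 hm
    linarith
  rw [walkCost, div_self h]
  ring

lemma walkCost_step (hρ1 : ρ < 1) (n : ℕ) :
    walkCost ρ s T m (n + 2) + ρ * walkCost ρ s T m n + s = (1 + ρ) * walkCost ρ s T m (n + 1) := by
  have h : 1 - ρ ≠ 0 := by linarith
  unfold walkCost
  set X := s * m / (1 - ρ) + T
  set Y := 1 - ρ ^ m
  have h1 : s * ((n + 2 : ℕ) : ℝ) / (1 - ρ) + ρ * (s * n / (1 - ρ)) - s
      = (1 + ρ) * (s * ((n + 1 : ℕ) : ℝ) / (1 - ρ)) := by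
    push_cast
    field_simp
    ring
  have h2 : (1 - ρ ^ (n + 2)) / Y + ρ * ((1 - ρ ^ n) / Y)
      = (1 + ρ) * ((1 - ρ ^ (n + 1)) / Y) := by
    rw [mul_div_assoc', mul_div_assoc', ← add_div]
    congr 1
    ring
  linear_combination X * h2 - h1

lemma mul_pow_le_geom_sum (hρ : 0 ≤ ρ) (hρ1 : ρ ≤ 1) (n : ℕ) :
    n * ρ ^ n ≤ ∑ j ∈ Finset.range n, ρ ^ j := by
  calc (n : ℝ) * ρ ^ n = ∑ j ∈ Finset.range n, ρ ^ n := by simp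
    _ ≤ _ := Finset.sum_le_sum fun j hj =>
      pow_le_pow_of_le_one hρ hρ1 (Finset.mem_range.1 hj).le

/-- The function `n ↦ (1 - ρ ^ n) / n` is decreasing. -/
lemma mul_one_sub_pow_le (hρ : 0 ≤ ρ) (hρ1 : ρ ≤ 1) (h : pos ≤ m) :
    pos * (1 - ρ ^ m) ≤ m * (1 - ρ ^ pos) := by
  induction m, h using Nat.le_induction with
  | base => exact le_rfl
  | succ m hm ih =>
    have h1 : pos * ρ ^ pos ≤ ∑ j ∈ Finset.range pos, ρ ^ j := mul_pow_le_geom_sum hρ hρ1 _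
    have h2 : (∑ j ∈ Finset.range pos, ρ ^ j) * (1 - ρ) = 1 - ρ ^ pos := geom_sum_mul_neg ρ pos
    have h3 := mul_le_mul_of_nonneg_right h1 (sub_nonneg.2 hρ1)
    have h4 : (pos : ℝ) * (1 - ρ) * ρ ^ m ≤ pos * (1 - ρ) * ρ ^ pos :=
      mul_le_mul_of_nonneg_left (pow_le_pow_of_le_one hρ hρ1 hm)
        (mul_nonneg (Nat.cast_nonneg _) (sub_nonneg.2 hρ1))
    push_cast
    rw [pow_succ]
    linarith

lemma walkCost_nonneg (hρ : 0 ≤ ρ) (hρ1 : ρ < 1) (hs : 0 ≤ s) (hT : 0 ≤ T) (hm : m ≠ 0)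
    (h : pos ≤ m) : 0 ≤ walkCost ρ s T m pos := by
  have hY : 0 < 1 - ρ ^ m := by
    have := pow_lt_one₀ hρ hρ1 hm
    linarith
  have hρ' : 0 < 1 - ρ := by linarith
  have h1 : pos ≤ m * ((1 - ρ ^ pos) / (1 - ρ ^ m)) := by
    rw [mul_div_assoc', le_div_iff₀ hY]
    exact mul_one_sub_pow_le hρ hρ1.le h
  have h2 : 0 ≤ (1 - ρ ^ pos) / (1 - ρ ^ m) :=
    div_nonneg (sub_nonneg.2 (pow_le_one₀ hρ hρ1.le)) hY.le
  have h3 := mul_le_mul_of_nonneg_left h1 (div_nonneg hs hρ'.le)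
  have h4 := mul_nonneg hT h2
  unfold walkCost
  have h5 : (s * m / (1 - ρ) + T) * ((1 - ρ ^ pos) / (1 - ρ ^ m)) - s * pos / (1 - ρ)
      = s / (1 - ρ) * (m * ((1 - ρ ^ pos) / (1 - ρ ^ m))) - s / (1 - ρ) * pos
        + T * ((1 - ρ ^ pos) / (1 - ρ ^ m)) := by ring
  rw [h5]
  linarith

lemma walkCost_le (hρ : 0 ≤ ρ) (hρ1 : ρ < 1) (hs : 0 ≤ s) (hT : 0 ≤ T) (hm : m ≠ 0)
    (h : pos ≤ m) : walkCost ρ s T m pos ≤ s * (m - pos) / (1 - ρ) + T := by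
  have hY : 0 < 1 - ρ ^ m := by
    have := pow_lt_one₀ hρ hρ1 hm
    linarith
  have hρ' : 0 < 1 - ρ := by linarith
  have h1 : (1 - ρ ^ pos) / (1 - ρ ^ m) ≤ 1 := by
    rw [div_le_one hY]
    have := pow_le_pow_of_le_one hρ hρ1.le h
    linarith
  have h2 : 0 ≤ s * m / (1 - ρ) + T := by positivity
  have h3 := mul_le_mul_of_nonneg_left h1 h2
  unfold walkCost
  have h4 : s * (m - pos) / (1 - ρ) = s * m / (1 - ρ) - s * pos / (1 - ρ) := by ring
  rw [h4]
  linarith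

/-- From position `1`, the walk often hits `0` early; this gives a bound that does not involve
`1 / (1 - ρ)`. -/
lemma walkCost_one_le (hρ : 0 ≤ ρ) (hρ1 : ρ < 1) (hs : 0 ≤ s) (hT : 0 ≤ T) :
    walkCost ρ s T (m + 1) 1 ≤ s * m + T := by
  have hρ' : 0 < 1 - ρ := by linarith
  set S := ∑ j ∈ Finset.range (m + 1), ρ ^ j with hS
  have hgeom : S * (1 - ρ) = 1 - ρ ^ (m + 1) := geom_sum_mul_neg ρ (m + 1)
  have hS1 : 1 + m * ρ ^ (m + 1) ≤ S := by
    rw [hS, Finset.sum_range_succ', pow_zero, add_comm]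
    gcongr
    calc (m : ℝ) * ρ ^ (m + 1) = ∑ j ∈ Finset.range m, ρ ^ (m + 1) := by simp
      _ ≤ _ := Finset.sum_le_sum fun j hj =>
        pow_le_pow_of_le_one hρ hρ1.le (by have := Finset.mem_range.1 hj; omega)
  have hS0 : 1 ≤ S := by
    have : 0 ≤ m * ρ ^ (m + 1) := by positivity
    linarith
  have hSpos : 0 < S := by linarith
  have hm : ((m + 1 : ℕ) : ℝ) ≤ S + m * (S * (1 - ρ)) := by
    rw [hgeom]
    push_cast
    linarith
  have h1 : walkCost ρ s T (m + 1) 1 = (s * ((m + 1 : ℕ) / S - 1)) / (1 - ρ) + T / S := by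
    unfold walkCost
    rw [pow_one, ← hgeom]
    field_simp
    push_cast
    ring
  have h2 : T / S ≤ T := div_le_self hT hS0
  have h3 : (s * ((m + 1 : ℕ) / S - 1)) / (1 - ρ) ≤ s * m := by
    rw [div_le_iff₀ hρ', mul_assoc]
    refine mul_le_mul_of_nonneg_left ?_ hs
    rw [sub_le_iff_le_add, div_le_iff₀ hSpos]
    linarith
  rw [h1]
  linarith

end Walk

/-! ### The expected number of flips -/

lemma survival_two : survival 2 = 256 / 6561 := by
  rw [survival_eq le_rfl]; norm_num

lemma survival_le {E : ℕ} (hE : 2 ≤ E) : survival E ≤ 1 / 7 := by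
  have hE' : (2 : ℝ) ≤ E := by exact_mod_cast hE
  have hpos : (0 : ℝ) < 2 * E - 1 := by linarith
  have h1 : (2 * (E : ℝ) - 2) / (2 * E - 1) ≤ Real.exp (-(1 / (2 * E - 1))) := by
    have h := Real.add_one_le_exp (-(1 / (2 * (E : ℝ) - 1)))
    refine le_trans (le_of_eq ?_) h
    field_simp
    ring
  have h0 : 0 ≤ (2 * (E : ℝ) - 2) / (2 * E - 1) := div_nonneg (by linarith) hpos.le
  have h2 : survival E ≤ Real.exp (-2) := by
    rw [survival_eq hE]
    refine (pow_le_pow_left₀ h0 h1 _).trans ?_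
    rw [← Real.exp_nat_mul]
    refine Real.exp_le_exp.2 ?_
    have h3 : (2 : ℝ) ≤ (4 * E) * (1 / (2 * E - 1)) := by
      rw [mul_one_div, le_div_iff₀ hpos]
      linarith
    push_cast
    linarith
  have h3 : (7 : ℝ) ≤ Real.exp 2 := by
    have h4 := Real.exp_one_gt_d9
    have h5 : Real.exp 2 = Real.exp 1 * Real.exp 1 := by rw [← Real.exp_add]; norm_num
    rw [h5]
    nlinarith
  refine h2.trans ?_
  rw [Real.exp_neg, ← one_div]
  exact one_div_le_one_div_of_le (by norm_num) h3

section

variable {k : ℕ}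

/-- The cost that is still to come when the random walk at level `E` reaches `4 * E`, where `b`
bounds the cost of the decision to continue and `(a + b) * 9.5 * (2 * E) ^ 2` the cost from the
beginning of level `2 * E`. -/
noncomputable def exitCost (a b : ℝ) (E : ℕ) : ℝ :=
  b + survival E * ((a + b) * (9.5 * (2 * E) ^ 2))

/-- The cost of the random walk from level `E` and position `pos` on, where a race at
level `E` costs `2 * (E - 1) / E * a / (1 + ρ)`. Its first factor is the quotient of the weights of
the coins, relative to the option to stop, at level `E` and at level `2`. -/
noncomputable def levelCost (M r a b : ℝ) (E pos : ℕ) : ℝ :=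
  walkCost (levelRatio M r E) (2 * (E - 1) / E * a) (exitCost a b E) (4 * E) pos

variable {M r a b : ℝ}

lemma exitCost_nonneg (ha : 0 ≤ a) (hb : 0 ≤ b) (E : ℕ) : 0 ≤ exitCost a b E := by
  have := (survival_mem E).1
  unfold exitCost
  positivity

lemma levelRatio_lt_one (hM : 0 < M) (hrM : r ≤ M) {E : ℕ} (hE : 2 ≤ E) :
    levelRatio M r E < 1 := by
  have hE' : (2 : ℝ) ≤ E := by exact_mod_cast hE
  have h1 : (0 : ℝ) < 1 / E := by positivity
  linarith [levelRatio_le hM hrM hE]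

lemma stepCost_nonneg (ha : 0 ≤ a) {E : ℕ} (hE : 2 ≤ E) : 0 ≤ 2 * ((E : ℝ) - 1) / E * a := by
  have hE' : (2 : ℝ) ≤ E := by exact_mod_cast hE
  have : (0 : ℝ) ≤ E - 1 := by linarith
  positivity

lemma levelCost_nonneg (hM : 0 < M) (hr : 0 ≤ r) (hrM : r ≤ M) (ha : 0 ≤ a) (hb : 0 ≤ b)
    {E pos : ℕ} (hE : 2 ≤ E) (hpos : pos ≤ 4 * E) : 0 ≤ levelCost M r a b E pos :=
  walkCost_nonneg (levelRatio_nonneg hM hr hE) (levelRatio_lt_one hM hrM hE)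
    (stepCost_nonneg ha hE) (exitCost_nonneg ha hb E) (by omega) hpos

/-- The cost from the beginning of a level `E ≥ 4` grows quadratically in `E`, which is `2 * E`
in the statement: the walk is at distance `2 * E` from its right end, its drift is of order at
least `1 / E`, and it continues with probability at most `1 / 7`. The recursion closes because
`4 + 4 * 9.5 / 7 ≤ 9.5`. -/
lemma levelCost_double_le (hM : 0 < M) (hr : 0 ≤ r) (hrM : r ≤ M) (ha : 0 ≤ a) (hb : 0 ≤ b)
    {E : ℕ} (hE : 2 ≤ E) :
    levelCost M r a b (2 * E) (4 * E) ≤ (a + b) * (9.5 * (2 * E) ^ 2) := by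
  have hF : 2 ≤ 2 * E := by omega
  have h1 := walkCost_le (levelRatio_nonneg hM hr hF) (levelRatio_lt_one hM hrM hF)
    (stepCost_nonneg ha hF) (exitCost_nonneg ha hb (2 * E)) (m := 4 * (2 * E)) (pos := 4 * E)
    (by omega) (by omega)
  refine h1.trans ?_
  have h2 := levelRatio_le hM hrM hF
  have h3 := survival_le hF
  set ρ := levelRatio M r (2 * E)
  set F : ℝ := 2 * E with hFdef
  have hcast : ((2 * E : ℕ) : ℝ) = F := by push_cast; rfl
  have hF4 : 4 ≤ F := by
    have hE' : (2 : ℝ) ≤ E := by exact_mod_cast hE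
    linarith
  have h4 : (((4 * (2 * E) : ℕ) : ℝ) - ((4 * E : ℕ) : ℝ)) = 2 * F := by
    push_cast; rw [hFdef]; ring
  rw [hcast] at h2 ⊢
  rw [h4]
  have hFinv : 0 < 1 / F := by positivity
  have hρ' : 1 / F ≤ 1 - ρ := by linarith
  have h5 : 2 * (F - 1) / F * a * (2 * F) / (1 - ρ) ≤ 4 * F ^ 2 * a := by
    rw [div_le_iff₀ (by linarith)]
    have h6 : 2 * (F - 1) / F * a * (2 * F) = 4 * (F - 1) * a := by field_simp; ring
    have h7 : 4 * F ^ 2 * a * (1 / F) ≤ 4 * F ^ 2 * a * (1 - ρ) := by gcongr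
    have h8 : 4 * F ^ 2 * a * (1 / F) = 4 * F * a := by field_simp
    rw [h6]
    nlinarith
  have h9 : exitCost a b (2 * E) ≤ b + 1 / 7 * ((a + b) * (9.5 * (2 * F) ^ 2)) := by
    unfold exitCost
    rw [hcast]
    gcongr
  have h10 : b ≤ b * (F ^ 2 / 16) := le_mul_of_one_le_right hb (by nlinarith)
  have h11 : 0 ≤ a * F ^ 2 := by positivity
  nlinarith

lemma levelCost_two_one_le (hM : 0 < M) (hr : 0 ≤ r) (hrM : r ≤ M) (ha : 0 ≤ a) (hb : 0 ≤ b) :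
    levelCost M r a b 2 1 ≤ 13 * (a + b) := by
  have h1 := walkCost_one_le (m := 7) (levelRatio_nonneg hM hr le_rfl)
    (levelRatio_lt_one hM hrM le_rfl) ha (exitCost_nonneg ha hb 2)
  have h2 : levelCost M r a b 2 1
      = walkCost (levelRatio M r 2) a (exitCost a b 2) (7 + 1) 1 := by
    simp only [levelCost]
    norm_num
  rw [h2]
  refine h1.trans ?_
  -- `7 * a + b + 256 / 6561 * 152 * (a + b) ≤ 13 * (a + b)`
  rw [exitCost, survival_two]
  push_cast
  norm_num
  linarith

/-- The cost of a run from a race at level `E` and position `pos` on, where `F` is the expected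
cost of the initial race and of what follows it, multiplied by `1 - 2 * M + r`. -/
noncomputable def totalCost (M r a b F : ℝ) (E pos : ℕ) : ℝ :=
  if E = 0 then F / (1 - 2 * M + r) else levelCost M r a b E pos

variable {C : Fin k → ℝ} {p : Fin k → ℝ}

/-- The race bound for a flip cost of `1` and a step cost of `eta`. The step costs are accounted
for by an arbitrary constant `K` that is large enough. -/
lemma isRaceBound_totalCost (hC : ∀ i, 0 ≤ C i) (hM : M < 1 / 2) (hr : 0 ≤ ∑ i, C i * p i)
    (hrM : ∑ i, C i * p i ≤ M) (B : ℕ) {eta K : ℝ} (heta : 0 ≤ eta) (hK : 1 ≤ K)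
    (hKM : 0 < M → B * ((k + 1) * (k + 3)) ≤ M * K) :
    IsRaceBound M 1 eta (fun _ => 0)
      (totalCost M (∑ i, C i * p i) ((∑ i, C i) / (2 * M) + eta * K) (eta * K)
        (∑ i, C i + (∑ i, C i * p i) * (eta + 2 * M * levelCost M (∑ i, C i * p i)
          ((∑ i, C i) / (2 * M) + eta * K) (eta * K) 2 1) + eta * B * ((k + 1) * (k + 3))))
      C B p := by
  have hCt : 0 ≤ ∑ i, C i := Finset.sum_nonneg fun i _ => hC i
  have hM0 : 0 ≤ M := hr.trans hrM
  set r := ∑ i, C i * p i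
  set Ct := ∑ i, C i
  set a := Ct / (2 * M) + eta * K with ha_def
  set b := eta * K with hb_def
  have hb : 0 ≤ b := mul_nonneg heta (by linarith)
  have ha : 0 ≤ a := add_nonneg (div_nonneg hCt (by linarith)) hb
  have hb_eta : eta ≤ b := le_mul_of_one_le_right heta hK
  set F := Ct + r * (eta + 2 * M * levelCost M r a b 2 1) + eta * B * ((k + 1) * (k + 3))
    with hFdef
  have hden : 0 < 1 - 2 * M + r := by linarith
  have hlc : 0 ≤ 2 * M * levelCost M r a b 2 1 := by
    rcases hM0.eq_or_lt with h | h
    · simp [← h]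
    · exact mul_nonneg (by linarith) (levelCost_nonneg h hr hrM ha hb le_rfl (by norm_num))
  have hpost : postValue M eta (fun _ => 0) (totalCost M r a b F)
      = eta + 2 * M * levelCost M r a b 2 1 := by
    simp [postValue, totalCost]
  refine ⟨fun _ => le_rfl, ?_, ?_, ?_⟩
  · rintro E pos (⟨rfl, -⟩ | ⟨hE, -, hpos, hM0⟩)
    · simp only [totalCost, if_true]
      refine div_nonneg ?_ hden.le
      have : 0 ≤ r * (eta + 2 * M * levelCost M r a b 2 1) := mul_nonneg hr (by linarith)
      have : 0 ≤ eta * B * (((k : ℝ) + 1) * (k + 3)) := by positivity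
      linarith
    · rw [totalCost, if_neg (by omega)]
      exact levelCost_nonneg hM0 hr hrM ha hb hE hpos.le
  · rw [hpost]
    have h1 : totalCost M r a b F 0 0 * (1 - 2 * M + r) = F := by
      simp only [totalCost, if_true]
      field_simp
    apply le_of_eq
    rw [hFdef] at h1
    linarith
  · intro E pos hE h1 h2 hM0
    have hE0 : E ≠ 0 := by omega
    have hE' : (2 : ℝ) ≤ E := by exact_mod_cast hE
    have hρ0 := levelRatio_nonneg hM0 hr hE
    have hρ1 := levelRatio_lt_one hM0 hrM hE
    have hρ : (E - 1) / E * r = M * levelRatio M r E := by unfold levelRatio; field_simp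
    have hstopValue : stopValue eta (fun _ => 0) (totalCost M r a b F) E pos
        ≤ levelCost M r a b E (pos + 1) := by
      simp only [stopValue, hE0, if_false]
      split_ifs with h
      · have h3 := mul_le_mul_of_nonneg_left (levelCost_double_le hM0 hr hrM ha hb hE)
          (survival_mem E).1
        have h4 : 2 * E ≠ 0 := by omega
        have h5 : levelCost M r a b E (pos + 1) = exitCost a b E := by
          rw [h]; exact walkCost_self hρ0 hρ1 (by omega)
        rw [h5]
        simp only [killValue, totalCost, h4, if_false, mul_zero, add_zero, exitCost]
        linarith
      · simp only [totalCost, hE0, if_false, le_refl]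
    have hheadsValue : headsValue M eta (fun _ => 0) (totalCost M r a b F) E pos
        = levelCost M r a b E (pos - 1) := by
      simp only [headsValue, hE0, if_false]
      split_ifs with h
      · subst h; exact walkCost_zero.symm
      · simp only [totalCost, hE0, if_false]
    rw [hheadsValue]
    simp only [totalCost, hE0, if_false]
    obtain ⟨n, rfl⟩ : ∃ n, pos = n + 1 := ⟨pos - 1, by omega⟩
    rw [Nat.add_sub_cancel]
    have hstep : levelCost M r a b E (n + 2) + levelRatio M r E * levelCost M r a b E n
        + 2 * (E - 1) / E * a = (1 + levelRatio M r E) * levelCost M r a b E (n + 1) :=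
      walkCost_step hρ1 n
    have hcost : (E - 1) / E * Ct + eta * B * ((k + 1) * (k + 3))
        ≤ M * (2 * (E - 1) / E * a) := by
      have h3 : M * (2 * (E - 1) / E * a)
          = (E - 1) / E * Ct + 2 * (E - 1) / E * (eta * (M * K)) := by
        rw [ha_def, hb_def]
        field_simp
      have h4 : (1 : ℝ) ≤ 2 * (E - 1) / E := by
        rw [le_div_iff₀ (by linarith)]; linarith
      have h5 : 0 ≤ eta * (M * K) := by positivity
      have h6 := mul_le_mul_of_nonneg_right h4 h5
      have h7 := mul_le_mul_of_nonneg_left (hKM hM0) heta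
      rw [h3]
      linarith
    have h8 := mul_le_mul_of_nonneg_left hstopValue hM0.le
    have h9 : (E - 1) / E * (r * (levelCost M r a b E n - levelCost M r a b E (n + 1)) + 1 * Ct)
        = M * (levelRatio M r E * (levelCost M r a b E n - levelCost M r a b E (n + 1)))
          + (E - 1) / E * Ct := by
      linear_combination (levelCost M r a b E n - levelCost M r a b E (n + 1)) * hρ
    rw [h9]
    have h10 : M * levelCost M r a b E (n + 2) + M * (levelRatio M r E * levelCost M r a b E n)
        + M * (2 * (E - 1) / E * a)
        = M * ((1 + levelRatio M r E) * levelCost M r a b E (n + 1)) := by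
      rw [← hstep]; ring
    linarith

/-- The value of the race bound at the start, split into the cost of the flips and the rest. -/
lemma totalCost_zero_le {Ct T eta K : ℝ} (hCt : 0 ≤ Ct) (hM : M < 1 / 2) (hr : 0 ≤ r)
    (hrM : r ≤ M) (heta : 0 ≤ eta) (hK : 0 ≤ K) :
    (Ct + r * (eta + 2 * M * levelCost M r (Ct / (2 * M) + eta * K) (eta * K) 2 1) + eta * T)
        / (1 - 2 * M + r)
      ≤ (Ct + r * (13 * Ct)) / (1 - 2 * M + r)
        + eta * ((r * (1 + 52 * M * K) + T) / (1 - 2 * M + r)) := by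
  have hden : 0 < 1 - 2 * M + r := by linarith
  have h1 : 2 * M * levelCost M r (Ct / (2 * M) + eta * K) (eta * K) 2 1
      ≤ 13 * Ct + eta * (52 * M * K) := by
    have hb : 0 ≤ eta * K := mul_nonneg heta hK
    -- for `M = 0`, where `Ct / (2 * M)` is a junk value, the walk is never entered
    rcases (hr.trans hrM).eq_or_lt with h | h
    · rw [← h]; simp; linarith
    · have ha : 0 ≤ Ct / (2 * M) + eta * K := by positivity
      have h2 := mul_le_mul_of_nonneg_left (levelCost_two_one_le h hr hrM ha hb)
        (show 0 ≤ 2 * M by linarith)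
      refine h2.trans (le_of_eq ?_)
      field_simp
      ring
  have h2 := mul_le_mul_of_nonneg_left h1 hr
  rw [mul_div_assoc', ← add_div]
  refine div_le_div_of_nonneg_right ?_ hden.le
  linarith

lemma le_smallMeanFlipBound {Ct : ℝ} (hCt : 0 ≤ Ct) (hM : M < 1 / 2) (hr : 0 ≤ r)
    (hrM : r ≤ M) : (Ct + r * (13 * Ct)) / (1 - 2 * M + r) ≤ smallMeanFlipBound Ct M r := by
  have hden : 0 < 1 - 2 * M + r := by linarith
  have h1 : Ct / (1 - 2 * M + r) ≤ Ct / ((1 - 2 * M) * (1 + r)) := by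
    refine div_le_div_of_nonneg_left hCt (mul_pos (by linarith) (by linarith)) ?_
    nlinarith [mul_nonneg (hr.trans hrM) hr]
  have h2 : r * (13 * Ct) / (1 - 2 * M + r) ≤ r * (Ct * (15.2 / (1 - 2 * M + r))) := by
    rw [mul_div_assoc', mul_div_assoc']
    refine div_le_div_of_nonneg_right ?_ hden.le
    refine mul_le_mul_of_nonneg_left ?_ hr
    linarith
  rw [add_div, smallMeanFlipBound]
  linarith

lemma tendsto_smallMeanFlipBound {C : ℝ} {r : ℝ → ℝ}
    (hr : ∀ M, 0 < M → M < 1 / 2 → 0 ≤ r M ∧ r M ≤ M) :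
    Tendsto (fun M => smallMeanFlipBound C M (r M)) (𝓝[>] 0) (𝓝 C) := by
  have hM : Tendsto (fun M : ℝ => M) (𝓝[>] 0) (𝓝 0) :=
    tendsto_nhdsWithin_of_tendsto_nhds tendsto_id
  have hev : ∀ᶠ M : ℝ in 𝓝[>] 0, 0 < M ∧ M < 1 / 2 :=
    Ioo_mem_nhdsGT (by norm_num)
  have hr0 : Tendsto r (𝓝[>] 0) (𝓝 0) :=
    tendsto_of_tendsto_of_tendsto_of_le_of_le' tendsto_const_nhds hM
      (hev.mono fun M h => (hr M h.1 h.2).1) (hev.mono fun M h => (hr M h.1 h.2).2)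
  have h1 : Tendsto (fun M => 1 - 2 * M) (𝓝[>] (0 : ℝ)) (𝓝 (1 - 2 * 0)) :=
    tendsto_const_nhds.sub (hM.const_mul 2)
  have h2 : Tendsto (fun M => C / ((1 - 2 * M) * (1 + r M))) (𝓝[>] 0)
      (𝓝 (C / ((1 - 2 * 0) * (1 + 0)))) :=
    tendsto_const_nhds.div (h1.mul (tendsto_const_nhds.add hr0)) (by norm_num)
  have h3 : Tendsto (fun M => r M * (C * (15.2 / (1 - 2 * M + r M)))) (𝓝[>] 0)
      (𝓝 (0 * (C * (15.2 / (1 - 2 * 0 + 0))))) :=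
    hr0.mul (tendsto_const_nhds.mul (tendsto_const_nhds.div (h1.add hr0) (by norm_num)))
  simpa [smallMeanFlipBound] using h2.add h3

end

/-! ### Conclusion -/

lemma compiledInstr_factory_eq_halt {k : ℕ} {s : FactoryState × ℕ × ℕ × Bool} {C : Fin k → ℝ}
    {M : ℝ} {c : Fin k → ℕ → ℕ} {b : Bool}
    (hs : (factory k).compiledInvariant C M (factoryInvariant c M) s)
    (h : (factory k).compiledInstr s = .halt b) : s.1 = .halt b := by
  obtain ⟨s, j, a, d⟩ := s
  have hI : factoryInvariant c M s := hs.1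
  change (match factoryInstr k s with
    | .inl i => i
    | .inr q => if d = true then .digit else q.readInstr (q.precision j)) = CoinInstr.halt b at h
  have hquery : ∀ q : BernoulliQuery k,
      (if d = true then .digit else q.readInstr (q.precision j)) ≠ CoinInstr.halt b := by
    intro q hq
    rcases d with _ | _
    · rcases hz : q.1 with _ | _ <;> simp [BernoulliQuery.readInstr, hz] at hq
    · simp at hq
  rcases s with ⟨i, B⟩ | ⟨E, pos, i, B⟩ | ⟨E, pos, i, B⟩ | ⟨E, pos, i, B⟩ | B | ⟨E, B⟩ | b' <;>
    simp only [factoryInstr] at h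
  · rcases hi : finOption k i with _ | j <;> simp [hi] at h
  · exact absurd h (hquery _)
  · exact absurd h (hquery _)
  · obtain ⟨-, hik, hi0, -⟩ := hI
    have hlt : i - 1 < k := by omega
    have hopt : finOption k (i - 1) = some ⟨i - 1, hlt⟩ := finOption_val (⟨i - 1, hlt⟩ : Fin k)
    simp [hopt] at h
  · exact absurd h (hquery _)
  · exact absurd h (hquery _)
  · simp only [CoinInstr.halt.injEq] at h
    rw [h]

section Conclusion

variable {k : ℕ} {C : Fin k → ℝ} {M : ℝ} {c : Fin k → ℕ → ℕ} {m : ℕ → ℕ} {p : Fin k → ℝ}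
  {Ω : Type*} [MeasurableSpace Ω] {μ : Measure Ω} [IsProbabilityMeasure μ]
  {U : Ω → ℝ} {X : Fin k → ℕ → Ω → Bool}

lemma factory_measure_outputs_le (hC : ∀ i, 0 ≤ C i) (hM : M < 1 / 2)
    (hc : ∀ i, IsRealName (c i) (C i)) (hm : IsRealName m M)
    (hp : ∀ i, p i ∈ Set.Icc (0 : ℝ) 1) (hrM : ∑ i, C i * p i ≤ M)
    (h : IsCoinModel μ p U X) {out : Bool → ℝ} (hout : ∀ b, 0 ≤ out b) {b : Bool}
    (hb : out b = 1) :
    μ {ω | (factory k).compile.Outputs c m (U ω) (fun i j => X i j ω) b}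
      ≤ ENNReal.ofReal (out false + (out true - out false) * ∑ i, C i * p i) := by
  have hr : 0 ≤ ∑ i, C i * p i := Finset.sum_nonneg fun i _ => mul_nonneg (hC i) (hp i).1
  have hsuper := (isRaceBound_trueProbability (C := C) (p := p) hM hr hrM (partialBound c k)
    hout).isSupersolution (m := m) hC (hr.trans hrM) hM hc hp le_rfl le_rfl
  have hcomp := hsuper.compile hc hm hp le_rfl
  rw [zero_div] at hcomp
  refine (hcomp.measure_outputs_le h hp (b := b) fun s hs hhalt => ?_).trans
    (ENNReal.ofReal_le_ofReal ?_)
  · have h1 := compiledInstr_factory_eq_halt hs hhalt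
    obtain ⟨s, j, a, d⟩ := s
    obtain rfl : s = .halt b := h1
    simp [BernoulliMachine.compiledBound, factory, factoryInstr, factoryValue, hb]
  · refine (hsuper.compiledBound_fresh_le le_rfl hsuper.start).trans (le_of_eq ?_)
    simp [factory, factoryValue, trueProbability]

lemma factory_halts_and_flips_le (hC : ∀ i, 0 ≤ C i) (hM : M < 1 / 2)
    (hc : ∀ i, IsRealName (c i) (C i)) (hm : IsRealName m M)
    (hp : ∀ i, p i ∈ Set.Icc (0 : ℝ) 1) (hrM : ∑ i, C i * p i ≤ M)
    (h : IsCoinModel μ p U X) :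
    1 ≤ μ {ω | (factory k).compile.Outputs c m (U ω) (fun i j => X i j ω) true}
        + μ {ω | (factory k).compile.Outputs c m (U ω) (fun i j => X i j ω) false} ∧
      ∫⁻ ω, (factory k).compile.totalFlips c m (U ω) (fun i j => X i j ω) ∂μ
        ≤ ENNReal.ofReal (smallMeanFlipBound (∑ i, C i) M (∑ i, C i * p i)) := by
  have hr : 0 ≤ ∑ i, C i * p i := Finset.sum_nonneg fun i _ => mul_nonneg (hC i) (hp i).1
  have hCt : 0 ≤ ∑ i, C i := Finset.sum_nonneg fun i _ => hC i
  have hM0 : 0 ≤ M := hr.trans hrM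
  set T : ℝ := partialBound c k * (((k : ℝ) + 1) * (k + 3)) with hT
  have hT0 : 0 ≤ T := by positivity
  -- for `M = 0` the value of `K` is irrelevant, since only the initial race takes place
  set K : ℝ := 1 + T / M
  have hK : 1 ≤ K := by
    have : 0 ≤ T / M := div_nonneg hT0 hM0
    linarith
  have hKM : 0 < M → T ≤ M * K := by
    intro hM0
    have : M * K = M + T := by simp only [K]; field_simp
    linarith
  have hcomp := fun (eta : ℝ) (heta : 0 ≤ eta) =>
    (isRaceBound_totalCost hC hM hr hrM (partialBound c k) heta hK hKM).isSupersolution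
      (m := m) hC hM0 hM hc hp zero_le_one heta
  refine ⟨((hcomp 1 zero_le_one).compile hc hm hp zero_le_one).one_le_measure_outputs h hp
    zero_le_one (by norm_num), ?_⟩
  set K' := ((∑ i, C i * p i) * (1 + 52 * M * K) + T) / (1 - 2 * M + ∑ i, C i * p i) + (k + 1)
  set F := smallMeanFlipBound (∑ i, C i) M (∑ i, C i * p i) with hF
  have hle : ∀ eta : ℝ, 0 < eta →
      ∫⁻ ω, (factory k).compile.totalFlips c m (U ω) (fun i j => X i j ω) ∂μ
        ≤ ENNReal.ofReal (F + eta * K') := by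
    intro eta heta
    have hsuper := hcomp eta heta.le
    refine ((hsuper.compile hc hm hp heta.le).lintegral_totalFlips_le h hp
      (by positivity)).trans (ENNReal.ofReal_le_ofReal ?_)
    refine (hsuper.compiledBound_fresh_le heta.le hsuper.start).trans ?_
    have h1 := totalCost_zero_le (T := T) hCt hM hr hrM heta.le (zero_le_one.trans hK)
    have h2 := le_smallMeanFlipBound hCt hM hr hrM
    change totalCost M _ _ _ _ 0 0 + eta * ((k : ℝ) + 1 - (0 : ℕ)) ≤ F + eta * K'
    simp only [totalCost, if_true]
    rw [mul_assoc eta, ← hT]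
    push_cast
    simp only [K']
    linarith
  have hlim : Tendsto (fun eta : ℝ => ENNReal.ofReal (F + eta * K')) (𝓝[>] 0)
      (𝓝 (ENNReal.ofReal (F + 0 * K'))) :=
    ENNReal.tendsto_ofReal (tendsto_const_nhds.add
      ((tendsto_nhdsWithin_of_tendsto_nhds tendsto_id).mul tendsto_const_nhds))
  rw [zero_mul, add_zero] at hlim
  exact ge_of_tendsto hlim (eventually_nhdsWithin_of_forall fun eta heta => hle eta heta)

lemma factory_measure_outputs_eq (hC : ∀ i, 0 ≤ C i) (hM : M < 1 / 2)
    (hc : ∀ i, IsRealName (c i) (C i)) (hm : IsRealName m M)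
    (hp : ∀ i, p i ∈ Set.Icc (0 : ℝ) 1) (hrM : ∑ i, C i * p i ≤ M)
    (h : IsCoinModel μ p U X) :
    μ {ω | (factory k).compile.Outputs c m (U ω) (fun i j => X i j ω) true}
        = ENNReal.ofReal (∑ i, C i * p i) ∧
      μ {ω | (factory k).compile.Outputs c m (U ω) (fun i j => X i j ω) false}
        = ENNReal.ofReal (1 - ∑ i, C i * p i) := by
  have hr : 0 ≤ ∑ i, C i * p i := Finset.sum_nonneg fun i _ => mul_nonneg (hC i) (hp i).1
  have h1 := factory_measure_outputs_le hC hM hc hm hp hrM h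
    (out := fun b => if b = true then 1 else 0) (b := true)
    (by rintro (_ | _) <;> norm_num) (by simp)
  have h2 := factory_measure_outputs_le hC hM hc hm hp hrM h
    (out := fun b => if b = true then 0 else 1) (b := false)
    (by rintro (_ | _) <;> norm_num) (by simp)
  have h3 := (factory_halts_and_flips_le hC hM hc hm hp hrM h).1
  simp only [Bool.false_eq_true, if_false, if_true, sub_zero, one_mul, zero_add, zero_sub,
    neg_mul, ← sub_eq_add_neg] at h1 h2
  have hsum : ENNReal.ofReal (∑ i, C i * p i) + ENNReal.ofReal (1 - ∑ i, C i * p i) = 1 := by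
    rw [← ENNReal.ofReal_add hr (by linarith)]; simp
  refine ⟨le_antisymm h1 ?_, le_antisymm h2 ?_⟩
  · refine (ENNReal.add_le_add_iff_right (ENNReal.ofReal_ne_top
      (r := 1 - ∑ i, C i * p i))).1 ?_
    rw [hsum]
    exact h3.trans (add_le_add le_rfl h2)
  · refine (ENNReal.add_le_add_iff_left (ENNReal.ofReal_ne_top
      (r := ∑ i, C i * p i))).1 ?_
    rw [hsum]
    exact h3.trans (add_le_add h1 le_rfl)

end Conclusion

theorem theorem1 (k : ℕ) :
    (∃ A : CoinAlgorithm k,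
      ∀ (C : Fin k → ℝ) (M : ℝ), (∀ i, 0 ≤ C i) → M < 1 / 2 →
      ∀ (c : Fin k → ℕ → ℕ) (m : ℕ → ℕ), (∀ i, IsRealName (c i) (C i)) → IsRealName m M →
      ∀ p : Fin k → ℝ, (∀ i, p i ∈ Set.Icc (0 : ℝ) 1) → ∑ i, C i * p i ≤ M →
      ∀ (Ω : Type*) [MeasurableSpace Ω] (μ : Measure Ω) [IsProbabilityMeasure μ]
        (U : Ω → ℝ) (X : Fin k → ℕ → Ω → Bool), IsCoinModel μ p U X →
        μ {ω | A.Outputs c m (U ω) (fun i j => X i j ω) true}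
            = ENNReal.ofReal (∑ i, C i * p i) ∧
        μ {ω | A.Outputs c m (U ω) (fun i j => X i j ω) false}
            = ENNReal.ofReal (1 - ∑ i, C i * p i) ∧
        ∫⁻ ω, A.totalFlips c m (U ω) (fun i j => X i j ω) ∂μ
            ≤ ENNReal.ofReal (smallMeanFlipBound (∑ i, C i) M (∑ i, C i * p i))) ∧
    (∀ (C : ℝ) (r : ℝ → ℝ), 0 ≤ C → (∀ M, 0 < M → M < 1 / 2 → 0 ≤ r M ∧ r M ≤ M) →
      Tendsto (fun M => smallMeanFlipBound C M (r M)) (𝓝[>] 0) (𝓝 C)) := by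
  refine ⟨⟨(factory k).compile, ?_⟩, fun C r _ hr => tendsto_smallMeanFlipBound hr⟩
  intro C M hC hM c m hc hm p hp hrM Ω _ μ _ U X h
  obtain ⟨h1, h2⟩ := factory_measure_outputs_eq hC hM hc hm hp hrM h
  exact ⟨h1, h2, (factory_halts_and_flips_le hC hM hc hm hp hrM h).2⟩
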